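/- **Conventions.** $\mathcal L$ is the first-order language with equality, constants $0,1$ and binary function symbols $+,\cdot$; $x\le y$ is a shorthand for $\exists z\,(x+z^2=y)$, $x<y$ for $x\le y\wedge x\ne y$, and $2$ for $1+1$. $\mathsf{RCF}^-$ consists of the field axioms and the axioms saying that $\le$ is a linear order compatible with the field operations. $\mathsf{RCF}$ is $\mathsf{RCF}^-$ together with $\forall z\ge 0\,\exists x\; x^2=z$ and, for each odd $m$, the degree-$m$ axiom $\forall a_0,\dots,a_{m-1}\,\exists x\;x^m+a_{m-1}x^{m-1}+\dots+a_0=0$. $\mathsf{Tarski}$ is $\mathsf{RCF}^-$ together with the least upper bound axiom (universally closed over parameters) for every formula $\varphi(x)$: $\exists d\,\varphi(d)\wedge\exists b\,\forall x(\varphi(x)\to x\le b)\ \to\ \exists c\big(\forall x(\varphi(x)\to x\le c)\wedge\forall b(\forall x(\varphi(x)\to x\le b)\to c\le b)\big)$. The size of a formula or proof is its number of symbols; proofs are formalized in natural deduction. A measure of proof length assigns to every theory and sentence the length of a shortest proof ($\infty$ if there is none); two measures are polynomially equivalent if each is bounded by one fixed polynomial (independent of theory and sentence) in the other. $\mathit{Pow}_n(x,y,z)$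 are formulas of size polynomial in $n$ such that $\mathit{Pow}_0(x,y,z)$ is equivalent to $(y=0\to z=1)\wedge(y=1\to z=x)\wedge(y=2\to z=x\cdot x)\wedge\neg(y\ne0\wedge y\ne1\wedge y\ne2)$ and, abbreviating $D_n(y):=\mathit{Pow}_n(1,y,1)$, $\mathit{Pow}_{n+1}(x,y,z)$ is equivalent (given $0\neq1$) to the conjunction of $\exists y_1\big(D_n(y_1)\wedge\forall y_2(D_n(y_2)\to y_2\le y_1)\wedge y\le y_1\cdot y_1\big)$, $D_n(y)\to \mathit{Pow}_n(x,y,z)$, and $\neg D_n(y)\to\exists y_3,y_4,y_5,z_2,z_3,z_4\big(D_n(y_3)\wedge D_n(y_4)\wedge D_n(y_5)\wedge y=y_3y_4+y_5\wedge\mathit{Pow}_n(x,y_3,z_2)\wedge\mathit{Pow}_n(z_2,y_4,z_3)\wedge\mathit{Pow}_n(x,y_5,z_4)\wedge z=z_3z_4\big)$; they are obtained by the standard device that replaces the recursion step by an equivalent one in which the previous formula occurs only once (in ordered fields $\mathit{Pow}_n(x,y,z)$ says that $y$ is a natural number, $y\le2^{2^n}$ and $x^y=z$). $\mathit{Hyp}_n(y)$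 is the conjunction of (1) $\exists x,z\,(1<x\wedge\mathit{Pow}_n(x,y,z)\wedge z\le2)$, (2) $\forall x,x_1>1\,\forall z,z_1\big(\mathit{Pow}_n(x,y,z)\wedge\mathit{Pow}_n(x_1,y,z_1)\to z>x\wedge(z_1>z\to x_1>x)\big)$, (3) $\forall c_1,c_2>1\big(c_1\ne c_2\to\exists x_0,c_0(\mathit{Pow}_n(x_0,y,c_0)\wedge(c_1<c_0<c_2\vee c_2<c_0<c_1)\wedge x_0>1)\big)$, and $\mathit{Root}_n$ is the sentence $\forall y\big(\mathit{Hyp}_n(y)\to\neg(y>1)\vee\exists r\,\mathit{Pow}_n(r,y,2)\big)$. **Theorem (Speedup).** (1) There is a polynomial $p$ such that for every $n$ the sentence $\mathit{Root}_n$ has size at most $p(n)$ and a proof in $\mathsf{Tarski}$ of size at most $p(n)$. (2) Every $\mathit{Root}_n$ is provable in $\mathsf{RCF}$. For $n\ge1$, every proof of $\mathit{Root}_n$ in $\mathsf{RCF}$ uses a degree-$m$ axiom for some odd $m>2^{2^n-1}$, hence an odd-degree axiom of size at least $2^{2^n-1}$. For every $n\ge0$, every proof of $\mathit{Root}_n$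 in $\mathsf{RCF}$ has size greater than $2^{2^n-1}$. (3) $\mathsf{Tarski}$ has a $2^{2^{x^\varepsilon}}$ speedup over $\mathsf{RCF}$, witnessed by $(\mathit{Root}_n)_n$: for every measure of proof length that is polynomially equivalent to natural deduction there is $\varepsilon>0$ such that, if $a_n$ and $b_n$ denote the lengths of shortest proofs of $\mathit{Root}_n$ in $\mathsf{Tarski}$ and in $\mathsf{RCF}$, then $a_n,b_n<\infty$ for all $n$, $a_n\to\infty$, and $b_n\ge 2^{2^{a_n^{\varepsilon}}}$ for all sufficiently large $n$. -/

import Mathlib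

open FirstOrder FirstOrder.Language Filter

namespace SpeedupRCF

/-! ## Formal proofs and their sizes

First-order syntax and semantics are Mathlib's. The primitive logical symbols are falsum, equality,
implication and the universal quantifier; all other connectives are abbreviations. -/

section ProofSystem

universe u v

variable {L : FirstOrder.Language.{u, v}} {α : Type}

/-- The number of symbols of a term. -/
def termSize : L.Term α → ℕ
  | .var _ => 1
  | .func _ ts => 1 + ∑ i, termSize (ts i)

/-- The number of symbols of a formula. -/
def formulaSize : ∀ {n : ℕ}, L.BoundedFormula α n → ℕ
  | _, .falsum => 1
  | _, .equal t s => 1 + termSize t + termSize s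
  | _, .rel _ ts => 1 + ∑ i, termSize (ts i)
  | _, .imp φ ψ => 1 + formulaSize φ + formulaSize ψ
  | _, .all φ => 1 + formulaSize φ

/-- `instantiate φ t` is `φ(t)`: the bound variable `&0` is replaced by the term `t`, whose
variables are free variables (capture is impossible). -/
def instantiate (φ : L.BoundedFormula ℕ 1) (t : L.Term ℕ) : L.Formula ℕ :=
  φ.toFormula.subst (Sum.elim Term.var fun _ => t)

/-- Rename every free variable `x_i` to `x_{i+1}`, so that `x_0` becomes fresh. -/
def shift {n : ℕ} (φ : L.BoundedFormula ℕ n) : L.BoundedFormula ℕ n :=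
  φ.subst fun i => Term.var (i + 1)

/-- A sentence regarded as a formula (without free variables) over the variables `x_0, x_1, …`. -/
def ofSentence (φ : L.Sentence) : L.Formula ℕ :=
  φ.subst fun i => i.elim

/-- Natural deduction for classical first-order logic with equality. An element of
`Derivation T Γ φ` is a derivation tree of `φ` from the open assumptions `Γ` and axioms from `T`. In
the introduction rule for `∀` the eigenvariable is `x_0`, made fresh by shifting the assumptions. -/
inductive Derivation (T : L.Theory) : List (L.Formula ℕ) → L.Formula ℕ → Type (max u v)
  | axm (Γ : List (L.Formula ℕ)) (φ : L.Sentence) (h : φ ∈ T) : Derivation T Γ (ofSentence φ)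
  | hyp (Γ : List (L.Formula ℕ)) (φ : L.Formula ℕ) (h : φ ∈ Γ) : Derivation T Γ φ
  | impI (Γ : List (L.Formula ℕ)) (φ ψ : L.Formula ℕ) (d : Derivation T (φ :: Γ) ψ) :
      Derivation T Γ (φ ⟹ ψ)
  | impE (Γ : List (L.Formula ℕ)) (φ ψ : L.Formula ℕ) (d : Derivation T Γ (φ ⟹ ψ))
      (e : Derivation T Γ φ) : Derivation T Γ ψ
  | raa (Γ : List (L.Formula ℕ)) (φ : L.Formula ℕ) (d : Derivation T (∼φ :: Γ) ⊥) :
      Derivation T Γ φ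
  | allI (Γ : List (L.Formula ℕ)) (φ : L.BoundedFormula ℕ 1)
      (d : Derivation T (Γ.map shift) (instantiate (shift φ) (Term.var 0))) :
      Derivation T Γ (∀' φ)
  | allE (Γ : List (L.Formula ℕ)) (φ : L.BoundedFormula ℕ 1) (t : L.Term ℕ)
      (d : Derivation T Γ (∀' φ)) : Derivation T Γ (instantiate φ t)
  | eqI (Γ : List (L.Formula ℕ)) (t : L.Term ℕ) : Derivation T Γ (Term.equal t t)
  | eqE (Γ : List (L.Formula ℕ)) (φ : L.BoundedFormula ℕ 1) (t s : L.Term ℕ)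
      (d : Derivation T Γ (Term.equal t s)) (e : Derivation T Γ (instantiate φ t)) :
      Derivation T Γ (instantiate φ s)

/-- The number of symbols of the sequent `Γ ⊢ φ`. -/
def sequentSize (Γ : List (L.Formula ℕ)) (φ : L.Formula ℕ) : ℕ :=
  1 + (Γ.map formulaSize).sum + formulaSize φ

/-- The size of a derivation: the number of symbols of all sequents in the tree. -/
def Derivation.size {T : L.Theory} :
    ∀ {Γ : List (L.Formula ℕ)} {φ : L.Formula ℕ}, Derivation T Γ φ → ℕ
  | _, _, .axm Γ φ _ => sequentSize Γ (ofSentence φ)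
  | _, _, .hyp Γ φ _ => sequentSize Γ φ
  | _, _, .impI Γ φ ψ d => sequentSize Γ (φ ⟹ ψ) + d.size
  | _, _, .impE Γ _ ψ d e => sequentSize Γ ψ + d.size + e.size
  | _, _, .raa Γ φ d => sequentSize Γ φ + d.size
  | _, _, .allI Γ φ d => sequentSize Γ (∀' φ) + d.size
  | _, _, .allE Γ φ t d => sequentSize Γ (instantiate φ t) + d.size
  | _, _, .eqI Γ t => sequentSize Γ (Term.equal t t)
  | _, _, .eqE Γ φ _ s d e => sequentSize Γ (instantiate φ s) + d.size + e.size

/-- The axioms of `T` that occur in a derivation. -/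
def Derivation.usedAxioms {T : L.Theory} :
    ∀ {Γ : List (L.Formula ℕ)} {φ : L.Formula ℕ}, Derivation T Γ φ → Set L.Sentence
  | _, _, .axm _ φ _ => {φ}
  | _, _, .hyp _ _ _ => ∅
  | _, _, .impI _ _ _ d => d.usedAxioms
  | _, _, .impE _ _ _ d e => d.usedAxioms ∪ e.usedAxioms
  | _, _, .raa _ _ d => d.usedAxioms
  | _, _, .allI _ _ d => d.usedAxioms
  | _, _, .allE _ _ _ d => d.usedAxioms
  | _, _, .eqI _ _ => ∅
  | _, _, .eqE _ _ _ _ d e => d.usedAxioms ∪ e.usedAxioms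

/-- A proof of the sentence `φ` in the theory `T`. -/
abbrev Proof (T : L.Theory) (φ : L.Sentence) : Type (max u v) :=
  Derivation T [] (ofSentence φ)

/-- A measure of proof length: it assigns to a theory `T` and a sentence `φ` the length of a shortest
proof of `φ` in `T`, and `⊤` if there is no proof. -/
abbrev LengthMeasure (L : FirstOrder.Language.{u, v}) := L.Theory → L.Sentence → ℕ∞

/-- The length of a shortest proof in natural deduction. -/
noncomputable def proofLength : LengthMeasure L := fun T φ => ⨅ d : Proof T φ, (d.size : ℕ∞)

/-- Two measures of proof length (that is, two proof systems) are polynomially equivalent: every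
proof in one system can be turned into a proof in the other one that is at most polynomially longer,
for a polynomial that does not depend on the theory or on the sentence. -/
def PolyEquivalent (ℓ ℓ' : LengthMeasure L) : Prop :=
  ∃ q : Polynomial ℕ, ∀ (T : L.Theory) (φ : L.Sentence) (k : ℕ),
    (ℓ T φ ≤ k → ℓ' T φ ≤ (q.eval k : ℕ)) ∧ (ℓ' T φ ≤ k → ℓ T φ ≤ (q.eval k : ℕ))

/-- `T` has a speedup of magnitude `f` over `U`, and the sentences `φ i` witness it: they are
provable in both theories, their shortest proofs in `T` have lengths `a i` tending to infinity, and
their shortest proofs in `U` have lengths `b i ≥ f (a i)` for all large `i`. -/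
def HasSpeedupVia (ℓ : LengthMeasure L) (f : ℝ → ℝ) (T U : L.Theory) (φ : ℕ → L.Sentence) : Prop :=
  ∃ a b : ℕ → ℕ, (∀ i, ℓ T (φ i) = a i ∧ ℓ U (φ i) = b i) ∧
    Tendsto a atTop atTop ∧ ∀ᶠ i in atTop, f (a i) ≤ b i

end ProofSystem

/-! ## The language with `0`, `1`, `+`, `·` -/

/-- The function symbols `0`, `1`, `+`, `·`. -/
inductive RcfFunc : ℕ → Type
  | zero : RcfFunc 0
  | one : RcfFunc 0
  | add : RcfFunc 2
  | mul : RcfFunc 2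

/-- The language of real closed fields: `0`, `1`, `+`, `·` and equality only. -/
def lang : FirstOrder.Language := ⟨RcfFunc, fun _ => Empty⟩

section Terms

variable {α : Type}

instance : Zero (lang.Term α) := ⟨Constants.term (L := lang) RcfFunc.zero⟩
instance : One (lang.Term α) := ⟨Constants.term (L := lang) RcfFunc.one⟩
instance : Add (lang.Term α) := ⟨Functions.apply₂ (L := lang) RcfFunc.add⟩
instance : Mul (lang.Term α) := ⟨Functions.apply₂ (L := lang) RcfFunc.mul⟩

/-- The term `1 + 1`. -/
def two : lang.Term α := 1 + 1

/-- `t ^ i` as the product `t · t ⋯ t`. -/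
def powTerm (t : lang.Term α) : ℕ → lang.Term α
  | 0 => 1
  | 1 => t
  | i + 2 => powTerm t (i + 1) * t

/-- `a · t ^ i`, which is just `a` for `i = 0`. -/
def monomialTerm (a t : lang.Term α) : ℕ → lang.Term α
  | 0 => a
  | i + 1 => a * powTerm t (i + 1)

variable {n : ℕ}

/-- Move a term from a context with `n` bound variables under one more quantifier. -/
def lift (t : lang.Term (α ⊕ Fin n)) : lang.Term (α ⊕ Fin (n + 1)) :=
  t.relabel (Sum.map id Fin.castSucc)

/-- `t ≤ s`, a shorthand for `∃ z, t + z² = s`. -/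
def le (t s : lang.Term (α ⊕ Fin n)) : lang.BoundedFormula α n :=
  ∃' ((lift t + &(Fin.last n) * &(Fin.last n)) =' lift s)

/-- `t < s`, a shorthand for `t ≤ s ∧ t ≠ s`. -/
def lt (t s : lang.Term (α ⊕ Fin n)) : lang.BoundedFormula α n :=
  le t s ⊓ ∼(t =' s)

/-- `φ(t_0, …, t_{k-1})` for a formula `φ` with free variables indexed by `Fin k`, in a context with
`n` bound variables. -/
def app {k : ℕ} (φ : lang.Formula (Fin k)) (ts : Fin k → lang.Term (α ⊕ Fin n)) :
    lang.BoundedFormula α n :=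
  BoundedFormula.relabel (id : α ⊕ Fin n → α ⊕ Fin n) (φ.subst ts : lang.Formula (α ⊕ Fin n))

/-- A block of `k` existential quantifiers. -/
def exBlock {k : ℕ} (φ : lang.Formula (α ⊕ Fin k)) : lang.Formula α :=
  (BoundedFormula.relabel (id : α ⊕ Fin k → α ⊕ Fin k) φ : lang.BoundedFormula α (k + 0)).exs

/-- A block of `k` universal quantifiers. -/
def allBlock {k : ℕ} (φ : lang.Formula (α ⊕ Fin k)) : lang.Formula α :=
  (BoundedFormula.relabel (id : α ⊕ Fin k → α ⊕ Fin k) φ : lang.BoundedFormula α (k + 0)).alls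

end Terms

/-! ## The theories -/

/-- The axioms of fields. -/
def fieldAxioms : lang.Theory :=
  { ∀' ∀' ∀' (((&0 + &1) + &2) =' (&0 + (&1 + &2))),
    ∀' ∀' ((&0 + &1) =' (&1 + &0)),
    ∀' ((&0 + 0) =' &0),
    ∀' ∃' ((&0 + &1) =' 0),
    ∀' ∀' ∀' (((&0 * &1) * &2) =' (&0 * (&1 * &2))),
    ∀' ∀' ((&0 * &1) =' (&1 * &0)),
    ∀' ((&0 * 1) =' &0),
    ∀' (∼(&0 =' 0) ⟹ ∃' ((&0 * &1) =' 1)),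
    ∀' ∀' ∀' ((&0 * (&1 + &2)) =' (&0 * &1 + &0 * &2)),
    ∼(0 =' 1) }

/-- `≤` is a linear order compatible with the field operations. -/
def orderAxioms : lang.Theory :=
  { ∀' le &0 &0,
    ∀' ∀' ((le &0 &1 ⊓ le &1 &0) ⟹ (&0 =' &1)),
    ∀' ∀' ∀' ((le &0 &1 ⊓ le &1 &2) ⟹ le &0 &2),
    ∀' ∀' (le &0 &1 ⊔ le &1 &0),
    ∀' ∀' ∀' (le &0 &1 ⟹ le (&0 + &2) (&1 + &2)),
    ∀' ∀' ((le 0 &0 ⊓ le 0 &1) ⟹ le 0 (&0 * &1)) }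

/-- The base theory of ordered fields. -/
def rcfMinus : lang.Theory := fieldAxioms ∪ orderAxioms

/-- `∀ z ≥ 0, ∃ x, x² = z`. -/
def sqrtAxiom : lang.Sentence :=
  ∀' (le 0 &0 ⟹ ∃' ((&1 * &1) =' &0))

/-- The term `x^d + a_{d-1} x^{d-1} + ⋯ + a_0`, where `a_i` is `&i` and `x` is `&d`. -/
def monicPoly (d : ℕ) : lang.Term (Empty ⊕ Fin (d + 1)) :=
  ((List.finRange d).reverse.map fun i : Fin d => monomialTerm (&(Fin.castSucc i)) (&(Fin.last d)) (i : ℕ)).foldl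
    (· + ·) (powTerm (&(Fin.last d)) d)

/-- `∀ a_0, …, a_{d-1}, ∃ x, x^d + a_{d-1} x^{d-1} + ⋯ + a_0 = 0`. -/
def rootAxiom (d : ℕ) : lang.Sentence :=
  (∃' (monicPoly d =' 0) : lang.BoundedFormula Empty d).alls

/-- The theory of ordered fields with square roots and with roots of odd-degree polynomials. -/
def rcf : lang.Theory :=
  rcfMinus ∪ {sqrtAxiom} ∪ {ψ | ∃ d : ℕ, Odd d ∧ ψ = rootAxiom d}

/-- The least upper bound axiom for a formula `φ(p_0, …, p_{k-1}, x)`, whose last variable is `x`: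
`(∃ d, φ d) ∧ (∃ b, ∀ x, φ x → x ≤ b) →
  ∃ c, (∀ x, φ x → x ≤ c) ∧ ∀ b, (∀ x, φ x → x ≤ b) → c ≤ b`,
where the parameters `p_0, …, p_{k-1}` are universally quantified. -/
def lubAxiom {k : ℕ} (φ : lang.Formula (Fin (k + 1))) : lang.Sentence :=
  let φ_ {n : ℕ} (t : lang.Term (Fin k ⊕ Fin n)) : lang.BoundedFormula (Fin k) n :=
    app φ (Fin.snoc (α := fun _ => lang.Term (Fin k ⊕ Fin n)) (fun i => .var (.inl i)) t)
  let body : lang.Formula (Fin k) :=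
    ((∃' (φ_ &0)) ⊓ (∃' ∀' (φ_ &1 ⟹ le &1 &0))) ⟹
      ∃' ((∀' (φ_ &1 ⟹ le &1 &0)) ⊓ ∀' ((∀' (φ_ &2 ⟹ le &2 &1)) ⟹ le &0 &1))
  allBlock (body.relabel Sum.inr)

/-- The theory of ordered fields with the least upper bound schema. -/
def tarski : lang.Theory :=
  rcfMinus ∪ {ψ | ∃ (k : ℕ) (φ : lang.Formula (Fin (k + 1))), ψ = lubAxiom φ}

/-! ## Bounded exponentiation

`powFormula n` expresses that `y` is a natural number, `y ≤ 2^(2^n)` and `x^y = z`. It is defined by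
iterating a step `R ↦ Φ(R)` in which `R` occurs several times. To keep the size of the
formulas linear in `n`, the iteration is performed on the graph of the truth value of the relation,
with a step in which the previous formula occurs only once. `powRel_zero` and `powRel_succ`
below verify the intended recursion. -/

section Pow

variable {α : Type}

/-- `t ≤ s` for terms without bound variables. -/
def leF (t s : lang.Term α) : lang.Formula α :=
  le (n := 0) (t.relabel Sum.inl) (s.relabel Sum.inl)

/-- `(y = 0 → z = 1) ∧ (y = 1 → z = x) ∧ (y = 2 → z = x · x) ∧ ¬ (y ≠ 0 ∧ y ≠ 1 ∧ y ≠ 2)`. -/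
def powBase (x y z : lang.Term α) : lang.Formula α :=
  (y.equal 0 ⟹ z.equal 1) ⊓ (y.equal 1 ⟹ z.equal x) ⊓ (y.equal two ⟹ z.equal (x * x)) ⊓
    ∼(∼(y.equal 0) ⊓ ∼(y.equal 1) ⊓ ∼(y.equal two))

/-- The ten triples at which the recursion step uses the previous relation. The entries of `b` are
`y₁, y₃, y₄, y₅, z₂, z₃, z₄`, and `y₂` is the other quantified variable. -/
def powQuery (x y z : lang.Term α) (b : Fin 7 → lang.Term α) (y₂ : lang.Term α) :
    Fin 10 → Fin 3 → lang.Term α :=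
  let y₁ := b 0; let y₃ := b 1; let y₄ := b 2; let y₅ := b 3
  let z₂ := b 4; let z₃ := b 5; let z₄ := b 6
  ![ ![1, y₁, 1], ![1, y₂, 1], ![1, y, 1], ![x, y, z], ![1, y₃, 1], ![1, y₄, 1], ![1, y₅, 1],
    ![x, y₃, z₂], ![z₂, y₄, z₃], ![x, y₅, z₄] ]

/-- The quantifier-free part of the recursion step, with the formulas `A i` in place of the ten
uses of the previous relation. -/
def powMatrix (y z : lang.Term α) (b : Fin 7 → lang.Term α) (y₂ : lang.Term α)
    (A : Fin 10 → lang.Formula α) : lang.Formula α :=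
  let y₁ := b 0; let y₃ := b 1; let y₄ := b 2; let y₅ := b 3
  let z₃ := b 5; let z₄ := b 6
  (A 0 ⊓ (A 1 ⟹ leF y₂ y₁) ⊓ leF y (y₁ * y₁)) ⊓
  (A 2 ⟹ A 3) ⊓
  (∼(A 2) ⟹ (A 4 ⊓ A 5 ⊓ A 6 ⊓ y.equal (y₃ * y₄ + y₅) ⊓ A 7 ⊓ A 8 ⊓ A 9 ⊓ z.equal (z₃ * z₄)))

/-- The variables of the inner part of `charStep`: `x, y, z, w`; a block `b`; `y₂`; a block `b'`;
`y₂'`; the truth values `v` and `v'` of the queries belonging to `b, y₂` and to `b', y₂'`. -/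
abbrev StepVars : Type :=
  (((((Fin 4 ⊕ Fin 7) ⊕ Fin 1) ⊕ Fin 7) ⊕ Fin 1) ⊕ Fin 10) ⊕ Fin 10

/-- If `G` defines the graph of the truth value of a relation `R`, that is, if `G(x, y, z, w)` says
`(w = 1 ∧ R(x, y, z)) ∨ (w = 0 ∧ ¬ R(x, y, z))`, then `charStep G` does so for `Φ(R)`.
The formula is
`(w = 0 ∨ w = 1) ∧ ∃ b ∀ y₂ ∀ b' ∃ y₂' ∃ v ∃ v', (w = 1 → matrix(b, y₂, v = 1)) ∧
(w = 0 → ¬ matrix(b', y₂', v' = 1)) ∧ ∀ u, (u is a query together with its truth value) → G(u)`. -/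
def charStep (G : lang.Formula (Fin 4)) : lang.Formula (Fin 4) :=
  let arg (i : Fin 4) : lang.Term StepVars :=
    .var (.inl (.inl (.inl (.inl (.inl (.inl i))))))
  let b (i : Fin 7) : lang.Term StepVars := .var (.inl (.inl (.inl (.inl (.inl (.inr i))))))
  let y₂ : lang.Term StepVars := .var (.inl (.inl (.inl (.inl (.inr 0)))))
  let b' (i : Fin 7) : lang.Term StepVars := .var (.inl (.inl (.inl (.inr i))))
  let y₂' : lang.Term StepVars := .var (.inl (.inl (.inr 0)))
  let v (i : Fin 10) : lang.Term StepVars := .var (.inl (.inr i))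
  let v' (i : Fin 10) : lang.Term StepVars := .var (.inr i)
  let x := arg 0; let y := arg 1; let z := arg 2; let w := arg 3
  let old (t : lang.Term StepVars) : lang.Term (StepVars ⊕ Fin 4) := t.relabel .inl
  let u (i : Fin 4) : lang.Term (StepVars ⊕ Fin 4) := .var (.inr i)
  let isQuery (q : Fin 3 → lang.Term StepVars) (s : lang.Term StepVars) :
      lang.Formula (StepVars ⊕ Fin 4) :=
    (u 0).equal (old (q 0)) ⊓ (u 1).equal (old (q 1)) ⊓ (u 2).equal (old (q 2)) ⊓
      (u 3).equal (old s)
  let queries : List (lang.Formula (StepVars ⊕ Fin 4)) :=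
    (List.finRange 10).map (fun i => isQuery (powQuery x y z b y₂ i) (v i)) ++
    (List.finRange 10).map (fun i => isQuery (powQuery x y z b' y₂' i) (v' i))
  ((Term.var 3).equal 0 ⊔ (Term.var 3).equal 1) ⊓
    exBlock (allBlock (allBlock (exBlock (exBlock (exBlock
      ((w.equal 1 ⟹ powMatrix y z b y₂ fun i => (v i).equal 1) ⊓
        (w.equal 0 ⟹ ∼(powMatrix y z b' y₂' fun i => (v' i).equal 1)) ⊓
        allBlock (queries.foldr (· ⊔ ·) ⊥ ⟹ G.relabel Sum.inr)))))))

/-- The graph of the truth value of the `n`-th bounded exponentiation relation. -/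
def powChar : ℕ → lang.Formula (Fin 4)
  | 0 =>
    ((Term.var 3).equal 1 ⊓ powBase (.var 0) (.var 1) (.var 2)) ⊔
      ((Term.var 3).equal 0 ⊓ ∼(powBase (.var 0) (.var 1) (.var 2)))
  | n + 1 => charStep (powChar n)

/-- The formula `Pow_n(x, y, z)`; the variables `x, y, z` are those with indices `0, 1, 2`. -/
def powFormula (n : ℕ) : lang.Formula (Fin 3) :=
  (powChar n).subst ![.var 0, .var 1, .var 2, 1]

/-- `Pow_n(t, s, r)` for terms in a context with `m` bound variables. -/
def pow (n : ℕ) {m : ℕ} (t s r : lang.Term (α ⊕ Fin m)) : lang.BoundedFormula α m :=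
  app (powFormula n) ![t, s, r]

end Pow

/-! ## The recursion for bounded exponentiation

For `≤` short for `∃ z, a + z² = b`, the formulas `powFormula n` satisfy the recursion
`Pow_{n+1}(x, y, z) ↔ Φ(Pow_n)(x, y, z)`, where `Φ` is `PowStep`. -/

section Semantics

variable {M : Type} [Zero M] [One M] [Add M] [Mul M] {α : Type}

/-- The standard interpretation of the language in a type with `0`, `1`, `+`, `·`. -/
abbrev structureOf (M : Type) [Zero M] [One M] [Add M] [Mul M] : lang.Structure M where
  funMap {_} f :=
    match f with
    | .zero => fun _ => 0
    | .one => fun _ => 1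
    | .add => fun xs => xs 0 + xs 1
    | .mul => fun xs => xs 0 * xs 1
  RelMap r := nomatch r

attribute [local instance] structureOf

@[simp] theorem realize_zero (v : α → M) : (0 : lang.Term α).realize v = 0 := rfl
@[simp] theorem realize_one (v : α → M) : (1 : lang.Term α).realize v = 1 := rfl
@[simp] theorem realize_add (v : α → M) (t s : lang.Term α) :
    (t + s).realize v = t.realize v + s.realize v := rfl
@[simp] theorem realize_mul (v : α → M) (t s : lang.Term α) :
    (t * s).realize v = t.realize v * s.realize v := rfl
@[simp] theorem realize_two (v : α → M) : (two : lang.Term α).realize v = 1 + 1 := rfl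

theorem realize_le {n : ℕ} (t s : lang.Term (α ⊕ Fin n)) (v : α → M) (xs : Fin n → M) :
    (le t s).Realize v xs ↔
      ∃ z : M, t.realize (Sum.elim v xs) + z * z = s.realize (Sum.elim v xs) := by
  have h (a : M) : (fun x => Sum.elim v (Fin.snoc xs a : Fin (n + 1) → M)
      (Sum.map id Fin.castSucc x)) = Sum.elim v xs := by
    funext x; rcases x with x | x <;> simp
  simp [le, lift, Function.comp_def, h]

theorem realize_leF (t s : lang.Term α) (v : α → M) :
    (leF t s).Realize v ↔ ∃ z : M, t.realize v + z * z = s.realize v := by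
  simp [leF, Formula.Realize, realize_le, Function.comp_def]

theorem realize_app {n k : ℕ} (φ : lang.Formula (Fin k)) (ts : Fin k → lang.Term (α ⊕ Fin n))
    (v : α → M) (xs : Fin n → M) :
    (app φ ts).Realize v xs ↔ φ.Realize fun i => (ts i).realize (Sum.elim v xs) := by
  unfold app
  refine (BoundedFormula.realize_relabel (n := 0)).trans ?_
  rw [BoundedFormula.realize_subst]
  exact iff_of_eq (congrArg₂ _ rfl (Subsingleton.elim _ _))

theorem realize_exBlock {k : ℕ} (φ : lang.Formula (α ⊕ Fin k)) (v : α → M) :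
    (exBlock φ).Realize v ↔ ∃ f : Fin k → M, φ.Realize (Sum.elim v f) := by
  unfold exBlock
  refine BoundedFormula.realize_exs.trans (exists_congr fun f => ?_)
  refine (BoundedFormula.realize_relabel (n := 0)).trans ?_
  exact iff_of_eq (congrArg₂ _ rfl (Subsingleton.elim _ _))

theorem realize_allBlock {k : ℕ} (φ : lang.Formula (α ⊕ Fin k)) (v : α → M) :
    (allBlock φ).Realize v ↔ ∀ f : Fin k → M, φ.Realize (Sum.elim v f) := by
  unfold allBlock
  refine BoundedFormula.realize_alls.trans (forall_congr' fun f => ?_)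
  refine (BoundedFormula.realize_relabel (n := 0)).trans ?_
  exact iff_of_eq (congrArg₂ _ rfl (Subsingleton.elim _ _))

/-- The order defined by the formula `∃ z, a + z² = b`. -/
def leM (a b : M) : Prop := ∃ z : M, a + z * z = b

/-- The recursion step `Φ(R)(x, y, z)` of the definition of bounded exponentiation. -/
def PowStep (R : M → M → M → Prop) (x y z : M) : Prop :=
  (∃ y₁, R 1 y₁ 1 ∧ (∀ y₂, R 1 y₂ 1 → leM y₂ y₁) ∧ leM y (y₁ * y₁)) ∧
  (R 1 y 1 → R x y z) ∧
  (¬ R 1 y 1 → ∃ y₃ y₄ y₅ z₂ z₃ z₄, R 1 y₃ 1 ∧ R 1 y₄ 1 ∧ R 1 y₅ 1 ∧ y = y₃ * y₄ + y₅ ∧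
    R x y₃ z₂ ∧ R z₂ y₄ z₃ ∧ R x y₅ z₄ ∧ z = z₃ * z₄)

/-- The relation defined by `powFormula n` on `M`. -/
def PowRel (M : Type) [Zero M] [One M] [Add M] [Mul M] (n : ℕ) (x y z : M) : Prop :=
  (powFormula n).Realize ![x, y, z]

theorem powRel_iff_char (n : ℕ) (x y z : M) :
    PowRel M n x y z ↔ (powChar n).Realize ![x, y, z, 1] := by
  unfold PowRel powFormula
  refine BoundedFormula.realize_subst.trans ?_
  refine iff_of_eq (congrArg₂ _ (funext fun i => ?_) (Subsingleton.elim _ _))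
  fin_cases i <;> rfl

theorem realize_powBase (x y z : lang.Term α) (v : α → M) :
    (powBase x y z).Realize v ↔
      (y.realize v = 0 → z.realize v = 1) ∧ (y.realize v = 1 → z.realize v = x.realize v) ∧
      (y.realize v = 1 + 1 → z.realize v = x.realize v * x.realize v) ∧
      ¬ (y.realize v ≠ 0 ∧ y.realize v ≠ 1 ∧ y.realize v ≠ 1 + 1) := by
  simp [powBase, Formula.realize_inf, Formula.realize_imp, and_assoc,
    Formula.realize_equal]

/-- Semantic counterpart of `powMatrix`. -/
def MatRel (y z : M) (b : Fin 7 → M) (y₂ : M) (A : Fin 10 → Prop) : Prop :=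
  (A 0 ∧ (A 1 → leM y₂ (b 0)) ∧ leM y (b 0 * b 0)) ∧ (A 2 → A 3) ∧
  (¬ A 2 → A 4 ∧ A 5 ∧ A 6 ∧ y = b 1 * b 2 + b 3 ∧ A 7 ∧ A 8 ∧ A 9 ∧ z = b 5 * b 6)

/-- Semantic counterpart of `powQuery`. -/
def queryVal (x y z : M) (b : Fin 7 → M) (y₂ : M) : Fin 10 → Fin 3 → M :=
  ![ ![1, b 0, 1], ![1, y₂, 1], ![1, y, 1], ![x, y, z], ![1, b 1, 1], ![1, b 2, 1], ![1, b 3, 1],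
    ![x, b 1, b 4], ![b 4, b 2, b 5], ![x, b 3, b 6] ]

theorem realize_powQuery (x y z : lang.Term α) (b : Fin 7 → lang.Term α) (y₂ : lang.Term α)
    (v : α → M) (i : Fin 10) (j : Fin 3) : (powQuery x y z b y₂ i j).realize v =
      queryVal (x.realize v) (y.realize v) (z.realize v) (fun k => (b k).realize v)
        (y₂.realize v) i j := by
  fin_cases i <;> fin_cases j <;> rfl

theorem realize_powMatrix (y z : lang.Term α) (b : Fin 7 → lang.Term α) (y₂ : lang.Term α)
    (A : Fin 10 → lang.Formula α) (v : α → M) : (powMatrix y z b y₂ A).Realize v ↔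
      MatRel (y.realize v) (z.realize v) (fun k => (b k).realize v) (y₂.realize v)
        (fun i => (A i).Realize v) := by
  simp [powMatrix, MatRel, Formula.realize_inf, Formula.realize_imp, Formula.realize_not,
    Formula.realize_equal, realize_leF, leM, and_assoc]

theorem formula_foldr_sup (l : List (lang.Formula α)) (v : α → M) :
    Formula.Realize (l.foldr (· ⊔ ·) ⊥) v ↔ ∃ φ ∈ l, Formula.Realize φ v :=
  BoundedFormula.realize_foldr_sup l v _

theorem realize_charStep (G : lang.Formula (Fin 4)) (a : Fin 4 → M) :
    (charStep G).Realize a ↔ (a 3 = 0 ∨ a 3 = 1) ∧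
      ∃ b : Fin 7 → M, ∀ y₂ : Fin 1 → M, ∀ b' : Fin 7 → M, ∃ y₂' : Fin 1 → M,
      ∃ v v' : Fin 10 → M,
        (a 3 = 1 → MatRel (a 1) (a 2) b (y₂ 0) (fun i => v i = 1)) ∧
        (a 3 = 0 → ¬ MatRel (a 1) (a 2) b' (y₂' 0) (fun i => v' i = 1)) ∧
        ∀ u : Fin 4 → M,
          ((∃ i, u 0 = queryVal (a 0) (a 1) (a 2) b (y₂ 0) i 0 ∧
              u 1 = queryVal (a 0) (a 1) (a 2) b (y₂ 0) i 1 ∧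
              u 2 = queryVal (a 0) (a 1) (a 2) b (y₂ 0) i 2 ∧ u 3 = v i) ∨
           (∃ i, u 0 = queryVal (a 0) (a 1) (a 2) b' (y₂' 0) i 0 ∧
              u 1 = queryVal (a 0) (a 1) (a 2) b' (y₂' 0) i 1 ∧
              u 2 = queryVal (a 0) (a 1) (a 2) b' (y₂' 0) i 2 ∧ u 3 = v' i)) → G.Realize u := by
  unfold charStep
  simp only [Formula.realize_inf, Formula.realize_sup, Formula.realize_imp, Formula.realize_not,
    realize_exBlock, realize_allBlock, Formula.realize_equal, realize_powMatrix,
    formula_foldr_sup, Formula.realize_relabel, realize_zero, realize_one, Term.realize_var,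
    Sum.elim_inl, Sum.elim_inr, List.mem_append, List.mem_map, List.mem_finRange, true_and,
    or_and_right, exists_or, exists_exists_eq_and, Term.realize_relabel, realize_powQuery,
    Sum.elim_comp_inr, Sum.elim_comp_inl, and_assoc]

theorem powStep_iff (R : M → M → M → Prop) (x y z : M) :
    PowStep R x y z ↔ ∃ b : Fin 7 → M, ∀ y₂, MatRel y z b y₂ fun i =>
      R (queryVal x y z b y₂ i 0) (queryVal x y z b y₂ i 1) (queryVal x y z b y₂ i 2) := by
  have h (b : Fin 7 → M) (y₂ : M) : (MatRel y z b y₂ fun i =>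
      R (queryVal x y z b y₂ i 0) (queryVal x y z b y₂ i 1) (queryVal x y z b y₂ i 2)) ↔
      (R 1 (b 0) 1 ∧ (R 1 y₂ 1 → leM y₂ (b 0)) ∧ leM y (b 0 * b 0)) ∧ (R 1 y 1 → R x y z) ∧
      (¬ R 1 y 1 → R 1 (b 1) 1 ∧ R 1 (b 2) 1 ∧ R 1 (b 3) 1 ∧ y = b 1 * b 2 + b 3 ∧
        R x (b 1) (b 4) ∧ R (b 4) (b 2) (b 5) ∧ R x (b 3) (b 6) ∧ z = b 5 * b 6) := Iff.rfl
  simp only [h, PowStep]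
  constructor
  · rintro ⟨⟨y₁, h1, h2, h3⟩, h4, h5⟩
    by_cases hy : R 1 y 1
    · exact ⟨![y₁, 0, 0, 0, 0, 0, 0], fun y₂ => ⟨⟨h1, h2 y₂, h3⟩, h4, fun h => absurd hy h⟩⟩
    · obtain ⟨y₃, y₄, y₅, z₂, z₃, z₄, h6⟩ := h5 hy
      exact ⟨![y₁, y₃, y₄, y₅, z₂, z₃, z₄], fun y₂ => ⟨⟨h1, h2 y₂, h3⟩, h4, fun _ => h6⟩⟩
  · rintro ⟨b, hb⟩
    exact ⟨⟨b 0, (hb 0).1.1, fun y₂ => (hb y₂).1.2.1, (hb 0).1.2.2⟩, (hb 0).2.1,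
      fun hy => ⟨_, _, _, _, _, _, (hb 0).2.2 hy⟩⟩

/-- `G` defines the graph of the truth value of `R`. -/
def IsChar (G : lang.Formula (Fin 4)) (R : M → M → M → Prop) : Prop :=
  ∀ a : Fin 4 → M, G.Realize a ↔
    (a 3 = 1 ∧ R (a 0) (a 1) (a 2)) ∨ (a 3 = 0 ∧ ¬ R (a 0) (a 1) (a 2))

theorem IsChar.step (h01 : (0 : M) ≠ 1) {G : lang.Formula (Fin 4)} {R : M → M → M → Prop}
    (hG : IsChar G R) : IsChar (charStep G) (PowStep R) := by
  classical
  intro a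
  rw [realize_charStep]
  have key (b : Fin 7 → M) (y₂ : M) (v : Fin 10 → M)
      (hv : ∀ u : Fin 4 → M, (∃ i, u 0 = queryVal (a 0) (a 1) (a 2) b y₂ i 0 ∧
              u 1 = queryVal (a 0) (a 1) (a 2) b y₂ i 1 ∧
              u 2 = queryVal (a 0) (a 1) (a 2) b y₂ i 2 ∧ u 3 = v i) → G.Realize u) :
      (fun i => v i = 1) = fun i => R (queryVal (a 0) (a 1) (a 2) b y₂ i 0)
        (queryVal (a 0) (a 1) (a 2) b y₂ i 1) (queryVal (a 0) (a 1) (a 2) b y₂ i 2) := by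
    funext i
    have := (hG _).1 (hv ![queryVal (a 0) (a 1) (a 2) b y₂ i 0,
      queryVal (a 0) (a 1) (a 2) b y₂ i 1, queryVal (a 0) (a 1) (a 2) b y₂ i 2, v i]
      ⟨i, rfl, rfl, rfl, rfl⟩)
    rcases this with h | h
    · exact propext ⟨fun _ => h.2, fun _ => h.1⟩
    · have h3 : v i = 0 := h.1
      exact propext ⟨fun h' => absurd (h3.symm.trans h') h01, fun h' => absurd h' h.2⟩
  have ex (b : Fin 7 → M) (y₂ : M) : ∃ v : Fin 10 → M,
      (∀ u : Fin 4 → M, (∃ i, u 0 = queryVal (a 0) (a 1) (a 2) b y₂ i 0 ∧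
              u 1 = queryVal (a 0) (a 1) (a 2) b y₂ i 1 ∧
              u 2 = queryVal (a 0) (a 1) (a 2) b y₂ i 2 ∧ u 3 = v i) → G.Realize u) := by
    refine ⟨fun i => if R (queryVal (a 0) (a 1) (a 2) b y₂ i 0)
        (queryVal (a 0) (a 1) (a 2) b y₂ i 1) (queryVal (a 0) (a 1) (a 2) b y₂ i 2)
        then 1 else 0, ?_⟩
    rintro u ⟨i, h0, h1, h2, h3⟩
    rw [hG, h0, h1, h2, h3]
    by_cases h : R (queryVal (a 0) (a 1) (a 2) b y₂ i 0)
        (queryVal (a 0) (a 1) (a 2) b y₂ i 1) (queryVal (a 0) (a 1) (a 2) b y₂ i 2) <;> simp [h]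
  constructor
  · rintro ⟨hw, b, hb⟩
    rcases hw with hw | hw
    · refine .inr ⟨hw, fun hS => ?_⟩
      obtain ⟨b', hb'⟩ := (powStep_iff R _ _ _).1 hS
      obtain ⟨y₂', v, v', -, h, hu⟩ := hb (fun _ => 0) b'
      apply h hw
      rw [key b' (y₂' 0) v' fun u hu' => hu u (.inr hu')]
      exact hb' _
    · refine .inl ⟨hw, (powStep_iff R _ _ _).2 ⟨b, fun y₂ => ?_⟩⟩
      obtain ⟨y₂', v, v', h, -, hu⟩ := hb (fun _ => y₂) (fun _ => 0)
      rw [← key b y₂ v fun u hu' => hu u (.inl hu')]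
      exact h hw
  · rintro (⟨hw, hS⟩ | ⟨hw, hS⟩)
    · obtain ⟨b, hb⟩ := (powStep_iff R _ _ _).1 hS
      refine ⟨.inr hw, b, fun y₂ b' => ⟨fun _ => 0, ?_⟩⟩
      obtain ⟨v, hv⟩ := ex b (y₂ 0)
      obtain ⟨v', hv'⟩ := ex b' 0
      refine ⟨v, v', fun _ => ?_, fun h => absurd (h.symm.trans hw) h01,
        fun u hu => hu.elim (hv u) (hv' u)⟩
      rw [key b (y₂ 0) v hv]
      exact hb _
    · refine ⟨.inl hw, fun _ => 0, fun y₂ b' => ?_⟩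
      have : ∃ y₂', ¬ MatRel (a 1) (a 2) b' y₂' fun i =>
          R (queryVal (a 0) (a 1) (a 2) b' y₂' i 0) (queryVal (a 0) (a 1) (a 2) b' y₂' i 1)
            (queryVal (a 0) (a 1) (a 2) b' y₂' i 2) := by
        by_contra hcon
        push Not at hcon
        exact hS ((powStep_iff R _ _ _).2 ⟨b', hcon⟩)
      obtain ⟨y₂', hy⟩ := this
      obtain ⟨v, hv⟩ := ex (fun _ => 0) (y₂ 0)
      obtain ⟨v', hv'⟩ := ex b' y₂'
      refine ⟨fun _ => y₂', v, v', fun h => absurd (hw.symm.trans h) h01, fun _ => ?_,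
        fun u hu => hu.elim (hv u) (hv' u)⟩
      rw [key b' y₂' v' hv']
      exact hy

theorem isChar_powChar (h01 : (0 : M) ≠ 1) (n : ℕ) : IsChar (powChar n) (PowRel M n) := by
  have h (n : ℕ) (R : M → M → M → Prop) (hR : IsChar (powChar n) R) : PowRel M n = R := by
    funext x y z
    refine propext ?_
    rw [powRel_iff_char, hR]
    simp [h01.symm]
  induction n with
  | zero =>
    have h0 : IsChar (M := M) (powChar 0) fun x y z =>
        (powBase (.var 0) (.var 1) (.var 2) : lang.Formula (Fin 3)).Realize ![x, y, z] := by
      intro a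
      simp [powChar, Formula.realize_sup, Formula.realize_inf, Formula.realize_not,
        Formula.realize_equal, realize_powBase]
    rw [h 0 _ h0]; exact h0
  | succ n ih =>
    have h1 := ih.step h01
    rw [h (n + 1) _ h1]; exact h1

/-- The base relation is the intended one. -/
theorem powRel_zero (h01 : (0 : M) ≠ 1) (x y z : M) : PowRel M 0 x y z ↔
      (y = 0 → z = 1) ∧ (y = 1 → z = x) ∧ (y = 1 + 1 → z = x * x) ∧
      ¬ (y ≠ 0 ∧ y ≠ 1 ∧ y ≠ 1 + 1) := by
  rw [powRel_iff_char]
  simp [powChar, Formula.realize_sup, Formula.realize_inf, Formula.realize_not,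
        Formula.realize_equal, realize_powBase, h01.symm]

/-- The relations satisfy the intended recursion, in every structure in which `0 ≠ 1`. -/
theorem powRel_succ (h01 : (0 : M) ≠ 1) (n : ℕ) (x y z : M) :
    PowRel M (n + 1) x y z ↔ PowStep (PowRel M n) x y z := by
  rw [powRel_iff_char, show powChar (n + 1) = charStep (powChar n) from rfl,
    (isChar_powChar h01 n).step h01]
  simp [h01.symm]

end Semantics
/-! ## The sentences -/

/-- `Hyp_n(y)` with `y = &0`. -/
def hypFormula (n : ℕ) : lang.BoundedFormula Empty 1 :=
  -- `∃ x z, 1 < x ∧ Pow_n(x, y, z) ∧ z ≤ 2`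
  (∃' ∃' (lt 1 &1 ⊓ pow n &1 &0 &2 ⊓ le &2 two)) ⊓
  -- `∀ x x₁ > 1, ∀ z z₁, Pow_n(x, y, z) ∧ Pow_n(x₁, y, z₁) → z > x ∧ (z₁ > z → x₁ > x)`
  (∀' ∀' ((lt 1 &1 ⊓ lt 1 &2) ⟹ ∀' ∀' ((pow n &1 &0 &3 ⊓ pow n &2 &0 &4) ⟹
    (lt &1 &3 ⊓ (lt &3 &4 ⟹ lt &1 &2))))) ⊓
  -- `∀ c₁ c₂ > 1, c₁ ≠ c₂ →
  --   ∃ x₀ c₀, Pow_n(x₀, y, c₀) ∧ (c₁ < c₀ < c₂ ∨ c₂ < c₀ < c₁) ∧ x₀ > 1`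
  (∀' ∀' ((lt 1 &1 ⊓ lt 1 &2) ⟹ (∼(&1 =' &2) ⟹
    ∃' ∃' (pow n &3 &0 &4 ⊓ ((lt &1 &4 ⊓ lt &4 &2) ⊔ (lt &2 &4 ⊓ lt &4 &1)) ⊓ lt 1 &3))))

/-- `Root_n`: `∀ y, Hyp_n(y) → ¬ (y > 1) ∨ ∃ r, Pow_n(r, y, 2)`. -/
def rootSentence (n : ℕ) : lang.Sentence :=
  ∀' (hypFormula n ⟹ (∼(lt 1 &0) ⊔ ∃' (pow n &1 &0 two)))

end SpeedupRCF

/-!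
Both directions go through the completeness theorem (`completeness`), which is proved here for the
given natural deduction system by a Henkin construction. Free variables serve as the witnesses:
every assumption list is finite, and so there is always a fresh variable.

*Short proofs.* A single proof is never written down; what has to be seen is that finitely many
fixed proofs suffice. They are proofs about schemes, formulas of the language `langG` with one
additional relation symbol `G`. Replacing `G` by a formula `γ` turns a proof of a scheme into a
proof of its instance whose size is linear in the size of `γ` (`Derivation.instance_le`). Let `I` be
the scheme `invariantG`: `G` is the graph of the truth value of some `Pow`, for every `y` the domain
of `Pow(·, y, ·)` is empty or everything, and in the latter case `Pow(1, y, 1)`. This holds for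
`Pow_0` (`exists_proof_invariant_zero`), and it is inherited by the next formula, so that `I(G)`
implies `I(stepG)` (`InvariantRel.step`). Completeness supplies one proof of this implication, and
its instances for `powChar 0, …, powChar (n - 1)` chain to a proof of `I(powChar n)`
(`exists_proof_invariant`). Since the previous formula occurs only once in the recursion step,
`powChar n` has size linear in `n`, and the whole chain has polynomial size. Finally `I` and the
least upper bound principle for `1 < x ∧ x ^ y ≤ 2` imply the scheme of `Root_n`: the least upper
bound `c` has a power `c ^ y` by `I`, and by the density clause of `Hyp_n` it can neither be smaller
nor larger than `2` (`trueG_rootG_of_lub`). Note that `y` may be any element here, and nothing has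
to be known about natural numbers.

*Proofs in `rcf`.* In an ordered field `Pow_n(x, y, z)` says that `y` is a natural number
`≤ 2 ^ (2 ^ n)` and `x ^ y = z` (`powRel_iff`). Roots of positive elements exist in real closed
fields, and completeness yields a proof of `Root_n` (`exists_rcf_proof`).

*Long proofs.* Let `p` be a prime with `2 ^ (2 ^ n - 1) < p ≤ 2 ^ (2 ^ n)`, by Bertrand's postulate.
Let `F` be maximal among the subfields of `ℝ` that do not contain the `p`-th root of `2`. A real
root of a polynomial of degree `< p` over `F` generates an extension of degree `< p`, which cannot
contain that root, since `X ^ p - 2` is irreducible over `F`; by maximality the root is in `F`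
(`exists_subfield`). Hence `F` has square roots and satisfies all the odd-degree axioms of degree
`< p`. It refutes `Root_n`: `Hyp_n(p)` holds because the `p`-th powers of rational numbers are dense.
By soundness every proof of `Root_n` uses an axiom of degree at least `p`
(`exists_mem_usedAxioms`), and such an axiom is long.

*The speedup.* A polynomial change of the length measure keeps the lengths in `tarski` polynomial in
`n` and those in `rcf` at least a root of `2 ^ (2 ^ n - 1)`; this leaves a doubly exponential gap
in a power of the former (`exists_eventually_le`).
-/

namespace SpeedupRCF

/-! ### Simultaneous substitution -/

section Substitution

universe u v

variable {L : FirstOrder.Language.{u, v}} {α β δ : Type}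

/-- Move a term under one more quantifier. -/
def liftTerm {m : ℕ} (t : L.Term (β ⊕ Fin m)) : L.Term (β ⊕ Fin (m + 1)) :=
  t.relabel (Sum.map id Fin.castSucc)

/-- Extend a simultaneous substitution under one more quantifier. -/
def up {n m : ℕ} (f : α ⊕ Fin n → L.Term (β ⊕ Fin m)) :
    α ⊕ Fin (n + 1) → L.Term (β ⊕ Fin (m + 1)) :=
  Sum.elim (fun a => liftTerm (f (.inl a)))
    (Fin.lastCases (Term.var (.inr (Fin.last m))) fun i => liftTerm (f (.inr i)))

/-- Simultaneous substitution for all variables, free and bound, of a bounded formula. All the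
syntactic operations on formulas (substitution, relabelling, instantiation, …) are instances. -/
def gsub : ∀ {n : ℕ}, L.BoundedFormula α n → ∀ {m : ℕ}, (α ⊕ Fin n → L.Term (β ⊕ Fin m)) →
    L.BoundedFormula β m
  | _, .falsum, _, _ => .falsum
  | _, .equal t s, _, f => .equal (t.subst f) (s.subst f)
  | _, .rel R ts, _, f => .rel R fun i => (ts i).subst f
  | _, .imp φ ψ, _, f => .imp (gsub φ f) (gsub ψ f)
  | _, .all φ, _, f => .all (gsub φ (up f))

@[simp] theorem up_inl {n m : ℕ} (f : α ⊕ Fin n → L.Term (β ⊕ Fin m)) (a : α) :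
    up f (.inl a) = liftTerm (f (.inl a)) := rfl

@[simp] theorem up_last {n m : ℕ} (f : α ⊕ Fin n → L.Term (β ⊕ Fin m)) :
    up f (.inr (Fin.last n)) = Term.var (.inr (Fin.last m)) := by simp [up]

@[simp] theorem up_castSucc {n m : ℕ} (f : α ⊕ Fin n → L.Term (β ⊕ Fin m)) (i : Fin n) :
    up f (.inr i.castSucc) = liftTerm (f (.inr i)) := by simp [up]

/-- Case distinction between a free variable, a bound variable from an outer context, and the
innermost bound variable. -/
theorem var_cases {n : ℕ} {P : α ⊕ Fin (n + 1) → Prop} (hl : ∀ a, P (.inl a))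
    (h : ∀ i : Fin n, P (.inr i.castSucc)) (hlast : P (.inr (Fin.last n))) : ∀ v, P v := by
  rintro (a | i)
  · exact hl a
  · exact Fin.lastCases hlast h i

theorem subst_subst (t : L.Term α) (f : α → L.Term β) (g : β → L.Term δ) :
    (t.subst f).subst g = t.subst fun v => (f v).subst g := by
  induction t with
  | var a => rfl
  | func F ts ih => simp [Term.subst, ih]

theorem relabel_eq_subst (t : L.Term α) (f : α → β) :
    t.relabel f = t.subst fun v => Term.var (f v) := by
  induction t with
  | var a => rfl
  | func F ts ih => simp [Term.subst, Term.relabel, ih]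

theorem subst_var (t : L.Term α) : t.subst Term.var = t := by
  induction t with
  | var a => rfl
  | func F ts ih => simp [Term.subst, ih]

theorem liftTerm_eq_subst {m : ℕ} (t : L.Term (β ⊕ Fin m)) :
    liftTerm t = t.subst fun v => Term.var (Sum.map id Fin.castSucc v) := relabel_eq_subst _ _

theorem liftTerm_subst_up {n m : ℕ} (t : L.Term (α ⊕ Fin n)) (f : α ⊕ Fin n → L.Term (β ⊕ Fin m)) :
    (liftTerm t).subst (up f) = liftTerm (t.subst f) := by
  simp only [liftTerm_eq_subst, subst_subst]
  congr 1; funext v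
  rcases v with a | i <;> simp [Term.subst, liftTerm_eq_subst]

theorem up_subst {k n m : ℕ} (f : α ⊕ Fin k → L.Term (β ⊕ Fin n))
    (g : β ⊕ Fin n → L.Term (δ ⊕ Fin m)) :
    (fun v => (up f v).subst (up g)) = up fun v => (f v).subst g := by
  funext v
  revert v
  apply var_cases <;> intros <;> simp [liftTerm_subst_up, Term.subst]

theorem gsub_gsub {k : ℕ} (φ : L.BoundedFormula α k) {n m : ℕ} (f : α ⊕ Fin k → L.Term (β ⊕ Fin n))
    (g : β ⊕ Fin n → L.Term (δ ⊕ Fin m)) :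
    gsub (gsub φ f) g = gsub φ fun v => (f v).subst g := by
  induction φ generalizing n m with
  | falsum => rfl
  | equal t s => simp [gsub, subst_subst]
  | rel R ts => simp [gsub, subst_subst]
  | imp φ ψ ih₁ ih₂ => simp [gsub, ih₁, ih₂]
  | all φ ih => simp [gsub, ih, up_subst]

theorem up_var {n : ℕ} :
    up (Term.var : α ⊕ Fin n → L.Term (α ⊕ Fin n)) = Term.var := by
  funext v; revert v; apply var_cases <;> intros <;> simp [liftTerm, Term.relabel]

theorem gsub_var {n : ℕ} (φ : L.BoundedFormula α n) : gsub φ Term.var = φ := by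
  induction φ with
  | falsum => rfl
  | equal t s => simp [gsub, subst_var]
  | rel R ts => simp [gsub, subst_var]
  | imp φ ψ ih₁ ih₂ => simp [gsub, ih₁, ih₂]
  | all φ ih => simp [gsub, up_var, ih]

theorem gsub_congr {n m : ℕ} (φ : L.BoundedFormula α n) {f g : α ⊕ Fin n → L.Term (β ⊕ Fin m)}
    (h : ∀ v, f v = g v) : gsub φ f = gsub φ g := by rw [funext h]

/-- A term regarded as a term in a context with bound variables. -/
abbrev free {m : ℕ} (t : L.Term β) : L.Term (β ⊕ Fin m) := t.relabel Sum.inl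

theorem liftTerm_free {m : ℕ} (t : L.Term β) : liftTerm (free (m := m) t) = free t := by
  simp [liftTerm, Term.relabel_relabel, Function.comp_def]

theorem subst_eq_gsub {n : ℕ} (φ : L.BoundedFormula α n) (σ : α → L.Term β) :
    φ.subst σ = gsub φ (Sum.elim (fun a => free (σ a)) fun i => Term.var (.inr i)) := by
  unfold BoundedFormula.subst
  induction φ with
  | falsum => rfl
  | equal t s => rfl
  | rel R ts => rfl
  | imp φ ψ ih₁ ih₂ => simp [gsub, BoundedFormula.mapTermRel, ih₁, ih₂]
  | all φ ih =>
    simp only [gsub, BoundedFormula.mapTermRel, id, ih]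
    congr 1
    refine gsub_congr _ (var_cases (fun a => ?_) (fun i => ?_) ?_)
    · simp [liftTerm_free]
    · simp [liftTerm, Term.relabel]
    · simp

theorem castLE_eq_gsub {n m : ℕ} (e : n = m) (φ : L.BoundedFormula α n) (h : n ≤ m) :
    φ.castLE h = gsub φ fun v => Term.var (Sum.map id (Fin.castLE h) v) := by
  subst e
  rw [BoundedFormula.castLE_rfl]
  refine (gsub_var φ).symm.trans (gsub_congr _ ?_)
  rintro (a | i) <;> rfl

theorem relabel_eq_gsub {n k : ℕ} (φ : L.BoundedFormula α k) (g : α → β ⊕ Fin n) :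
    φ.relabel g = gsub φ fun v => Term.var (BoundedFormula.relabelAux g k v) := by
  unfold BoundedFormula.relabel
  induction φ with
  | falsum => rfl
  | equal t s => simp [gsub, BoundedFormula.mapTermRel, relabel_eq_subst]
  | rel R ts => simp [gsub, BoundedFormula.mapTermRel, relabel_eq_subst]
  | imp φ ψ ih₁ ih₂ => simp [gsub, BoundedFormula.mapTermRel, ih₁, ih₂]
  | all φ ih =>
    simp only [gsub, BoundedFormula.mapTermRel, ih]
    refine congrArg _ ((castLE_eq_gsub (by rfl) _ _).trans ?_)
    rw [gsub_gsub]
    refine gsub_congr _ (var_cases (fun a => ?_) (fun i => ?_) ?_)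
    · rcases h : g a with b | i <;>
        simp [liftTerm, Term.relabel, Term.subst, BoundedFormula.relabelAux, h]; rfl
    · simp [liftTerm, Term.relabel, Term.subst, BoundedFormula.relabelAux]
    · simp [Term.subst, BoundedFormula.relabelAux]

theorem formula_relabel_eq_gsub (φ : L.Formula α) (g : α → β) :
    Formula.relabel g φ = gsub φ (m := 0) (Sum.elim (fun a => Term.var (.inl (g a))) Fin.elim0) := by
  refine (relabel_eq_gsub φ (n := 0) (Sum.inl ∘ g)).trans (gsub_congr _ ?_)
  rintro (a | i)
  · simp [BoundedFormula.relabelAux]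
  · exact i.elim0

theorem toFormula_eq_gsub {n : ℕ} (φ : L.BoundedFormula α n) :
    φ.toFormula = gsub φ (m := 0) fun v => Term.var (.inl v) := by
  induction φ with
  | falsum => rfl
  | equal t s => simp [gsub, Term.equal, Term.bdEqual, relabel_eq_subst]
  | rel R ts => simp [gsub, Relations.formula, Relations.boundedFormula, relabel_eq_subst]
  | imp φ ψ ih₁ ih₂ => simp [gsub, ih₁, ih₂]
  | all φ ih =>
    simp only [BoundedFormula.toFormula, ih, gsub, relabel_eq_gsub, gsub_gsub]
    congr 1
    refine gsub_congr _ (var_cases (fun a => ?_) (fun i => ?_) ?_)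
    · simp [Term.subst, BoundedFormula.relabelAux, liftTerm]
    · have : finSumFinEquiv.symm i.castSucc = (Sum.inl i : Fin _ ⊕ Fin 1) :=
        finSumFinEquiv_symm_apply_castAdd i
      simp [Term.subst, BoundedFormula.relabelAux, liftTerm, this]
    · rename_i n
      have : finSumFinEquiv.symm (Fin.last n) = (Sum.inr 0 : Fin n ⊕ Fin 1) :=
        finSumFinEquiv_symm_apply_natAdd (0 : Fin 1)
      simp [Term.subst, BoundedFormula.relabelAux, this]; rfl

theorem instantiate_eq_gsub (φ : L.BoundedFormula ℕ 1) (t : L.Term ℕ) :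
    instantiate φ t = gsub φ (m := 0) (Sum.elim (fun i => Term.var (.inl i)) fun _ => free t) := by
  rw [instantiate, toFormula_eq_gsub, subst_eq_gsub, gsub_gsub]
  refine gsub_congr _ ?_
  rintro (a | i) <;> simp [Term.subst, Term.relabel]

theorem shift_eq_gsub {n : ℕ} (φ : L.BoundedFormula ℕ n) :
    shift φ = gsub φ (Sum.elim (fun i => Term.var (.inl (i + 1))) fun i => Term.var (.inr i)) := by
  rw [shift, subst_eq_gsub]; rfl

theorem ofSentence_eq_gsub (φ : L.Sentence) :
    ofSentence φ = gsub φ (m := 0) (Sum.elim Empty.elim Fin.elim0) := by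
  rw [ofSentence, subst_eq_gsub]
  refine gsub_congr _ ?_
  rintro (a | i)
  · exact a.elim
  · exact i.elim0

theorem ofSentence_subst (φ : L.Sentence) (σ : ℕ → L.Term ℕ) :
    (ofSentence φ).subst σ = ofSentence φ := by
  rw [ofSentence_eq_gsub, subst_eq_gsub, gsub_gsub]
  refine gsub_congr _ ?_
  rintro (a | i)
  · exact a.elim
  · exact i.elim0

/-- The substitution lemma. -/
theorem realize_gsub {M : Type} [L.Structure M] {n m : ℕ} (φ : L.BoundedFormula α n)
    (f : α ⊕ Fin n → L.Term (β ⊕ Fin m)) (v : β → M) (xs : Fin m → M) :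
    (gsub φ f).Realize v xs ↔ φ.Realize (fun a => (f (.inl a)).realize (Sum.elim v xs))
      (fun i => (f (.inr i)).realize (Sum.elim v xs)) := by
  have key (n m : ℕ) (f : α ⊕ Fin n → L.Term (β ⊕ Fin m)) (xs : Fin m → M) (t : L.Term (α ⊕ Fin n)) :
      (t.subst f).realize (Sum.elim v xs) =
        t.realize (Sum.elim (fun a => (f (.inl a)).realize (Sum.elim v xs))
          (fun i => (f (.inr i)).realize (Sum.elim v xs))) := by
    rw [Term.realize_subst]; congr 1; funext x; rcases x with x | x <;> rfl
  have lift_key (m : ℕ) (t : L.Term (β ⊕ Fin m)) (xs : Fin m → M) (a : M) :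
      (liftTerm t).realize (Sum.elim v (Fin.snoc xs a : Fin (m + 1) → M)) =
        t.realize (Sum.elim v xs) := by
    rw [liftTerm, Term.realize_relabel]
    congr 1; funext x; rcases x with x | x <;> simp
  induction φ generalizing m with
  | falsum => exact Iff.rfl
  | equal t s => simp [gsub, BoundedFormula.Realize, key]
  | rel R ts => simp [gsub, BoundedFormula.Realize, key]
  | imp φ ψ ih₁ ih₂ => simp [gsub, ih₁, ih₂]
  | all φ ih =>
    simp only [gsub, BoundedFormula.realize_all, ih, up_inl, lift_key]
    refine forall_congr' fun a => iff_of_eq (congrArg _ (funext fun i => ?_))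
    refine Fin.lastCases ?_ (fun i => ?_) i <;> simp [lift_key]

theorem formulaSize_pos {n : ℕ} (φ : L.BoundedFormula α n) : 1 ≤ formulaSize φ := by
  cases φ <;> simp [formulaSize] <;> omega

theorem termSize_pos (t : L.Term α) : 1 ≤ termSize t := by
  cases t <;> simp [termSize]

theorem termSize_relabel (t : L.Term α) (f : α → β) : termSize (t.relabel f) = termSize t := by
  induction t with
  | var a => rfl
  | func F ts ih => simp [termSize, Term.relabel, ih]

theorem termSize_subst_le (t : L.Term α) (f : α → L.Term β) {B : ℕ} (hB : 1 ≤ B)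
    (h : ∀ v, termSize (f v) ≤ B) : termSize (t.subst f) ≤ termSize t * B := by
  induction t with
  | var a => simpa [termSize, Term.subst] using h a
  | func F ts ih =>
    simp only [termSize, Term.subst, add_mul, one_mul, Finset.sum_mul]
    exact add_le_add hB (Finset.sum_le_sum fun i _ => ih i)

theorem le_termSize_subst (t : L.Term α) (f : α → L.Term β) :
    termSize t ≤ termSize (t.subst f) := by
  induction t with
  | var a => exact termSize_pos _
  | func F ts ih =>
    simp only [termSize, Term.subst]
    exact add_le_add le_rfl (Finset.sum_le_sum fun i _ => ih i)

theorem termSize_up_le {n m B : ℕ} (hB : 1 ≤ B) {f : α ⊕ Fin n → L.Term (β ⊕ Fin m)}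
    (h : ∀ v, termSize (f v) ≤ B) : ∀ v, termSize (up f v) ≤ B := by
  apply var_cases <;> intros <;> simp [liftTerm, termSize_relabel, h]
  simpa [termSize] using hB

/-- Substituting terms of size at most `B` multiplies the size of a formula by at most `B`. -/
theorem formulaSize_gsub_le {n m : ℕ} (φ : L.BoundedFormula α n)
    (f : α ⊕ Fin n → L.Term (β ⊕ Fin m)) {B : ℕ} (hB : 1 ≤ B) (h : ∀ v, termSize (f v) ≤ B) :
    formulaSize (gsub φ f) ≤ formulaSize φ * B := by
  induction φ generalizing m with
  | falsum => simpa [gsub, formulaSize] using hB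
  | equal t s =>
    have := termSize_subst_le t f hB h
    have := termSize_subst_le s f hB h
    simp only [gsub, formulaSize, add_mul, one_mul]; omega
  | rel R ts =>
    simp only [gsub, formulaSize, add_mul, one_mul, Finset.sum_mul]
    exact add_le_add hB (Finset.sum_le_sum fun i _ => termSize_subst_le _ f hB h)
  | imp φ ψ ih₁ ih₂ =>
    have := ih₁ f h
    have := ih₂ f h
    simp only [gsub, formulaSize, add_mul, one_mul]; omega
  | all φ ih =>
    have := ih (up f) (termSize_up_le hB h)
    simp only [gsub, formulaSize, add_mul, one_mul]; omega

theorem le_formulaSize_gsub {n m : ℕ} (φ : L.BoundedFormula α n)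
    (f : α ⊕ Fin n → L.Term (β ⊕ Fin m)) : formulaSize φ ≤ formulaSize (gsub φ f) := by
  induction φ generalizing m with
  | falsum => simp [gsub, formulaSize]
  | equal t s =>
    have := le_termSize_subst t f
    have := le_termSize_subst s f
    simp only [gsub, formulaSize]; omega
  | rel R ts =>
    simp only [gsub, formulaSize]
    exact add_le_add le_rfl (Finset.sum_le_sum fun i _ => le_termSize_subst _ f)
  | imp φ ψ ih₁ ih₂ =>
    have := ih₁ f
    have := ih₂ f
    simp only [gsub, formulaSize]; omega
  | all φ ih =>
    have := ih (up f)
    simp only [gsub, formulaSize]; omega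

end Substitution

section Metatheory

universe u v

variable {L : FirstOrder.Language.{u, v}} {T : L.Theory}

/-! ### Soundness -/

theorem realize_instantiate {M : Type} [L.Structure M] (φ : L.BoundedFormula ℕ 1) (t : L.Term ℕ)
    (v : ℕ → M) : Formula.Realize (instantiate φ t) v ↔ φ.Realize v fun _ => t.realize v := by
  rw [instantiate_eq_gsub, Formula.Realize, realize_gsub]
  refine iff_of_eq (congrArg₂ _ rfl ?_)
  funext i
  simp [Function.comp_def]

theorem realize_shift {M : Type} [L.Structure M] {n : ℕ} (φ : L.BoundedFormula ℕ n) (v : ℕ → M)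
    (xs : Fin n → M) : (shift φ).Realize v xs ↔ φ.Realize (fun i => v (i + 1)) xs := by
  rw [shift_eq_gsub, realize_gsub]; rfl

theorem realize_ofSentence {M : Type} [L.Structure M] (φ : L.Sentence) (v : ℕ → M) :
    (ofSentence φ).Realize v ↔ M ⊨ φ := by
  rw [ofSentence_eq_gsub, Formula.Realize, realize_gsub]
  exact iff_of_eq (congrArg₂ _ (Subsingleton.elim _ _) (Subsingleton.elim _ _))

/-- A derivation is sound in every structure that satisfies the axioms it uses. -/
theorem Derivation.sound {M : Type} [L.Structure M] {Γ : List (L.Formula ℕ)} {φ : L.Formula ℕ}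
    (d : Derivation T Γ φ) (hT : ∀ ψ ∈ d.usedAxioms, M ⊨ ψ) (v : ℕ → M)
    (hΓ : ∀ ψ ∈ Γ, ψ.Realize v) : φ.Realize v := by
  induction d generalizing v with
  | axm Γ φ h => exact (realize_ofSentence φ v).2 (hT φ rfl)
  | hyp Γ φ h => exact hΓ φ h
  | impI Γ φ ψ d ih =>
    refine Formula.realize_imp.2 fun h => ih hT v ?_
    simpa using ⟨h, hΓ⟩
  | impE Γ φ ψ d e ih₁ ih₂ =>
    exact Formula.realize_imp.1 (ih₁ (fun ψ h => hT ψ (.inl h)) v hΓ)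
      (ih₂ (fun ψ h => hT ψ (.inr h)) v hΓ)
  | raa Γ φ d ih =>
    by_contra h
    exact ih hT v (by simpa [Formula.realize_not] using ⟨h, hΓ⟩)
  | allI Γ φ d ih =>
    refine BoundedFormula.realize_all.2 fun a => ?_
    have := ih hT (fun i => Nat.casesOn i a v) (by
      intro ψ hψ
      obtain ⟨χ, hχ, rfl⟩ := List.mem_map.1 hψ
      exact (realize_shift χ _ _).2 (hΓ χ hχ))
    rw [realize_instantiate, realize_shift] at this
    convert this using 1
    funext i
    obtain rfl : i = Fin.last 0 := Subsingleton.elim (α := Fin 1) _ _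
    simp [Fin.snoc]
  | allE Γ φ t d ih =>
    rw [realize_instantiate]
    have := BoundedFormula.realize_all.1 (ih hT v hΓ) (t.realize v)
    convert this using 1
    funext i
    obtain rfl : i = Fin.last 0 := Subsingleton.elim (α := Fin 1) _ _
    simp [Fin.snoc]
  | eqI Γ t => exact Formula.realize_equal.2 rfl
  | eqE Γ φ t s d e ih₁ ih₂ =>
    have h₁ := Formula.realize_equal.1 (ih₁ (fun ψ h => hT ψ (.inl h)) v hΓ)
    have h₂ := ih₂ (fun ψ h => hT ψ (.inr h)) v hΓ
    rw [realize_instantiate] at h₂ ⊢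
    rwa [← h₁]

theorem Derivation.usedAxioms_subset {Γ : List (L.Formula ℕ)} {φ : L.Formula ℕ}
    (d : Derivation T Γ φ) : d.usedAxioms ⊆ T := by
  induction d <;> simp_all [Derivation.usedAxioms]

theorem formulaSize_ofSentence (φ : L.Sentence) : formulaSize (ofSentence φ) = formulaSize φ := by
  rw [ofSentence_eq_gsub]
  refine le_antisymm ?_ (le_formulaSize_gsub _ _)
  refine (formulaSize_gsub_le φ _ le_rfl ?_).trans (mul_one _).le
  rintro (a | i)
  · exact a.elim
  · exact i.elim0

theorem Derivation.sequentSize_le {Γ : List (L.Formula ℕ)} {φ : L.Formula ℕ}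
    (d : Derivation T Γ φ) : sequentSize Γ φ ≤ d.size := by
  cases d <;> simp [Derivation.size] <;> omega

theorem Derivation.formulaSize_lt {Γ : List (L.Formula ℕ)} {φ : L.Formula ℕ}
    (d : Derivation T Γ φ) : formulaSize φ < d.size := by
  have := d.sequentSize_le
  unfold sequentSize at this
  omega

/-- A derivation is longer than each of the axioms that it uses. -/
theorem Derivation.formulaSize_lt_of_mem {Γ : List (L.Formula ℕ)} {φ : L.Formula ℕ}
    (d : Derivation T Γ φ) {ψ : L.Sentence} (h : ψ ∈ d.usedAxioms) : formulaSize ψ < d.size := by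
  induction d with
  | axm Γ φ hφ =>
    obtain rfl : ψ = φ := h
    have := (Derivation.axm Γ ψ hφ).formulaSize_lt
    rwa [formulaSize_ofSentence] at this
  | hyp => exact h.elim
  | eqI => exact h.elim
  | impI Γ φ ψ d ih => have := ih h; simp only [Derivation.size]; omega
  | raa Γ φ d ih => have := ih h; simp only [Derivation.size]; omega
  | allI Γ φ d ih => have := ih h; simp only [Derivation.size]; omega
  | allE Γ φ t d ih => have := ih h; simp only [Derivation.size]; omega
  | impE Γ φ ψ d e ih₁ ih₂ =>
    simp only [Derivation.size]
    rcases h with h | h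
    · have := ih₁ h; omega
    · have := ih₂ h; omega
  | eqE Γ φ t s d e ih₁ ih₂ =>
    simp only [Derivation.size]
    rcases h with h | h
    · have := ih₁ h; omega
    · have := ih₂ h; omega

/-! ### Structural rules -/

/-- `φ` is derivable from the assumptions `Γ` and the axioms `T`. -/
def Prov (T : L.Theory) (Γ : List (L.Formula ℕ)) (φ : L.Formula ℕ) : Prop :=
  Nonempty (Derivation T Γ φ)

theorem Prov.weaken {Γ Δ : List (L.Formula ℕ)} {φ : L.Formula ℕ} (h : Prov T Γ φ) (hs : Γ ⊆ Δ) :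
    Prov T Δ φ := by
  obtain ⟨d⟩ := h
  induction d generalizing Δ with
  | axm Γ φ h => exact ⟨.axm _ _ h⟩
  | hyp Γ φ h => exact ⟨.hyp _ _ (hs h)⟩
  | impI Γ φ ψ d ih => exact (ih (List.cons_subset_cons _ hs)).map (.impI _ _ _)
  | impE Γ φ ψ d e ih₁ ih₂ => obtain ⟨a⟩ := ih₁ hs; obtain ⟨b⟩ := ih₂ hs; exact ⟨.impE _ _ _ a b⟩
  | raa Γ φ d ih => exact (ih (List.cons_subset_cons _ hs)).map (.raa _ _)
  | allI Γ φ d ih => exact (ih (List.map_subset _ hs)).map (.allI _ _)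
  | allE Γ φ t d ih => exact (ih hs).map (.allE _ _ t)
  | eqI Γ t => exact ⟨.eqI _ t⟩
  | eqE Γ φ t s d e ih₁ ih₂ =>
    obtain ⟨a⟩ := ih₁ hs; obtain ⟨b⟩ := ih₂ hs; exact ⟨.eqE _ _ _ _ a b⟩

theorem instantiate_subst (φ : L.BoundedFormula ℕ 1) (t : L.Term ℕ) (σ : ℕ → L.Term ℕ) :
    (instantiate φ t).subst σ = instantiate (φ.subst σ) (t.subst σ) := by
  simp only [instantiate_eq_gsub, subst_eq_gsub, gsub_gsub]
  refine gsub_congr _ ?_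
  rintro (a | i) <;> simp [Term.subst, relabel_eq_subst, subst_subst]

/-- Derivability is closed under substitution for the free variables. -/
theorem Prov.subst {Γ : List (L.Formula ℕ)} {φ : L.Formula ℕ} (h : Prov T Γ φ)
    (σ : ℕ → L.Term ℕ) : Prov T (Γ.map fun ψ => ψ.subst σ) (φ.subst σ) := by
  obtain ⟨d⟩ := h
  induction d generalizing σ with
  | axm Γ φ h => rw [ofSentence_subst]; exact ⟨.axm _ _ h⟩
  | hyp Γ φ h => exact ⟨.hyp _ _ (List.mem_map_of_mem h)⟩
  | impI Γ φ ψ d ih => exact (ih σ).map (.impI _ _ _)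
  | impE Γ φ ψ d e ih₁ ih₂ => obtain ⟨a⟩ := ih₁ σ; obtain ⟨b⟩ := ih₂ σ; exact ⟨.impE _ _ _ a b⟩
  | raa Γ φ d ih => exact (ih σ).map (.raa _ _)
  | allI Γ φ d ih =>
    -- the eigenvariable is kept, and the other variables receive the shifted terms
    let τ : ℕ → L.Term ℕ := fun i => Nat.casesOn i (Term.var 0) fun i => (σ i).relabel (· + 1)
    have hτ {n : ℕ} (ψ : L.BoundedFormula ℕ n) : (shift ψ).subst τ = shift (ψ.subst σ) := by
      simp only [shift_eq_gsub, subst_eq_gsub, gsub_gsub]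
      refine gsub_congr _ ?_
      rintro (a | i) <;> simp [Term.subst, τ, relabel_eq_subst, subst_subst]
    have h := ih τ
    rw [instantiate_subst, hτ] at h
    have e : (Γ.map shift).map (fun ψ => ψ.subst τ) = (Γ.map fun ψ => ψ.subst σ).map shift := by
      simp [Function.comp_def, hτ]
    rw [e] at h
    have e' : (∀' φ).subst σ = ∀' (φ.subst σ) := rfl
    rw [e']
    exact h.map (.allI _ _)
  | allE Γ φ t d ih => rw [instantiate_subst]; exact (ih σ).map (.allE _ _ _)
  | eqI Γ t =>
    have e : (Term.equal t t).subst σ = Term.equal (t.subst σ) (t.subst σ) := by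
      simp [Term.equal, Term.bdEqual, subst_eq_gsub, gsub, relabel_eq_subst, subst_subst, Term.subst]
    rw [e]; exact ⟨.eqI _ _⟩
  | eqE Γ φ t s d e ih₁ ih₂ =>
    obtain ⟨a⟩ := ih₁ σ; obtain ⟨b⟩ := ih₂ σ
    rw [instantiate_subst] at *
    have e : (Term.equal t s).subst σ = Term.equal (t.subst σ) (s.subst σ) := by
      simp [Term.equal, Term.bdEqual, subst_eq_gsub, gsub, relabel_eq_subst, subst_subst, Term.subst]
    rw [e] at a
    exact ⟨.eqE _ _ _ _ a b⟩

theorem Prov.hyp {Γ : List (L.Formula ℕ)} {φ : L.Formula ℕ} (h : φ ∈ Γ) : Prov T Γ φ := ⟨.hyp _ _ h⟩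

theorem Prov.mp {Γ : List (L.Formula ℕ)} {φ ψ : L.Formula ℕ} (h : Prov T Γ (φ ⟹ ψ))
    (h' : Prov T Γ φ) : Prov T Γ ψ := by
  obtain ⟨a⟩ := h; obtain ⟨b⟩ := h'; exact ⟨.impE _ _ _ a b⟩

theorem Prov.cut {Γ : List (L.Formula ℕ)} {φ ψ : L.Formula ℕ} (h : Prov T (φ :: Γ) ψ)
    (h' : Prov T Γ φ) : Prov T Γ ψ := Prov.mp (h.map (.impI _ _ _)) h'

theorem Prov.bot {Γ : List (L.Formula ℕ)} {φ : L.Formula ℕ} (h : Prov T Γ ⊥) : Prov T Γ φ :=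
  (h.weaken (List.subset_cons_self _ _)).map (.raa _ _)

theorem Prov.eq_mp {Γ : List (L.Formula ℕ)} (φ : L.BoundedFormula ℕ 1) {t s : L.Term ℕ}
    (h : Prov T Γ (Term.equal t s)) (h' : Prov T Γ (instantiate φ t)) :
    Prov T Γ (instantiate φ s) := by
  obtain ⟨a⟩ := h; obtain ⟨b⟩ := h'; exact ⟨.eqE _ _ _ _ a b⟩

/-! ### The Henkin construction -/

/-- The free variables of `φ` are among `x_0, …, x_{N-1}`, expressed by saying that the result of a
substitution does not depend on what is substituted for the other variables. -/
def FreshFrom {n : ℕ} (N : ℕ) (φ : L.BoundedFormula ℕ n) : Prop :=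
  ∀ {m : ℕ} (f g : ℕ ⊕ Fin n → L.Term (ℕ ⊕ Fin m)), (∀ i < N, f (.inl i) = g (.inl i)) →
    (∀ i, f (.inr i) = g (.inr i)) → gsub φ f = gsub φ g

theorem exists_term_fresh {n : ℕ} (t : L.Term (ℕ ⊕ Fin n)) :
    ∃ N, ∀ {β : Type} (f g : ℕ ⊕ Fin n → L.Term β), (∀ i < N, f (.inl i) = g (.inl i)) →
    (∀ i, f (.inr i) = g (.inr i)) → t.subst f = t.subst g := by
  induction t with
  | var a =>
    rcases a with a | i
    · exact ⟨a + 1, fun f g h _ => h a (Nat.lt_succ_self a)⟩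
    · exact ⟨0, fun f g _ h => h i⟩
  | func F ts ih =>
    choose N hN using ih
    refine ⟨Finset.univ.sup N, fun f g h h' => ?_⟩
    simp only [Term.subst]
    congr 1; funext i
    exact hN i f g (fun j hj => h j (hj.trans_le (Finset.le_sup (f := N) (Finset.mem_univ i)))) h'

theorem exists_freshFrom {n : ℕ} (φ : L.BoundedFormula ℕ n) : ∃ N, FreshFrom N φ := by
  induction φ with
  | falsum => exact ⟨0, fun _ _ _ _ => rfl⟩
  | equal t s =>
    obtain ⟨N, hN⟩ := exists_term_fresh t
    obtain ⟨K, hK⟩ := exists_term_fresh s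
    refine ⟨max N K, fun f g h h' => ?_⟩
    simp only [gsub]
    rw [hN f g (fun i hi => h i (lt_max_of_lt_left hi)) h',
      hK f g (fun i hi => h i (lt_max_of_lt_right hi)) h']
  | rel R ts =>
    choose N hN using fun i => exists_term_fresh (ts i)
    refine ⟨Finset.univ.sup N, fun f g h h' => ?_⟩
    simp only [gsub]
    congr 1; funext i
    exact hN i f g (fun j hj => h j (hj.trans_le (Finset.le_sup (f := N) (Finset.mem_univ i)))) h'
  | imp φ ψ ih₁ ih₂ =>
    obtain ⟨N, hN⟩ := ih₁
    obtain ⟨K, hK⟩ := ih₂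
    refine ⟨max N K, fun f g h h' => ?_⟩
    simp only [gsub]
    rw [hN f g (fun i hi => h i (lt_max_of_lt_left hi)) h',
      hK f g (fun i hi => h i (lt_max_of_lt_right hi)) h']
  | all φ ih =>
    obtain ⟨N, hN⟩ := ih
    refine ⟨N, fun f g h h' => ?_⟩
    simp only [gsub]
    rw [hN (up f) (up g) (fun i hi => by simp [h i hi])]
    intro i
    refine Fin.lastCases ?_ (fun i => ?_) i <;> simp [h']

theorem FreshFrom.mono {n N K : ℕ} {φ : L.BoundedFormula ℕ n} (h : FreshFrom N φ) (hNK : N ≤ K) :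
    FreshFrom K φ := fun f g hf => h f g fun i hi => hf i (hi.trans_le hNK)

theorem exists_freshFrom_list (Γ : List (L.Formula ℕ)) : ∃ N, ∀ φ ∈ Γ, FreshFrom N φ := by
  induction Γ with
  | nil => exact ⟨0, by simp⟩
  | cons φ Γ ih =>
    obtain ⟨N, hN⟩ := ih
    obtain ⟨K, hK⟩ := exists_freshFrom φ
    refine ⟨max N K, ?_⟩
    simp only [List.mem_cons, forall_eq_or_imp]
    exact ⟨hK.mono (le_max_right _ _), fun ψ h => FreshFrom.mono (hN ψ h) (le_max_left _ _)⟩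

/-- Generalization on a variable that occurs neither in the assumptions nor in the formula. -/
theorem Prov.gen {Γ : List (L.Formula ℕ)} {φ : L.BoundedFormula ℕ 1} {m : ℕ}
    (hΓ : ∀ ψ ∈ Γ, FreshFrom m ψ) (hφ : FreshFrom m φ) (h : Prov T Γ (instantiate φ (Term.var m))) :
    Prov T Γ (∀' φ) := by
  have h' := h.subst fun i => if i = m then Term.var 0 else Term.var (i + 1)
  have e {n : ℕ} (ψ : L.BoundedFormula ℕ n) (hψ : FreshFrom m ψ) :
      (ψ.subst fun i => if i = m then Term.var 0 else Term.var (i + 1)) = shift ψ := by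
    rw [subst_eq_gsub, shift_eq_gsub]
    refine hψ _ _ (fun i hi => ?_) (fun i => rfl)
    simp [hi.ne]
  rw [instantiate_subst, e φ hφ, List.map_congr_left fun ψ hψ => e ψ (hΓ ψ hψ)] at h'
  simp only [Term.subst, if_true] at h'
  exact h'.map (.allI _ _)

/-- `Γ` together with `T` is consistent. -/
def Con (T : L.Theory) (Γ : List (L.Formula ℕ)) : Prop := ¬ Prov T Γ ⊥

/-- One step of the Henkin construction. A formula is decided, and a fresh variable is used as the
witness when a universal formula is refuted. -/
theorem Con.extend {Γ : List (L.Formula ℕ)} (h : Con T Γ) (ψ : L.Formula ℕ) :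
    ∃ Δ, Con T Δ ∧ Γ ⊆ Δ ∧ (ψ ∈ Δ ∨ ∼ψ ∈ Δ ∧
      ∀ φ : L.BoundedFormula ℕ 1, ψ = ∀' φ → ∃ m, ∼(instantiate φ (Term.var m)) ∈ Δ) := by
  by_cases hψ : Con T (ψ :: Γ)
  · exact ⟨_, hψ, List.subset_cons_self _ _, .inl List.mem_cons_self⟩
  have hn : Con T (∼ψ :: Γ) := fun h₁ => h (Prov.cut (not_not.1 hψ) (h₁.map (.raa _ _)))
  by_cases hall : ∃ φ : L.BoundedFormula ℕ 1, ψ = ∀' φ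
  · obtain ⟨φ, rfl⟩ := hall
    obtain ⟨N, hN⟩ := exists_freshFrom_list (∼(∀' φ) :: Γ)
    obtain ⟨K, hK⟩ := exists_freshFrom φ
    refine ⟨∼(instantiate φ (Term.var (max N K))) :: ∼(∀' φ) :: Γ, fun h₁ => hn ?_,
      fun x hx => by simp [hx], .inr ⟨by simp, ?_⟩⟩
    · exact (Prov.hyp List.mem_cons_self).mp (Prov.gen (m := max N K)
        (fun ψ h => FreshFrom.mono (hN ψ h) (le_max_left _ _)) (hK.mono (le_max_right _ _))
        (h₁.map (.raa _ _)))
    · intro φ' h'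
      obtain rfl : φ = φ' := by injection h'
      exact ⟨max N K, by simp⟩
  · exact ⟨_, hn, List.subset_cons_self _ _, .inr ⟨List.mem_cons_self, fun φ h' =>
      absurd ⟨φ, h'⟩ hall⟩⟩

/-- A maximal consistent set of formulas with witnesses for the refuted universal formulas. -/
structure Henkin (T : L.Theory) (Θ : Set (L.Formula ℕ)) : Prop where
  closed : ∀ (Γ : List (L.Formula ℕ)) (φ : L.Formula ℕ), (∀ ψ ∈ Γ, ψ ∈ Θ) → Prov T Γ φ → φ ∈ Θ
  bot : (⊥ : L.Formula ℕ) ∉ Θ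
  total : ∀ φ : L.Formula ℕ, φ ∈ Θ ∨ ∼φ ∈ Θ
  witness : ∀ φ : L.BoundedFormula ℕ 1, ∼(∀' φ) ∈ Θ → ∃ t, ∼(instantiate φ t) ∈ Θ

/-- Lindenbaum's lemma: one formula after the other is decided, along an enumeration. -/
theorem Con.exists_henkin [Countable (L.Formula ℕ)] {Γ : List (L.Formula ℕ)} (h : Con T Γ) :
    ∃ Θ, Henkin T Θ ∧ ∀ φ ∈ Γ, φ ∈ Θ := by
  have : Nonempty (L.Formula ℕ) := ⟨⊥⟩
  obtain ⟨enum, henum⟩ := exists_surjective_nat (L.Formula ℕ)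
  choose next hnext using fun (Γ : {Γ : List (L.Formula ℕ) // Con T Γ}) (ψ : L.Formula ℕ) =>
    Γ.2.extend ψ
  let seq : ℕ → {Γ : List (L.Formula ℕ) // Con T Γ} := fun n =>
    Nat.rec ⟨Γ, h⟩ (fun n Δ => ⟨next Δ (enum n), (hnext Δ (enum n)).1⟩) n
  have hmono : ∀ n m, n ≤ m → (seq n).1 ⊆ (seq m).1 := fun n m hnm => by
    induction hnm with
    | refl => exact fun x hx => hx
    | step _ ih => exact fun x hx => (hnext (seq _) (enum _)).2.1 (ih hx)
  let Θ : Set (L.Formula ℕ) := {φ | ∃ n, φ ∈ (seq n).1}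
  have hfin (Δ : List (L.Formula ℕ)) (hΔ : ∀ ψ ∈ Δ, ψ ∈ Θ) : ∃ n, Δ ⊆ (seq n).1 := by
    induction Δ with
    | nil => exact ⟨0, by simp⟩
    | cons φ Δ ih =>
      obtain ⟨n, hn⟩ := ih fun ψ hψ => hΔ ψ (List.mem_cons_of_mem _ hψ)
      obtain ⟨m, hm⟩ := hΔ φ List.mem_cons_self
      refine ⟨max n m, List.cons_subset.2 ⟨hmono _ _ (le_max_right _ _) hm,
        fun x hx => hmono _ _ (le_max_left _ _) (hn hx)⟩⟩
  have hcon (Δ : List (L.Formula ℕ)) (hΔ : ∀ ψ ∈ Δ, ψ ∈ Θ) : Con T Δ := fun hb => by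
    obtain ⟨n, hn⟩ := hfin Δ hΔ
    exact (seq n).2 (hb.weaken hn)
  have hdec (ψ : L.Formula ℕ) : ψ ∈ Θ ∨ ∼ψ ∈ Θ ∧
      ∀ φ : L.BoundedFormula ℕ 1, ψ = ∀' φ → ∃ m, ∼(instantiate φ (Term.var m)) ∈ Θ := by
    obtain ⟨n, rfl⟩ := henum ψ
    rcases (hnext (seq n) (enum n)).2.2 with h₁ | ⟨h₁, h₂⟩
    · exact .inl ⟨n + 1, h₁⟩
    · refine .inr ⟨⟨n + 1, h₁⟩, fun φ hφ => ?_⟩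
      obtain ⟨m, hm⟩ := h₂ φ hφ
      exact ⟨m, n + 1, hm⟩
  refine ⟨Θ, ⟨?_, ?_, ?_, ?_⟩, fun φ hφ => ⟨0, hφ⟩⟩
  · intro Δ φ hΔ hp
    refine (hdec φ).resolve_right fun hn => hcon (∼φ :: Δ) ?_ ?_
    · simpa using ⟨hn.1, hΔ⟩
    · exact (Prov.hyp List.mem_cons_self).mp (hp.weaken (List.subset_cons_self _ _))
  · exact fun hb => hcon [⊥] (by simpa using hb) (Prov.hyp List.mem_cons_self)
  · exact fun φ => (hdec φ).imp_right And.left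
  · intro φ hφ
    rcases hdec (∀' φ) with h₁ | ⟨-, h₁⟩
    · refine absurd ?_ (hcon [∼(∀' φ), ∀' φ] (by simpa using ⟨hφ, h₁⟩))
      exact (Prov.hyp (φ := ∼(∀' φ)) (by simp)).mp (Prov.hyp (by simp))
    · obtain ⟨m, hm⟩ := h₁ φ rfl
      exact ⟨_, hm⟩

namespace Henkin

variable {Θ : Set (L.Formula ℕ)} (H : Henkin T Θ)

include H

theorem mp {φ ψ : L.Formula ℕ} (h : (φ ⟹ ψ) ∈ Θ) (h' : φ ∈ Θ) : ψ ∈ Θ :=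
  H.closed [φ ⟹ ψ, φ] ψ (by simpa using ⟨h, h'⟩)
    ((Prov.hyp (φ := φ ⟹ ψ) (by simp)).mp (Prov.hyp (by simp)))

theorem not_mem_of_not {φ : L.Formula ℕ} (h : ∼φ ∈ Θ) : φ ∉ Θ := fun h' => H.bot (H.mp h h')

theorem imp_mem {φ ψ : L.Formula ℕ} : (φ ⟹ ψ) ∈ Θ ↔ (φ ∈ Θ → ψ ∈ Θ) := by
  refine ⟨H.mp, fun h => ?_⟩
  rcases H.total φ with h₁ | h₁
  · exact H.closed [ψ] _ (by simpa using h h₁) ⟨.impI _ _ _ (.hyp _ _ (by simp))⟩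
  · have h₂ : Prov T [φ, ∼φ] ψ :=
      Prov.bot ((Prov.hyp (φ := ∼φ) (by simp)).mp (Prov.hyp (by simp)))
    exact H.closed [∼φ] _ (by simpa using h₁) (h₂.map (.impI _ _ _))

theorem all_mem {φ : L.BoundedFormula ℕ 1} : (∀' φ) ∈ Θ ↔ ∀ t, instantiate φ t ∈ Θ := by
  refine ⟨fun h t => H.closed [∀' φ] _ (by simpa using h)
    ⟨.allE _ _ t (.hyp _ _ (by simp))⟩, fun h => ?_⟩
  refine (H.total _).resolve_right fun hn => ?_
  obtain ⟨t, ht⟩ := H.witness φ hn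
  exact H.not_mem_of_not ht (h t)

theorem eq_mp (φ : L.BoundedFormula ℕ 1) {t s : L.Term ℕ} (h : Term.equal t s ∈ Θ)
    (h' : instantiate φ t ∈ Θ) : instantiate φ s ∈ Θ :=
  H.closed [Term.equal t s, instantiate φ t] _ (by simpa using ⟨h, h'⟩)
    (Prov.eq_mp φ (t := t) (Prov.hyp (by simp)) (Prov.hyp (by simp)))

end Henkin

end Metatheory

/-! ### The term model and completeness -/

section Completeness

variable {L : FirstOrder.Language.{0, 0}} {T : L.Theory} {Θ : Set (L.Formula ℕ)}

/-- Substitute terms for all the bound variables of a formula. -/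
def instAll {n : ℕ} (φ : L.BoundedFormula ℕ n) (σ : Fin n → L.Term ℕ) : L.Formula ℕ :=
  gsub φ (m := 0) (Sum.elim (fun i => Term.var (.inl i)) fun i => free (σ i))

theorem instantiate_up {n : ℕ} (φ : L.BoundedFormula ℕ (n + 1)) (σ : Fin n → L.Term ℕ)
    (t : L.Term ℕ) :
    instantiate (gsub φ (up (Sum.elim (fun i => Term.var (.inl i)) fun i => free (m := 0) (σ i)))) t
      = instAll φ (Fin.snoc σ t : Fin (n + 1) → L.Term ℕ) := by
  rw [instantiate_eq_gsub, gsub_gsub]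
  refine gsub_congr _ (var_cases (fun a => ?_) (fun i => ?_) ?_)
  · simp [liftTerm, Term.subst, Term.relabel]
  · simp [liftTerm_eq_subst, subst_subst, relabel_eq_subst, Term.subst]
  · rw [up_last]; simp [Term.subst]

namespace Henkin

variable (H : Henkin T Θ)

include H

theorem eq_refl (t : L.Term ℕ) : Term.equal t t ∈ Θ :=
  H.closed [] _ (by simp) ⟨.eqI _ t⟩

theorem eq_symm {t s : L.Term ℕ} (h : Term.equal t s ∈ Θ) : Term.equal s t ∈ Θ := by
  have e (r : L.Term ℕ) : instantiate (.equal (Term.var (.inr 0)) (free t)) r = Term.equal r t := by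
    simp [instantiate_eq_gsub, gsub, Term.equal, Term.bdEqual, Term.subst, relabel_eq_subst,
      subst_subst]
  have := H.eq_mp (.equal (Term.var (.inr 0)) (free t)) h (by rw [e]; exact H.eq_refl t)
  rwa [e] at this

/-- Provably equal terms may be exchanged simultaneously. -/
theorem instAll_congr {n : ℕ} (φ : L.BoundedFormula ℕ n) {σ τ : Fin n → L.Term ℕ}
    (h : ∀ i, Term.equal (σ i) (τ i) ∈ Θ) (hσ : instAll φ σ ∈ Θ) : instAll φ τ ∈ Θ := by
  -- the terms are exchanged one at a time
  have key : ∀ N ≤ n, instAll φ (fun i => if i.1 < N then τ i else σ i) ∈ Θ := by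
    intro N
    induction N with
    | zero => intro _; simpa using hσ
    | succ N ih =>
      intro hN
      let χ : L.BoundedFormula ℕ 1 := gsub φ (Sum.elim (fun i => Term.var (.inl i)) fun i =>
        if i.1 = N then Term.var (.inr 0) else free (if i.1 < N then τ i else σ i))
      have e (r : L.Term ℕ) : instantiate χ r =
          instAll φ fun i => if i.1 = N then r else if i.1 < N then τ i else σ i := by
        rw [instantiate_eq_gsub, gsub_gsub]
        refine gsub_congr _ ?_
        rintro (a | i)
        · simp [Term.subst]
        · by_cases hi : i.1 = N
          · simp [Term.subst, hi]
          · simp [hi, relabel_eq_subst, subst_subst, Term.subst]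
      have h₁ := H.eq_mp χ (h ⟨N, hN⟩) (by
        rw [e]
        convert ih (Nat.le_of_succ_le hN) using 2
        funext i
        by_cases hi : i.1 = N
        · obtain rfl : i = ⟨N, hN⟩ := Fin.ext hi
          simp
        · simp [hi])
      rw [e] at h₁
      convert h₁ using 2
      funext i
      by_cases hi : i.1 = N
      · obtain rfl : i = ⟨N, hN⟩ := Fin.ext hi
        simp
      · have : i.1 < N + 1 ↔ i.1 < N := by omega
        simp [hi, this]
  simpa using key n le_rfl

theorem eq_trans {t s r : L.Term ℕ} (h : Term.equal t s ∈ Θ) (h' : Term.equal s r ∈ Θ) :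
    Term.equal t r ∈ Θ := by
  have e (r : L.Term ℕ) : instantiate (.equal (free t) (Term.var (.inr 0))) r = Term.equal t r := by
    simp [instantiate_eq_gsub, gsub, Term.equal, Term.bdEqual, Term.subst, relabel_eq_subst,
      subst_subst]
  have := H.eq_mp (.equal (free t) (Term.var (.inr 0))) h' (by rw [e]; exact h)
  rwa [e] at this

/-- Terms are identified when their equality belongs to the Henkin set. -/
def setoid : Setoid (L.Term ℕ) where
  r t s := Term.equal t s ∈ Θ
  iseqv := ⟨H.eq_refl, H.eq_symm, H.eq_trans⟩

/-- The universe of the term model. -/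
def Model : Type := Quotient H.setoid

/-- The class of a term in the term model. -/
def cls (t : L.Term ℕ) : H.Model := Quotient.mk H.setoid t

/-- A representative of an element of the term model. -/
noncomputable def rep (a : H.Model) : L.Term ℕ := Quotient.out a

theorem cls_surjective (a : H.Model) : ∃ t, H.cls t = a := Quotient.exists_rep a

theorem cls_eq_cls {t s : L.Term ℕ} :
    (H.cls t = H.cls s) ↔ Term.equal t s ∈ Θ := Quotient.eq

theorem equal_rep (t : L.Term ℕ) : Term.equal (H.rep (H.cls t)) t ∈ Θ :=
  H.cls_eq_cls.1 (Quotient.out_eq _)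

/-- The term model: functions act on terms, and a relation holds if the atomic formula belongs to
the Henkin set. -/
noncomputable abbrev termStructure : L.Structure H.Model where
  funMap f xs := H.cls (Term.func f fun i => H.rep (xs i))
  RelMap R xs := R.formula (fun i => H.rep (xs i)) ∈ Θ

theorem realize_term {n : ℕ} (t : L.Term (ℕ ⊕ Fin n)) (σ : Fin n → L.Term ℕ) :
    letI := H.termStructure
    t.realize (Sum.elim (fun i => H.cls (Term.var i))
      fun i => H.cls (σ i)) =
      H.cls (t.subst (Sum.elim Term.var σ)) := by
  let _ := H.termStructure
  induction t with
  | var a => rcases a with a | i <;> rfl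
  | @func l f ts ih =>
    simp only [Term.realize, ih, Term.subst]
    refine H.cls_eq_cls.2 ?_
    let s : Fin l → L.Term ℕ := fun i => (ts i).subst (Sum.elim Term.var σ)
    let χ : L.BoundedFormula ℕ l :=
      .equal (Term.func f fun i => Term.var (.inr i)) (free (Term.func f s))
    have e (r : Fin l → L.Term ℕ) :
        instAll χ r = Term.equal (Term.func f r) (Term.func f s) := by
      simp [χ, instAll, gsub, Term.subst, Term.equal, Term.bdEqual, relabel_eq_subst, subst_subst]
    have key := H.instAll_congr χ (fun i => H.eq_symm (H.equal_rep (s i)))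
      (by rw [e]; exact H.eq_refl _)
    rwa [e] at key

/-- A formula holds in the term model if and only if it belongs to the Henkin set. -/
theorem truth {n : ℕ} (φ : L.BoundedFormula ℕ n) (σ : Fin n → L.Term ℕ) :
    letI := H.termStructure
    φ.Realize (fun i => H.cls (Term.var i))
      (fun i => H.cls (σ i)) ↔ instAll φ σ ∈ Θ := by
  let _ := H.termStructure
  have hs {n : ℕ} (t : L.Term (ℕ ⊕ Fin n)) (σ : Fin n → L.Term ℕ) :
      (t.subst (Sum.elim Term.var σ)).relabel Sum.inl =
        t.subst (Sum.elim (fun i => Term.var (.inl i)) fun i => free (m := 0) (σ i)) := by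
    rw [relabel_eq_subst, subst_subst]
    congr 1; funext v
    rcases v with a | i <;> simp [Term.subst, relabel_eq_subst]
  induction φ with
  | falsum => exact iff_of_false id H.bot
  | equal t s =>
    simp only [BoundedFormula.Realize, H.realize_term, H.cls_eq_cls, instAll, gsub, Term.equal,
      Term.bdEqual, hs]
  | @rel n l R ts =>
    simp only [BoundedFormula.Realize, H.realize_term]
    let s : Fin l → L.Term ℕ := fun i => (ts i).subst (Sum.elim Term.var σ)
    have e (r : Fin l → L.Term ℕ) :
        instAll (.rel R fun i => Term.var (.inr i)) r = R.formula r := by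
      simp [instAll, gsub, Term.subst, Relations.formula, Relations.boundedFormula]
    have e' : instAll (.rel R ts) σ = R.formula s := by
      simp [instAll, gsub, Relations.formula, Relations.boundedFormula, s, hs]
    rw [e', ← e]
    change R.formula (fun i => H.rep (H.cls (s i))) ∈ Θ ↔ _
    rw [← e]
    exact ⟨H.instAll_congr _ fun i => H.equal_rep (s i),
      H.instAll_congr _ fun i => H.eq_symm (H.equal_rep (s i))⟩
  | imp φ ψ ih₁ ih₂ =>
    exact (BoundedFormula.realize_imp.trans (imp_congr (ih₁ σ) (ih₂ σ))).trans H.imp_mem.symm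
  | all φ ih =>
    rw [BoundedFormula.realize_all, instAll, gsub]
    refine Iff.trans ?_ H.all_mem.symm
    simp only [instantiate_up, ← ih]
    have e {n : ℕ} (σ : Fin n → L.Term ℕ) (t : L.Term ℕ) :
        (Fin.snoc (fun i => H.cls (σ i)) (H.cls t) :
          Fin (n + 1) → H.Model) =
        fun i => H.cls ((Fin.snoc σ t : Fin (n + 1) → L.Term ℕ) i) := by
      funext i
      refine Fin.lastCases ?_ (fun i => ?_) i <;> simp
    exact ⟨fun h t => e σ t ▸ h _, fun h a => by
      obtain ⟨t, rfl⟩ := H.cls_surjective a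
      exact (e σ t).symm ▸ h t⟩

theorem truth_sentence (φ : L.Sentence) :
    letI := H.termStructure
    H.Model ⊨ φ ↔ ofSentence φ ∈ Θ := by
  let _ := H.termStructure
  rw [← realize_ofSentence φ fun i => H.cls (Term.var i)]
  have := H.truth (ofSentence φ) Fin.elim0
  have e : instAll (ofSentence φ) Fin.elim0 = ofSentence φ := by
    rw [instAll, ofSentence_eq_gsub, gsub_gsub]
    refine gsub_congr _ ?_
    rintro (a | i)
    · exact a.elim
    · exact i.elim0
  rw [e] at this
  rw [← this, Formula.Realize]
  exact iff_of_eq (congrArg _ (Subsingleton.elim _ _))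

end Henkin

/-- Gödel's completeness theorem for the natural deduction system, over a countable language. -/
theorem completeness [Countable (L.Formula ℕ)] (φ : L.Sentence)
    (h : ∀ (M : Type) [L.Structure M] [Nonempty M], M ⊨ T → M ⊨ φ) : Nonempty (Proof T φ) := by
  by_contra hn
  have hc : Con T [∼(ofSentence φ)] := fun hb => hn (hb.map (.raa _ _))
  obtain ⟨Θ, H, hΘ⟩ := hc.exists_henkin
  let _ := H.termStructure
  have : Nonempty H.Model := ⟨H.cls (Term.var 0)⟩
  have hM : H.Model ⊨ φ := h H.Model ⟨fun {ψ} hψ =>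
    (H.truth_sentence ψ).2 (H.closed [] _ (by simp) ⟨.axm _ _ hψ⟩)⟩
  exact H.not_mem_of_not (hΘ _ (by simp)) ((H.truth_sentence φ).1 hM)

end Completeness

/-! ### Formulas with a relation variable -/

section Schemes

/-- The single relation symbol of `langG`, with four places. -/
inductive GraphRel : ℕ → Type
  | graph : GraphRel 4

/-- The language `lang` with an additional quaternary relation symbol. A formula of `langG` is a
scheme, whose instances are obtained by replacing the symbol by a formula with four variables. -/
def langG : FirstOrder.Language := ⟨RcfFunc, GraphRel⟩

/-- The inclusion of `lang` in `langG`. -/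
def embed : lang →ᴸ langG where
  onFunction _ f := f
  onRelation _ r := nomatch r

variable {L : FirstOrder.Language.{0, 0}} {α β : Type} (e : lang →ᴸ L) (γ : L.Formula (Fin 4))

/-- Translate a term of `langG`. -/
def trTerm : langG.Term α → L.Term α
  | .var a => .var a
  | .func f ts => .func (e.onFunction f) fun i => trTerm (ts i)

/-- The instance of a scheme in which the relation symbol is replaced by `γ`. -/
def tr : ∀ {n : ℕ}, langG.BoundedFormula α n → L.BoundedFormula α n
  | _, .falsum => .falsum
  | _, .equal t s => .equal (trTerm e t) (trTerm e s)
  | _, .rel .graph ts => gsub γ (Sum.elim (fun i => trTerm e (ts i)) Fin.elim0)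
  | _, .imp φ ψ => .imp (tr φ) (tr ψ)
  | _, .all φ => .all (tr φ)

theorem trTerm_subst (t : langG.Term α) (f : α → langG.Term β) :
    trTerm e (t.subst f) = (trTerm e t).subst fun v => trTerm e (f v) := by
  induction t with
  | var a => rfl
  | func F ts ih => simp [trTerm, Term.subst, ih]

theorem trTerm_relabel (t : langG.Term α) (f : α → β) :
    trTerm e (t.relabel f) = (trTerm e t).relabel f := by
  rw [relabel_eq_subst, relabel_eq_subst, trTerm_subst]; rfl

theorem trTerm_up {n m : ℕ} (f : α ⊕ Fin n → langG.Term (β ⊕ Fin m)) :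
    (fun v => trTerm e (up f v)) = up fun v => trTerm e (f v) := by
  funext v
  revert v
  apply var_cases <;> intros <;> simp [liftTerm, trTerm_relabel, trTerm]

theorem tr_gsub {n m : ℕ} (φ : langG.BoundedFormula α n) (f : α ⊕ Fin n → langG.Term (β ⊕ Fin m)) :
    tr e γ (gsub φ f) = gsub (tr e γ φ) fun v => trTerm e (f v) := by
  induction φ generalizing m with
  | falsum => rfl
  | equal t s => simp [tr, gsub, trTerm_subst]
  | rel R ts =>
    cases R
    simp only [tr, gsub, gsub_gsub, trTerm_subst]
    refine gsub_congr _ ?_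
    rintro (a | i)
    · rfl
    · exact i.elim0
  | imp φ ψ ih₁ ih₂ => simp [tr, gsub, ih₁, ih₂]
  | all φ ih => simp [tr, gsub, ih, trTerm_up]

theorem tr_relabel {n k : ℕ} (φ : langG.BoundedFormula α k) (g : α → β ⊕ Fin n) :
    tr e γ (φ.relabel g) = (tr e γ φ).relabel g := by
  simp only [relabel_eq_gsub, tr_gsub]; rfl

theorem tr_formula_relabel (φ : langG.Formula α) (g : α → β) :
    tr e γ (Formula.relabel g φ) = Formula.relabel g (tr e γ φ) := by
  simp only [formula_relabel_eq_gsub, tr_gsub]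
  refine gsub_congr _ ?_
  rintro (a | i)
  · rfl
  · exact i.elim0

theorem tr_instantiate (φ : langG.BoundedFormula ℕ 1) (t : langG.Term ℕ) :
    tr e γ (instantiate φ t) = instantiate (tr e γ φ) (trTerm e t) := by
  simp only [instantiate_eq_gsub, tr_gsub]
  refine gsub_congr _ ?_
  rintro (a | i)
  · rfl
  · exact trTerm_relabel _ _ _

theorem tr_shift {n : ℕ} (φ : langG.BoundedFormula ℕ n) : tr e γ (shift φ) = shift (tr e γ φ) := by
  simp only [shift_eq_gsub, tr_gsub]
  refine gsub_congr _ ?_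
  rintro (a | i) <;> rfl

theorem tr_ofSentence (φ : langG.Sentence) :
    tr e γ (ofSentence φ) = ofSentence (tr e γ φ : L.Sentence) := by
  simp only [ofSentence_eq_gsub, tr_gsub]
  refine gsub_congr _ ?_
  rintro (a | i)
  · exact a.elim
  · exact i.elim0

theorem tr_equal (t s : langG.Term α) :
    tr e γ (Term.equal t s) = Term.equal (trTerm e t) (trTerm e s) := by
  simp [tr, Term.equal, Term.bdEqual, trTerm_relabel]

theorem tr_alls {n : ℕ} (φ : langG.BoundedFormula α n) : tr e γ φ.alls = (tr e γ φ).alls := by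
  induction n with
  | zero => rfl
  | succ n ih => exact ih _

theorem tr_exs {n : ℕ} (φ : langG.BoundedFormula α n) : tr e γ φ.exs = (tr e γ φ).exs := by
  induction n with
  | zero => rfl
  | succ n ih => exact ih _

theorem trTerm_embed (t : lang.Term α) : trTerm (LHom.id lang) (embed.onTerm t) = t := by
  induction t with
  | var a => rfl
  | func F ts ih => simp only [LHom.onTerm, trTerm, ih]; rfl

theorem tr_embed (γ : lang.Formula (Fin 4)) {n : ℕ} (φ : lang.BoundedFormula α n) :
    tr (LHom.id lang) γ (embed.onBoundedFormula φ) = φ := by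
  induction φ with
  | falsum => rfl
  | equal t s => simp [LHom.onBoundedFormula, Term.bdEqual, tr, trTerm_embed]
  | rel R ts => exact nomatch R
  | imp φ ψ ih₁ ih₂ => simp [LHom.onBoundedFormula, tr, ih₁, ih₂]
  | all φ ih => simp [LHom.onBoundedFormula, tr, ih]

/-- Instances of instances are instances. -/
theorem tr_tr (δ : langG.Formula (Fin 4)) {n : ℕ} (φ : langG.BoundedFormula α n) :
    tr e γ (tr embed δ φ) = tr e (tr e γ δ) φ := by
  have h {α : Type} (t : langG.Term α) : trTerm e (trTerm embed t) = trTerm e t := by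
    induction t with
    | var a => rfl
    | func F ts ih => simp only [trTerm, ih]; rfl
  induction φ with
  | falsum => rfl
  | equal t s => simp [tr, h]
  | rel R ts =>
    cases R
    simp only [tr, tr_gsub]
    refine gsub_congr _ ?_
    rintro (a | i)
    · exact h _
    · exact i.elim0
  | imp φ ψ ih₁ ih₂ => simp [tr, ih₁, ih₂]
  | all φ ih => simp [tr, ih]

theorem termSize_trTerm (t : langG.Term α) : termSize (trTerm e t) = termSize t := by
  induction t with
  | var a => rfl
  | func F ts ih => simp [trTerm, termSize, ih]

theorem formulaSize_tr_le {n : ℕ} (φ : langG.BoundedFormula α n) :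
    formulaSize (tr e γ φ) ≤ formulaSize γ * formulaSize φ := by
  have hγ := formulaSize_pos γ
  induction φ with
  | falsum => simpa [tr, formulaSize] using hγ
  | equal t s =>
    simp only [tr, formulaSize, termSize_trTerm]
    exact Nat.le_mul_of_pos_left _ hγ
  | rel R ts =>
    cases R
    simp only [tr, formulaSize]
    refine formulaSize_gsub_le _ _ (by omega) ?_
    rintro (i | i)
    · have := Finset.single_le_sum (f := fun i => termSize (ts i)) (fun _ _ => Nat.zero_le _)
        (Finset.mem_univ i)
      simp only [Sum.elim_inl, termSize_trTerm]; omega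
    · exact i.elim0
  | imp φ ψ ih₁ ih₂ => simp only [tr, formulaSize, mul_add]; omega
  | all φ ih => simp only [tr, formulaSize, mul_add]; omega

theorem sequentSize_tr_le (Γ : List (langG.Formula ℕ)) (φ : langG.Formula ℕ) :
    sequentSize (Γ.map (tr e γ)) (tr e γ φ) ≤ formulaSize γ * sequentSize Γ φ := by
  have hγ := formulaSize_pos γ
  have h₁ := formulaSize_tr_le e γ φ
  have h₂ : ((Γ.map (tr e γ)).map formulaSize).sum ≤ formulaSize γ * (Γ.map formulaSize).sum := by
    induction Γ with
    | nil => simp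
    | cons ψ Γ ih =>
      have := formulaSize_tr_le e γ ψ
      simp only [List.map_cons, List.sum_cons, mul_add] at ih ⊢
      omega
  simp only [sequentSize, mul_add]
  omega

/-- A derivation of a scheme yields derivations of all its instances, whose sizes are linear in the
size of the formula that replaces the relation symbol. -/
theorem Derivation.instance_le {T' : langG.Theory} {T : L.Theory}
    (hT : ∀ φ ∈ T', (tr e γ φ : L.Sentence) ∈ T) {Γ : List (langG.Formula ℕ)}
    {φ : langG.Formula ℕ} (d : Derivation T' Γ φ) :
    ∃ d' : Derivation T (Γ.map (tr e γ)) (tr e γ φ), d'.size ≤ formulaSize γ * d.size := by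
  induction d with
  | axm Γ φ h =>
    have := sequentSize_tr_le e γ Γ (ofSentence φ)
    rw [tr_ofSentence] at this ⊢
    exact ⟨.axm _ _ (hT φ h), this⟩
  | hyp Γ φ h => exact ⟨.hyp _ _ (List.mem_map_of_mem h), sequentSize_tr_le e γ Γ φ⟩
  | impI Γ φ ψ d ih =>
    obtain ⟨a, ha⟩ := ih
    have := sequentSize_tr_le e γ Γ (φ ⟹ ψ)
    refine ⟨.impI _ _ _ a, ?_⟩
    simp only [Derivation.size, mul_add]
    exact add_le_add this ha
  | impE Γ φ ψ d d₂ ih₁ ih₂ =>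
    obtain ⟨a, ha⟩ := ih₁
    obtain ⟨b, hb⟩ := ih₂
    refine ⟨.impE _ _ _ a b, ?_⟩
    simp only [Derivation.size, mul_add]
    exact add_le_add (add_le_add (sequentSize_tr_le e γ Γ ψ) ha) hb
  | raa Γ φ d ih =>
    obtain ⟨a, ha⟩ := ih
    refine ⟨.raa _ _ a, ?_⟩
    simp only [Derivation.size, mul_add]
    exact add_le_add (sequentSize_tr_le e γ Γ φ) ha
  | allI Γ φ d ih =>
    have h : (Γ.map shift).map (tr e γ) = (Γ.map (tr e γ)).map shift := by
      simp [Function.comp_def, tr_shift]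
    rw [h, tr_instantiate, tr_shift] at ih
    obtain ⟨a, ha⟩ := ih
    refine ⟨.allI _ _ a, ?_⟩
    simp only [Derivation.size, mul_add]
    exact add_le_add (sequentSize_tr_le e γ Γ (∀' φ)) ha
  | allE Γ φ t d ih =>
    obtain ⟨a, ha⟩ := ih
    have := sequentSize_tr_le e γ Γ (instantiate φ t)
    rw [tr_instantiate] at this ⊢
    refine ⟨.allE _ _ _ a, ?_⟩
    simp only [Derivation.size, mul_add]
    exact add_le_add this ha
  | eqI Γ t =>
    have := sequentSize_tr_le e γ Γ (Term.equal t t)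
    rw [tr_equal] at this ⊢
    exact ⟨.eqI _ _, this⟩
  | eqE Γ φ t s d d₂ ih₁ ih₂ =>
    rw [tr_equal] at ih₁
    rw [tr_instantiate] at ih₂
    obtain ⟨a, ha⟩ := ih₁
    obtain ⟨b, hb⟩ := ih₂
    have := sequentSize_tr_le e γ Γ (instantiate φ s)
    rw [tr_instantiate] at this ⊢
    refine ⟨.eqE _ _ _ _ a b, ?_⟩
    simp only [Derivation.size, mul_add]
    exact add_le_add (add_le_add this ha) hb

/-- Modus ponens with an instance of a proved implication between two schemes adds only a term that
is linear in the size of the formula that replaces the relation symbol. -/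
theorem exists_proof_imp {T' : langG.Theory} {T : L.Theory} {φ ψ : langG.Sentence}
    (d : Proof T' (φ ⟹ ψ)) (hT : ∀ φ ∈ T', (tr e γ φ : L.Sentence) ∈ T)
    (d₁ : Proof T (tr e γ φ : L.Sentence)) :
    ∃ d₂ : Proof T (tr e γ ψ : L.Sentence), d₂.size ≤
      2 * (formulaSize γ * d.size) + d₁.size := by
  have h : tr e γ (ofSentence (φ ⟹ ψ)) =
      ofSentence (tr e γ φ : L.Sentence) ⟹ ofSentence (tr e γ ψ : L.Sentence) := by
    rw [tr_ofSentence]; rfl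
  have hd := d.instance_le e γ hT
  rw [h] at hd
  obtain ⟨a, ha⟩ := hd
  refine ⟨.impE _ _ _ a d₁, ?_⟩
  have := a.formulaSize_lt
  simp only [formulaSize] at this
  simp only [Derivation.size, sequentSize, List.map_nil, List.sum_nil]
  omega

end Schemes

/-! ### The schemes of the proof -/

section SchemeSyntax

variable {α : Type} {n k : ℕ} (γ : lang.Formula (Fin 4))

/-- The instance in `lang` of a scheme. -/
abbrev inst (φ : langG.BoundedFormula α n) : lang.BoundedFormula α n := tr (LHom.id lang) γ φ

/-- A formula of `lang` regarded as a scheme. -/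
abbrev const (φ : lang.BoundedFormula α n) : langG.BoundedFormula α n := embed.onBoundedFormula φ

/-- The atomic formula `G(t_0, t_1, t_2, t_3)`. -/
def graphG (ts : Fin 4 → lang.Term (α ⊕ Fin n)) : langG.BoundedFormula α n :=
  .rel (L := langG) GraphRel.graph fun i => embed.onTerm (ts i)

/-- The atomic formula `G(t, s, r, 1)`, that is `Pow(t, s, r)` if `G` is the graph of the truth
value of `Pow`. -/
def powG (t s r : lang.Term (α ⊕ Fin n)) : langG.BoundedFormula α n := graphG ![t, s, r, 1]

/-- `φ(t_0, …, t_{k-1})` for a scheme `φ`. -/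
def appG (φ : langG.Formula (Fin k)) (ts : Fin k → lang.Term (α ⊕ Fin n)) :
    langG.BoundedFormula α n :=
  gsub φ (Sum.elim (fun i => embed.onTerm (ts i)) Fin.elim0)

/-- A block of existential quantifiers in a scheme. -/
def exBlockG (φ : langG.Formula (α ⊕ Fin k)) : langG.Formula α :=
  (BoundedFormula.relabel (id : α ⊕ Fin k → α ⊕ Fin k) φ : langG.BoundedFormula α (k + 0)).exs

/-- A block of universal quantifiers in a scheme. -/
def allBlockG (φ : langG.Formula (α ⊕ Fin k)) : langG.Formula α :=
  (BoundedFormula.relabel (id : α ⊕ Fin k → α ⊕ Fin k) φ : langG.BoundedFormula α (k + 0)).alls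

theorem app_eq_gsub (φ : lang.Formula (Fin k)) (ts : Fin k → lang.Term (α ⊕ Fin n)) :
    app φ ts = gsub φ (Sum.elim ts Fin.elim0) := by
  unfold app
  rw [relabel_eq_gsub, subst_eq_gsub, gsub_gsub]
  refine gsub_congr _ ?_
  rintro (i | i)
  · have h : (fun v => Term.var (L := lang)
        (BoundedFormula.relabelAux (id : α ⊕ Fin n → α ⊕ Fin n) 0 (Sum.inl v))) =
        Term.var := by
      funext v
      rcases v with v | v
      · simp [BoundedFormula.relabelAux]
      · simp only [BoundedFormula.relabelAux, Function.comp_apply]; rfl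
    simp only [Sum.elim_inl, free, relabel_eq_subst, subst_subst, Term.subst, h, subst_var]
  · exact i.elim0

@[simp] theorem inst_const (φ : lang.BoundedFormula α n) : inst γ (const φ) = φ := tr_embed γ φ
@[simp] theorem inst_imp (φ ψ : langG.BoundedFormula α n) :
    inst γ (φ ⟹ ψ) = inst γ φ ⟹ inst γ ψ := rfl
@[simp] theorem inst_not (φ : langG.BoundedFormula α n) : inst γ (∼φ) = ∼(inst γ φ) := rfl
@[simp] theorem inst_inf (φ ψ : langG.BoundedFormula α n) :
    inst γ (φ ⊓ ψ) = inst γ φ ⊓ inst γ ψ := rfl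
@[simp] theorem inst_sup (φ ψ : langG.BoundedFormula α n) :
    inst γ (φ ⊔ ψ) = inst γ φ ⊔ inst γ ψ := rfl
@[simp] theorem inst_all (φ : langG.BoundedFormula α (n + 1)) : inst γ (∀' φ) = ∀' (inst γ φ) := rfl
@[simp] theorem inst_ex (φ : langG.BoundedFormula α (n + 1)) : inst γ (∃' φ) = ∃' (inst γ φ) := rfl

theorem inst_graphG (ts : Fin 4 → lang.Term (α ⊕ Fin n)) :
    inst γ (graphG ts) = gsub γ (Sum.elim ts Fin.elim0) := by
  refine gsub_congr _ ?_
  rintro (i | i)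
  · exact trTerm_embed _
  · exact i.elim0

@[simp] theorem inst_powG (t s r : lang.Term (α ⊕ Fin n)) (N : ℕ) :
    inst (powChar N) (powG t s r) = pow N t s r := by
  rw [powG, inst_graphG, pow, app_eq_gsub, powFormula, subst_eq_gsub, gsub_gsub]
  refine gsub_congr _ ?_
  rintro (i | i)
  · fin_cases i
    · rfl
    · rfl
    · rfl
    · have h {α β : Type} (f : α → lang.Term β) : (1 : lang.Term α).subst f = 1 := by
        change Term.func _ _ = Term.func _ _
        congr 1; funext i; exact i.elim0
      have h' {α β : Type} (f : α → β) : (1 : lang.Term α).relabel f = 1 := by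
        rw [relabel_eq_subst, h]
      simp [h, h']
  · exact i.elim0

@[simp] theorem inst_appG (φ : langG.Formula (Fin k)) (ts : Fin k → lang.Term (α ⊕ Fin n)) :
    inst γ (appG φ ts) = app (inst γ φ) ts := by
  rw [app_eq_gsub, appG]
  refine (tr_gsub _ _ _ _).trans (gsub_congr _ ?_)
  rintro (i | i)
  · exact trTerm_embed _
  · exact i.elim0

@[simp] theorem inst_exBlockG (φ : langG.Formula (α ⊕ Fin k)) :
    inst γ (exBlockG φ) = exBlock (inst γ φ) :=
  (tr_exs _ _ _).trans (congrArg _ (tr_relabel _ _ _ _))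

@[simp] theorem inst_allBlockG (φ : langG.Formula (α ⊕ Fin k)) :
    inst γ (allBlockG φ) = allBlock (inst γ φ) :=
  (tr_alls _ _ _).trans (congrArg _ (tr_relabel _ _ _ _))

/-- The least upper bound principle for a scheme. -/
def lubG {k : ℕ} (φ : langG.Formula (Fin (k + 1))) : langG.Sentence :=
  let φ_ {n : ℕ} (t : lang.Term (Fin k ⊕ Fin n)) : langG.BoundedFormula (Fin k) n :=
    appG φ (Fin.snoc (α := fun _ => lang.Term (Fin k ⊕ Fin n)) (fun i => .var (.inl i)) t)
  let body : langG.Formula (Fin k) :=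
    ((∃' (φ_ &0)) ⊓ (∃' ∀' (φ_ &1 ⟹ const (le &1 &0)))) ⟹
      ∃' ((∀' (φ_ &1 ⟹ const (le &1 &0))) ⊓
        ∀' ((∀' (φ_ &2 ⟹ const (le &2 &1))) ⟹ const (le &0 &1)))
  allBlockG (body.relabel Sum.inr)

theorem inst_lubG (φ : langG.Formula (Fin (k + 1))) :
    (inst γ (lubG φ) : lang.Sentence) = lubAxiom (inst γ φ) := by
  simp only [lubG, lubAxiom, inst_allBlockG]
  refine congrArg _ ((tr_formula_relabel _ _ _ _).trans (congrArg _ ?_))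
  simp only [inst_imp, inst_inf, inst_ex, inst_all, inst_appG, inst_const]

/-- The scheme whose instance for the `n`-th graph is `Hyp_n`. -/
def hypG : langG.BoundedFormula Empty 1 :=
  (∃' ∃' (const (lt 1 &1) ⊓ powG &1 &0 &2 ⊓ const (le &2 two))) ⊓
  (∀' ∀' ((const (lt 1 &1) ⊓ const (lt 1 &2)) ⟹ ∀' ∀' ((powG &1 &0 &3 ⊓ powG &2 &0 &4) ⟹
    (const (lt &1 &3) ⊓ (const (lt &3 &4) ⟹ const (lt &1 &2)))))) ⊓
  (∀' ∀' ((const (lt 1 &1) ⊓ const (lt 1 &2)) ⟹ (∼(const (&1 =' &2)) ⟹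
    ∃' ∃' (powG &3 &0 &4 ⊓ ((const (lt &1 &4) ⊓ const (lt &4 &2)) ⊔
      (const (lt &2 &4) ⊓ const (lt &4 &1))) ⊓ const (lt 1 &3)))))

/-- The scheme whose instance for the `n`-th graph is `Root_n`. -/
def rootG : langG.Sentence :=
  ∀' (hypG ⟹ (∼(const (lt 1 &0)) ⊔ ∃' (powG &1 &0 two)))

theorem inst_rootG (n : ℕ) : (inst (powChar n) rootG : lang.Sentence) = rootSentence n := by
  simp only [rootG, hypG, rootSentence, hypFormula, inst_imp, inst_not, inst_inf, inst_sup,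
    inst_ex, inst_all, inst_powG, inst_const]

/-- The set whose least upper bound is the root of `2`: the formula
`1 < x ∧ ∃ z, (Pow(x, y, z) ∧ z ≤ 2)`, where `y` and `x` are the variables `0` and `1`. -/
def cutG : langG.Formula (Fin 2) :=
  const (lt 1 (.var (.inl 1))) ⊓
    ∃' (powG (.var (.inl 1)) (.var (.inl 0)) &0 ⊓ const (le &0 two))

/-- `G` is the graph of the truth value of a relation `Pow` such that the domain of `Pow(·, y, ·)`
is empty or everything, and `Pow(1, y, 1)` holds in the latter case. This is the
property of bounded exponentiation that is transported from `n` to `n + 1`. -/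
def invariantG : langG.Sentence :=
  (∀' ∀' ∀' ∀' ((graphG ![&0, &1, &2, &3] ⟹ ((const (&3 =' 1) ⊓ powG &0 &1 &2) ⊔
      (const (&3 =' 0) ⊓ ∼(powG &0 &1 &2)))) ⊓
    (((const (&3 =' 1) ⊓ powG &0 &1 &2) ⊔ (const (&3 =' 0) ⊓ ∼(powG &0 &1 &2))) ⟹
      graphG ![&0, &1, &2, &3]))) ⊓
  (∀' ∀' ∀' ∀' (powG &0 &1 &2 ⟹ ∃' powG &3 &1 &4)) ⊓
  (∀' ∀' ∀' (powG &0 &1 &2 ⟹ powG 1 &1 1))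

/-- The quantifier-free part of `charStep` that does not mention the previous graph. -/
def stepCond : lang.Formula StepVars :=
  let arg (i : Fin 4) : lang.Term StepVars :=
    .var (.inl (.inl (.inl (.inl (.inl (.inl i))))))
  let b (i : Fin 7) : lang.Term StepVars := .var (.inl (.inl (.inl (.inl (.inl (.inr i))))))
  let y₂ : lang.Term StepVars := .var (.inl (.inl (.inl (.inl (.inr 0)))))
  let b' (i : Fin 7) : lang.Term StepVars := .var (.inl (.inl (.inl (.inr i))))
  let y₂' : lang.Term StepVars := .var (.inl (.inl (.inr 0)))
  let v (i : Fin 10) : lang.Term StepVars := .var (.inl (.inr i))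
  let v' (i : Fin 10) : lang.Term StepVars := .var (.inr i)
  ((arg 3).equal 1 ⟹ powMatrix (arg 1) (arg 2) b y₂ fun i => (v i).equal 1) ⊓
    ((arg 3).equal 0 ⟹ ∼(powMatrix (arg 1) (arg 2) b' y₂' fun i => (v' i).equal 1))

/-- The disjunction in `charStep` which says that `u` is a query together with its truth value. -/
def stepQueries : lang.Formula (StepVars ⊕ Fin 4) :=
  let arg (i : Fin 4) : lang.Term StepVars :=
    .var (.inl (.inl (.inl (.inl (.inl (.inl i))))))
  let b (i : Fin 7) : lang.Term StepVars := .var (.inl (.inl (.inl (.inl (.inl (.inr i))))))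
  let y₂ : lang.Term StepVars := .var (.inl (.inl (.inl (.inl (.inr 0)))))
  let b' (i : Fin 7) : lang.Term StepVars := .var (.inl (.inl (.inl (.inr i))))
  let y₂' : lang.Term StepVars := .var (.inl (.inl (.inr 0)))
  let v (i : Fin 10) : lang.Term StepVars := .var (.inl (.inr i))
  let v' (i : Fin 10) : lang.Term StepVars := .var (.inr i)
  let old (t : lang.Term StepVars) : lang.Term (StepVars ⊕ Fin 4) := t.relabel .inl
  let u (i : Fin 4) : lang.Term (StepVars ⊕ Fin 4) := .var (.inr i)
  let isQuery (q : Fin 3 → lang.Term StepVars) (s : lang.Term StepVars) :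
      lang.Formula (StepVars ⊕ Fin 4) :=
    (u 0).equal (old (q 0)) ⊓ (u 1).equal (old (q 1)) ⊓ (u 2).equal (old (q 2)) ⊓
      (u 3).equal (old s)
  ((List.finRange 10).map (fun i => isQuery (powQuery (arg 0) (arg 1) (arg 2) b y₂ i) (v i)) ++
    (List.finRange 10).map
      (fun i => isQuery (powQuery (arg 0) (arg 1) (arg 2) b' y₂' i) (v' i))).foldr (· ⊔ ·) ⊥

theorem charStep_eq (G : lang.Formula (Fin 4)) : charStep G =
    (((Term.var 3).equal 0 ⊔ (Term.var 3).equal 1) ⊓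
      exBlock (allBlock (allBlock (exBlock (exBlock (exBlock
        (stepCond ⊓ allBlock (stepQueries ⟹ G.relabel Sum.inr))))))) : lang.Formula (Fin 4)) := rfl

/-- The scheme whose instance for `γ` is `charStep γ`. -/
def stepG : langG.Formula (Fin 4) :=
  const ((Term.var 3).equal 0 ⊔ (Term.var 3).equal 1) ⊓
    exBlockG (allBlockG (allBlockG (exBlockG (exBlockG (exBlockG
      (const stepCond ⊓ allBlockG (const stepQueries ⟹
        graphG fun i => .var (.inl (.inr i)))))))))

theorem inst_stepG : inst γ stepG = charStep γ := by
  rw [charStep_eq]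
  simp only [stepG, inst_inf, inst_imp, inst_const, inst_exBlockG, inst_allBlockG, inst_graphG,
    formula_relabel_eq_gsub]

/-- `rcfMinus` as a theory in the language with the relation symbol. -/
def rcfMinusG : langG.Theory := {ψ | ∃ φ ∈ rcfMinus, ψ = const φ}

/-- `rcfMinusG` with the least upper bound principle for `cutG`. -/
def tarskiG : langG.Theory := rcfMinusG ∪ {lubG cutG}

theorem inst_mem_rcfMinus {φ : langG.Sentence} (h : φ ∈ rcfMinusG) :
    (inst γ φ : lang.Sentence) ∈ rcfMinus := by
  obtain ⟨ψ, hψ, rfl⟩ := h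
  rwa [inst_const]

theorem inst_mem_tarski {φ : langG.Sentence} (h : φ ∈ tarskiG) :
    (inst γ φ : lang.Sentence) ∈ tarski := by
  rcases h with h | h
  · exact .inl (inst_mem_rcfMinus γ h)
  · obtain rfl : φ = lubG cutG := h
    exact .inr ⟨1, inst γ cutG, inst_lubG γ cutG⟩

end SchemeSyntax

/-! ### Semantics of the schemes -/

section Tuples

variable {M : Type}

theorem snoc_one (a : M) : (Fin.snoc (default : Fin 0 → M) a : Fin 1 → M) = ![a] := by
  funext i; fin_cases i; rfl
theorem snoc_two (a b : M) : (Fin.snoc ![a] b : Fin 2 → M) = ![a, b] := by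
  funext i; fin_cases i <;> rfl
theorem snoc_three (a b c : M) : (Fin.snoc ![a, b] c : Fin 3 → M) = ![a, b, c] := by
  funext i; fin_cases i <;> rfl
theorem snoc_four (a b c d : M) : (Fin.snoc ![a, b, c] d : Fin 4 → M) = ![a, b, c, d] := by
  funext i; fin_cases i <;> rfl
theorem snoc_five (a b c d e : M) :
    (Fin.snoc ![a, b, c, d] e : Fin 5 → M) = ![a, b, c, d, e] := by
  funext i; fin_cases i <;> rfl

end Tuples

section SchemeSemantics

attribute [local instance] structureOf

variable {M : Type} [Zero M] [One M] [Add M] [Mul M] {α : Type} {n k : ℕ}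

/-- The interpretation of `langG` in which the relation symbol is interpreted by `R`. -/
abbrev structureG (R : (Fin 4 → M) → Prop) : langG.Structure M where
  funMap f xs := (structureOf M).funMap f xs
  RelMap {_} r :=
    match r with
    | .graph => R

/-- Truth of a scheme when the relation symbol is interpreted by `R`. -/
def RealizeG (R : (Fin 4 → M) → Prop) (φ : langG.BoundedFormula α n) (v : α → M)
    (xs : Fin n → M) : Prop :=
  @BoundedFormula.Realize langG M (structureG R) α n φ v xs

variable (R : (Fin 4 → M) → Prop) (v : α → M) (xs : Fin n → M)

theorem realize_onTerm (t : lang.Term α) :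
    @Term.realize langG M (structureG R) α v (embed.onTerm t) = t.realize v := by
  induction t with
  | var a => rfl
  | func F ts ih => simp only [LHom.onTerm, Term.realize, ih]; rfl

@[simp] theorem realizeG_const (φ : lang.BoundedFormula α n) :
    RealizeG R (const φ) v xs ↔ φ.Realize v xs := by
  unfold RealizeG
  induction φ with
  | falsum => exact Iff.rfl
  | equal t s => exact iff_of_eq (congrArg₂ _ (realize_onTerm R _ t) (realize_onTerm R _ s))
  | rel r ts => exact nomatch r
  | imp φ ψ ih₁ ih₂ => exact imp_congr (ih₁ _) (ih₂ _)
  | all φ ih => exact forall_congr' fun a => ih _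

@[simp] theorem realizeG_imp (φ ψ : langG.BoundedFormula α n) :
    RealizeG R (φ ⟹ ψ) v xs ↔ (RealizeG R φ v xs → RealizeG R ψ v xs) := Iff.rfl
@[simp] theorem realizeG_not (φ : langG.BoundedFormula α n) :
    RealizeG R (∼φ) v xs ↔ ¬ RealizeG R φ v xs := Iff.rfl
@[simp] theorem realizeG_inf (φ ψ : langG.BoundedFormula α n) :
    RealizeG R (φ ⊓ ψ) v xs ↔ RealizeG R φ v xs ∧ RealizeG R ψ v xs :=
  @BoundedFormula.realize_inf langG M (structureG R) α n φ ψ v xs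
@[simp] theorem realizeG_sup (φ ψ : langG.BoundedFormula α n) :
    RealizeG R (φ ⊔ ψ) v xs ↔ RealizeG R φ v xs ∨ RealizeG R ψ v xs :=
  @BoundedFormula.realize_sup langG M (structureG R) α n φ ψ v xs
@[simp] theorem realizeG_all (φ : langG.BoundedFormula α (n + 1)) :
    RealizeG R (∀' φ) v xs ↔ ∀ a : M, RealizeG R φ v (Fin.snoc xs a) := Iff.rfl
@[simp] theorem realizeG_ex (φ : langG.BoundedFormula α (n + 1)) :
    RealizeG R (∃' φ) v xs ↔ ∃ a : M, RealizeG R φ v (Fin.snoc xs a) :=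
  @BoundedFormula.realize_ex langG M (structureG R) α n φ v xs

@[simp] theorem realizeG_graphG (ts : Fin 4 → lang.Term (α ⊕ Fin n)) :
    RealizeG R (graphG ts) v xs ↔ R fun i => (ts i).realize (Sum.elim v xs) :=
  iff_of_eq (congrArg R (funext fun i => realize_onTerm R _ (ts i)))

theorem realizeG_graphG_vec (t s r q : lang.Term (α ⊕ Fin n)) :
    RealizeG R (graphG ![t, s, r, q]) v xs ↔ R ![t.realize (Sum.elim v xs),
      s.realize (Sum.elim v xs), r.realize (Sum.elim v xs), q.realize (Sum.elim v xs)] := by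
  rw [realizeG_graphG]
  refine iff_of_eq (congrArg R (funext fun i => ?_))
  fin_cases i <;> rfl

@[simp] theorem realizeG_powG (t s r : lang.Term (α ⊕ Fin n)) :
    RealizeG R (powG t s r) v xs ↔ R ![t.realize (Sum.elim v xs), s.realize (Sum.elim v xs),
      r.realize (Sum.elim v xs), 1] := by
  exact realizeG_graphG_vec R v xs t s r 1

@[simp] theorem realizeG_appG (φ : langG.Formula (Fin k)) (ts : Fin k → lang.Term (α ⊕ Fin n)) :
    RealizeG R (appG φ ts) v xs ↔
      RealizeG R φ (fun i => (ts i).realize (Sum.elim v xs)) Fin.elim0 := by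
  let _ := structureG R
  refine (realize_gsub φ _ v xs).trans (iff_of_eq (congrArg₂ _ ?_ (Subsingleton.elim _ _)))
  exact funext fun i => realize_onTerm R _ (ts i)

@[simp] theorem realizeG_exBlockG (φ : langG.Formula (α ⊕ Fin k)) (xs : Fin 0 → M) :
    RealizeG R (exBlockG φ) v xs ↔ ∃ f : Fin k → M, RealizeG R φ (Sum.elim v f) Fin.elim0 := by
  obtain rfl := Subsingleton.elim default xs
  let _ := structureG R
  refine BoundedFormula.realize_exs.trans (exists_congr fun f => ?_)
  refine (BoundedFormula.realize_relabel (n := 0)).trans ?_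
  exact iff_of_eq (congrArg₂ _ rfl (Subsingleton.elim _ _))

@[simp] theorem realizeG_allBlockG (φ : langG.Formula (α ⊕ Fin k)) (xs : Fin 0 → M) :
    RealizeG R (allBlockG φ) v xs ↔ ∀ f : Fin k → M, RealizeG R φ (Sum.elim v f) Fin.elim0 := by
  obtain rfl := Subsingleton.elim default xs
  let _ := structureG R
  refine BoundedFormula.realize_alls.trans (forall_congr' fun f => ?_)
  refine (BoundedFormula.realize_relabel (n := 0)).trans ?_
  exact iff_of_eq (congrArg₂ _ rfl (Subsingleton.elim _ _))

theorem realizeG_formula_relabel {β : Type} (φ : langG.Formula α) (g : α → β) (v : β → M)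
    (xs : Fin 0 → M) :
    RealizeG R (Formula.relabel g φ) v xs ↔ RealizeG R φ (v ∘ g) Fin.elim0 := by
  let _ := structureG R
  rw [formula_relabel_eq_gsub]
  refine (realize_gsub φ _ v xs).trans (iff_of_eq (congrArg₂ _ rfl (Subsingleton.elim _ _)))

/-- The instance of a scheme for `γ` says what the scheme says of the relation defined by `γ`. -/
theorem realize_inst (γ : lang.Formula (Fin 4)) (φ : langG.BoundedFormula α n) :
    (inst γ φ).Realize v xs ↔ RealizeG (fun a => γ.Realize a) φ v xs := by
  have h {α : Type} (t : langG.Term α) (v : α → M) : (trTerm (LHom.id lang) t).realize v =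
      @Term.realize langG M (structureG fun a => γ.Realize a) α v t := by
    induction t with
    | var a => rfl
    | func F ts ih => simp only [trTerm, Term.realize, ih]; rfl
  induction φ with
  | falsum => exact Iff.rfl
  | equal t s => exact iff_of_eq (congrArg₂ _ (h _ _) (h _ _))
  | rel r ts =>
    cases r
    refine (realize_gsub γ _ v xs).trans ?_
    exact iff_of_eq (congrArg₂ _ (funext fun i => h _ _) (Subsingleton.elim _ _))
  | imp φ ψ ih₁ ih₂ => exact imp_congr (ih₁ _) (ih₂ _)
  | all φ ih => exact forall_congr' fun a => ih _

/-- A scheme that replaces the relation symbol by a scheme `δ` says of `R` what the original scheme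
says of the relation defined by `δ`. -/
theorem realizeG_tr_embed (δ : langG.Formula (Fin 4)) (φ : langG.BoundedFormula α n) :
    RealizeG R (tr embed δ φ) v xs ↔ RealizeG (fun a => RealizeG R δ a Fin.elim0) φ v xs := by
  have h {α : Type} (t : langG.Term α) (v : α → M) :
      @Term.realize langG M (structureG R) α v (trTerm embed t) =
      @Term.realize langG M (structureG fun a => RealizeG R δ a Fin.elim0) α v t := by
    induction t with
    | var a => rfl
    | func F ts ih => simp only [trTerm, Term.realize, ih]; rfl
  induction φ with
  | falsum => exact Iff.rfl
  | equal t s => exact iff_of_eq (congrArg₂ _ (h _ _) (h _ _))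
  | rel r ts =>
    cases r
    let _ := structureG R
    refine (realize_gsub δ _ v xs).trans ?_
    exact iff_of_eq (congrArg₂ _ (funext fun i => h _ _) (Subsingleton.elim _ _))
  | imp φ ψ ih₁ ih₂ => exact imp_congr (ih₁ _) (ih₂ _)
  | all φ ih => exact forall_congr' fun a => ih _

/-- The truth of a sentence when the relation symbol is interpreted by `R`. -/
abbrev TrueG (R : (Fin 4 → M) → Prop) (φ : langG.Sentence) : Prop :=
  RealizeG R φ default default

/-- The semantic content of `invariantG`. -/
def InvariantRel (R : (Fin 4 → M) → Prop) : Prop :=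
  (∀ x y z w, R ![x, y, z, w] ↔ (w = 1 ∧ R ![x, y, z, 1]) ∨ (w = 0 ∧ ¬ R ![x, y, z, 1])) ∧
  (∀ x y z x', R ![x, y, z, 1] → ∃ z', R ![x', y, z', 1]) ∧
  (∀ x y z, R ![x, y, z, 1] → R ![1, y, 1, 1])

@[simp] theorem realize_bdEq (t s : lang.Term (α ⊕ Fin n)) :
    (t =' s).Realize v xs ↔ t.realize (Sum.elim v xs) = s.realize (Sum.elim v xs) := Iff.rfl

theorem realize_lt (t s : lang.Term (α ⊕ Fin n)) :
    (lt t s).Realize v xs ↔ leM (t.realize (Sum.elim v xs)) (s.realize (Sum.elim v xs)) ∧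
      t.realize (Sum.elim v xs) ≠ s.realize (Sum.elim v xs) := by
  rw [lt, BoundedFormula.realize_inf, realize_le]; rfl

theorem trueG_invariantG : TrueG R invariantG ↔ InvariantRel R := by
  simp only [TrueG, invariantG, InvariantRel, realizeG_all, realizeG_inf, realizeG_imp,
    realizeG_graphG_vec, realizeG_powG, realizeG_sup, realizeG_const, realizeG_not, realizeG_ex,
    realize_bdEq, snoc_one, snoc_two, snoc_three, snoc_four, snoc_five, realize_zero, realize_one,
    Function.comp_apply, Term.realize_var, Sum.elim_inr, ← iff_iff_implies_and_implies, and_assoc]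
  rfl

/-- The semantic content of `Hyp_n`, for a relation `P` in place of `Pow_n`. -/
def HypRel (P : M → M → M → Prop) (lt : M → M → Prop) (y : M) : Prop :=
  (∃ x z, lt 1 x ∧ P x y z ∧ leM z (1 + 1)) ∧
  (∀ x x₁, lt 1 x ∧ lt 1 x₁ → ∀ z z₁, P x y z ∧ P x₁ y z₁ → lt x z ∧ (lt z z₁ → lt x x₁)) ∧
  (∀ c₁ c₂, lt 1 c₁ ∧ lt 1 c₂ → c₁ ≠ c₂ →
    ∃ x₀ c₀, P x₀ y c₀ ∧ ((lt c₁ c₀ ∧ lt c₀ c₂) ∨ (lt c₂ c₀ ∧ lt c₀ c₁)) ∧ lt 1 x₀)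

/-- The strict order defined by the formula `a ≤ b ∧ a ≠ b`. -/
def ltM (a b : M) : Prop := leM a b ∧ a ≠ b

theorem trueG_rootG : TrueG R rootG ↔
    ∀ y : M, HypRel (fun x y z => R ![x, y, z, 1]) ltM y →
      ¬ ltM 1 y ∨ ∃ r, R ![r, y, 1 + 1, 1] := by
  simp only [TrueG, rootG, hypG, HypRel, ltM, realizeG_all, realizeG_inf, realizeG_imp,
    realizeG_powG, realizeG_sup, realizeG_const, realizeG_not, realizeG_ex,
    realize_bdEq, snoc_one, snoc_two, snoc_three, snoc_four, snoc_five, realize_one,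
    realize_two, realize_lt, realize_le, leM, Function.comp_apply, Term.realize_var, Sum.elim_inr,
    and_assoc]
  rfl

/-- The least upper bound principle for `{x | 1 < x ∧ x ^ y ≤ 2}`. -/
theorem trueG_lubG_cutG : TrueG R (lubG cutG) ↔ ∀ y : M,
    let S : M → Prop := fun x => ltM 1 x ∧ ∃ z, R ![x, y, z, 1] ∧ leM z (1 + 1)
    ((∃ d, S d) ∧ ∃ b, ∀ x, S x → leM x b) →
      ∃ c, (∀ x, S x → leM x c) ∧ ∀ b, (∀ x, S x → leM x b) → leM c b := by
  simp only [TrueG, lubG, cutG, ltM, realizeG_allBlockG, realizeG_formula_relabel, realizeG_all,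
    realizeG_inf, realizeG_imp, realizeG_appG, realizeG_powG, realizeG_const, realizeG_ex,
    realize_one, realize_two, realize_lt, realize_le, leM, Function.comp_apply, Term.realize_var,
    Sum.elim_inr, and_assoc]
  exact ⟨fun h y => h ![y], fun h f => h (f 0)⟩

/-- The semantic content of `charStep`. -/
theorem realizeG_stepG (a : Fin 4 → M) :
    RealizeG R stepG a Fin.elim0 ↔ (a 3 = 0 ∨ a 3 = 1) ∧
      ∃ b : Fin 7 → M, ∀ y₂ : Fin 1 → M, ∀ b' : Fin 7 → M, ∃ y₂' : Fin 1 → M,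
      ∃ v v' : Fin 10 → M,
        (a 3 = 1 → MatRel (a 1) (a 2) b (y₂ 0) (fun i => v i = 1)) ∧
        (a 3 = 0 → ¬ MatRel (a 1) (a 2) b' (y₂' 0) (fun i => v' i = 1)) ∧
        ∀ u : Fin 4 → M,
          ((∃ i, u 0 = queryVal (a 0) (a 1) (a 2) b (y₂ 0) i 0 ∧
              u 1 = queryVal (a 0) (a 1) (a 2) b (y₂ 0) i 1 ∧
              u 2 = queryVal (a 0) (a 1) (a 2) b (y₂ 0) i 2 ∧ u 3 = v i) ∨
           (∃ i, u 0 = queryVal (a 0) (a 1) (a 2) b' (y₂' 0) i 0 ∧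
              u 1 = queryVal (a 0) (a 1) (a 2) b' (y₂' 0) i 1 ∧
              u 2 = queryVal (a 0) (a 1) (a 2) b' (y₂' 0) i 2 ∧ u 3 = v' i)) → R u := by
  have h₁ (v : Fin 4 → M) (xs : Fin 0 → M) :
      BoundedFormula.Realize ((Term.var 3).equal 0 ⊔ (Term.var 3).equal 1 : lang.Formula (Fin 4))
        v xs ↔
        v 3 = 0 ∨ v 3 = 1 := by
    obtain rfl := Subsingleton.elim default xs
    refine Formula.realize_sup.trans ?_
    simp only [Formula.realize_equal, Term.realize_var, realize_zero, realize_one]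
  have h₂ (φ : lang.Formula StepVars) (v : StepVars → M) (xs : Fin 0 → M) :
      BoundedFormula.Realize φ v xs ↔ Formula.Realize φ v :=
    iff_of_eq (congrArg _ (Subsingleton.elim _ _))
  have h₃ (φ : lang.Formula (StepVars ⊕ Fin 4)) (v : StepVars ⊕ Fin 4 → M) (xs : Fin 0 → M) :
      BoundedFormula.Realize φ v xs ↔ Formula.Realize φ v :=
    iff_of_eq (congrArg _ (Subsingleton.elim _ _))
  simp only [stepG, realizeG_inf, realizeG_imp, realizeG_const, realizeG_exBlockG,
    realizeG_allBlockG, realizeG_graphG, h₁]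
  simp only [h₂, h₃, stepCond, stepQueries, Formula.realize_inf,
    Formula.realize_imp, Formula.realize_not, Formula.realize_equal, realize_powMatrix,
    formula_foldr_sup, realize_zero, realize_one, Term.realize_var,
    Sum.elim_inl, Sum.elim_inr, List.mem_append, List.mem_map, List.mem_finRange, true_and,
    or_and_right, exists_or, exists_exists_eq_and, Term.realize_relabel, realize_powQuery,
    Sum.elim_comp_inl, and_assoc]

end SchemeSemantics

/-! ### Ordered fields as models -/

section OrderedFields

attribute [local instance] structureOf

theorem exists_eq_structureOf {M : Type} (S : lang.Structure M) :
    ∃ (_ : Zero M) (_ : One M) (_ : Add M) (_ : Mul M), S = structureOf M := by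
  refine ⟨⟨S.funMap (n := 0) RcfFunc.zero ![]⟩, ⟨S.funMap (n := 0) RcfFunc.one ![]⟩,
    ⟨fun a b => S.funMap (n := 2) RcfFunc.add ![a, b]⟩,
    ⟨fun a b => S.funMap (n := 2) RcfFunc.mul ![a, b]⟩, ?_⟩
  refine Structure.ext ?_ ?_
  · funext n f xs
    cases f
    · exact congrArg _ (Subsingleton.elim _ _)
    · exact congrArg _ (Subsingleton.elim _ _)
    · exact congrArg _ (funext fun i => by fin_cases i <;> rfl)
    · exact congrArg _ (funext fun i => by fin_cases i <;> rfl)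
  · funext n r
    exact nomatch r

theorem exists_eq_structureG {M : Type} (S : langG.Structure M) :
    ∃ (_ : Zero M) (_ : One M) (_ : Add M) (_ : Mul M) (R : (Fin 4 → M) → Prop),
      S = structureG R := by
  obtain ⟨z, o, a, m, h⟩ := exists_eq_structureOf (M := M) ⟨S.funMap, fun r => nomatch r⟩
  refine ⟨z, o, a, m, S.RelMap (n := 4) GraphRel.graph, ?_⟩
  refine Structure.ext ?_ ?_
  · exact congrArg (fun S : lang.Structure M => @S.funMap) h
  · funext n r
    cases r
    rfl

/-- The operations of a model of `rcfMinus` are those of an ordered field, and `leM` is its order.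
The equations between the operations allow them to be substituted by those of the field. -/
theorem exists_orderedField {M : Type} [z : Zero M] [o : One M] [a : Add M] [m : Mul M]
    (h : M ⊨ rcfMinus) :
    ∃ (F : Field M) (_ : LinearOrder M), IsStrictOrderedRing M ∧
      (z = F.toZero ∧ o = F.toOne ∧ a = F.toAdd ∧ m = F.toMul) ∧
      ∀ a b : M, leM a b ↔ a ≤ b := by
  have hF : ∀ φ ∈ fieldAxioms, M ⊨ φ := fun φ hφ => h.realize_of_mem φ (.inl hφ)
  have hO : ∀ φ ∈ orderAxioms, M ⊨ φ := fun φ hφ => h.realize_of_mem φ (.inr hφ)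
  simp only [fieldAxioms, orderAxioms, Set.mem_insert_iff, Set.mem_singleton_iff,
    forall_eq_or_imp, forall_eq, Sentence.Realize, Formula.Realize, BoundedFormula.realize_all,
    BoundedFormula.realize_ex, BoundedFormula.realize_imp, BoundedFormula.realize_not,
    BoundedFormula.realize_inf, BoundedFormula.realize_sup, realize_bdEq, realize_le,
    snoc_one, snoc_two, snoc_three, realize_add, realize_mul, realize_zero, realize_one,
    Function.comp_apply, Term.realize_var, Sum.elim_inr] at hF hO
  obtain ⟨add_assoc', add_comm', add_zero', neg', mul_assoc', mul_comm', mul_one', inv', dist',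
    ne'⟩ := hF
  obtain ⟨refl', antisymm', trans', total', add', mul'⟩ := hO
  change ∀ a b c : M, a + b + c = a + (b + c) at add_assoc'
  change ∀ a b : M, a + b = b + a at add_comm'
  change ∀ a : M, a + 0 = a at add_zero'
  change ∀ a : M, ∃ b, a + b = 0 at neg'
  change ∀ a b c : M, a * b * c = a * (b * c) at mul_assoc'
  change ∀ a b : M, a * b = b * a at mul_comm'
  change ∀ a : M, a * 1 = a at mul_one'
  change ∀ a : M, ¬ a = 0 → ∃ b, a * b = 1 at inv'
  change ∀ a b c : M, a * (b + c) = a * b + a * c at dist'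
  change ∀ a : M, leM a a at refl'
  change ∀ a b : M, leM a b ∧ leM b a → a = b at antisymm'
  change ∀ a b c : M, leM a b ∧ leM b c → leM a c at trans'
  change ∀ a b : M, leM a b ∨ leM b a at total'
  change ∀ a b c : M, leM a b → leM (a + c) (b + c) at add'
  change ∀ a b : M, leM 0 a ∧ leM 0 b → leM 0 (a * b) at mul'
  choose neg hneg using neg'
  choose inv hinv using inv'
  classical
  let F : Field M :=
    { zero := 0, one := 1, add := (· + ·), mul := (· * ·), neg := neg
      add_assoc := add_assoc'
      zero_add := fun a => (add_comm' 0 a).trans (add_zero' a)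
      add_zero := add_zero'
      nsmul := nsmulRec
      zsmul := @zsmulRec M _ _ ⟨neg⟩ nsmulRec
      neg_add_cancel := fun a => (add_comm' _ _).trans (hneg a)
      add_comm := add_comm'
      left_distrib := dist'
      right_distrib := fun a b c => by
        rw [mul_comm' (a + b) c, dist', mul_comm' c a, mul_comm' c b]
      zero_mul := fun a => by
        have h1 : a * 0 + a * 0 = a * 0 := by rw [← dist', add_zero']
        have h2 : (a * 0 + a * 0) + neg (a * 0) = 0 := by rw [h1, hneg]
        rw [add_assoc', hneg, add_zero'] at h2
        rw [mul_comm', h2]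
      mul_zero := fun a => by
        have h1 : a * 0 + a * 0 = a * 0 := by rw [← dist', add_zero']
        have h2 : (a * 0 + a * 0) + neg (a * 0) = 0 := by rw [h1, hneg]
        rwa [add_assoc', hneg, add_zero'] at h2
      mul_assoc := mul_assoc'
      one_mul := fun a => (mul_comm' 1 a).trans (mul_one' a)
      mul_one := mul_one'
      mul_comm := mul_comm'
      exists_pair_ne := ⟨0, 1, ne'⟩
      inv := fun a => if h : a = 0 then 0 else inv a h
      mul_inv_cancel := fun a h => by
        change a * (if h : a = 0 then 0 else inv a h) = 1
        rw [dif_neg h]; exact hinv a h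
      inv_zero := dif_pos rfl
      nnqsmul := _
      nnqsmul_def := fun _ _ => rfl
      qsmul := _
      qsmul_def := fun _ _ => rfl }
  let O : LinearOrder M :=
    { le := leM
      le_refl := refl'
      le_trans := fun a b c h₁ h₂ => trans' a b c ⟨h₁, h₂⟩
      le_antisymm := fun a b h₁ h₂ => antisymm' a b ⟨h₁, h₂⟩
      le_total := total'
      toDecidableLE := Classical.decRel _ }
  refine ⟨F, O, ?_, ⟨rfl, rfl, rfl, rfl⟩, fun a b => Iff.rfl⟩
  have : IsOrderedAddMonoid M := ⟨fun a b h c => add' a b c h, fun a b h c => by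
    rw [add_comm c a, add_comm c b]; exact add' a b c h⟩
  -- `1` is a square
  have : ZeroLEOneClass M := ⟨⟨1, by
    rw [one_mul, zero_add]⟩⟩
  exact IsStrictOrderedRing.of_mul_pos fun a b ha hb => lt_of_le_of_ne
    (mul' a b ⟨ha.le, hb.le⟩) (mul_ne_zero ha.ne' hb.ne').symm

theorem countable_formula_of_functions (Rel : ℕ → Type) [∀ n, Countable (Rel n)] :
    Countable ((⟨RcfFunc, Rel⟩ : Language).Formula ℕ) := by
  have h (n : ℕ) : Countable (RcfFunc n) := by
    refine Function.Injective.countable (f := fun f : RcfFunc n => match f with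
      | .zero => 0 | .one => 1 | .add => 2 | .mul => (3 : ℕ)) ?_
    intro a b hab
    cases a <;> cases b <;> simp_all
  have : Countable (⟨RcfFunc, Rel⟩ : Language).Symbols := by
    have h₁ : Countable (Σ n, RcfFunc n) := inferInstance
    have h₂ : Countable (Σ n, Rel n) := inferInstance
    exact inferInstanceAs (Countable ((Σ n, RcfFunc n) ⊕ (Σ n, Rel n)))
  infer_instance

instance : Countable (lang.Formula ℕ) := countable_formula_of_functions fun _ => Empty

instance : Countable (langG.Formula ℕ) := by
  have h (n : ℕ) : Countable (GraphRel n) := by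
    refine Function.Injective.countable (f := fun _ => 0) ?_
    intro a b _
    cases a; cases b; rfl
  exact countable_formula_of_functions GraphRel

/-- Completeness for extensions of the theory of ordered fields. -/
theorem exists_proof_of_orderedField {T : lang.Theory} (hT : rcfMinus ⊆ T) (φ : lang.Sentence)
    (h : ∀ (M : Type) [Field M] [LinearOrder M] [IsStrictOrderedRing M],
      (∀ a b : M, leM a b ↔ a ≤ b) → M ⊨ T → M ⊨ φ) : Nonempty (Proof T φ) := by
  refine completeness φ fun M S _ hM => ?_
  obtain ⟨z, o, a, m, rfl⟩ := exists_eq_structureOf S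
  obtain ⟨F, O, hO, ⟨rfl, rfl, rfl, rfl⟩, hle⟩ := exists_orderedField (hM.mono hT)
  exact h M hle hM

/-- Completeness for schemes over the theory of ordered fields. -/
theorem exists_proof_of_orderedFieldG {T : langG.Theory} (hT : rcfMinusG ⊆ T) (φ : langG.Sentence)
    (h : ∀ (M : Type) [Field M] [LinearOrder M] [IsStrictOrderedRing M] (R : (Fin 4 → M) → Prop),
      (∀ a b : M, leM a b ↔ a ≤ b) → (∀ ψ ∈ T, TrueG R ψ) → TrueG R φ) :
    Nonempty (Proof T φ) := by
  refine completeness φ fun M S _ hM => ?_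
  obtain ⟨z, o, a, m, R, rfl⟩ := exists_eq_structureG S
  have hR : ∀ ψ ∈ T, TrueG R ψ := fun ψ hψ =>
    @Theory.Model.realize_of_mem langG M (structureG R) T hM ψ hψ
  have hM' : M ⊨ rcfMinus := ⟨fun {ψ} hψ =>
    (realizeG_const R default default ψ).1 (hR _ (hT ⟨ψ, hψ, rfl⟩))⟩
  obtain ⟨F, O, hO, ⟨rfl, rfl, rfl, rfl⟩, hle⟩ := exists_orderedField hM'
  exact h M R hle hR

end OrderedFields

/-! ### The invariant of bounded exponentiation -/

section Invariant

attribute [local instance] structureOf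

section GraphSemantics

variable {M : Type} [Zero M] [One M] [Add M] [Mul M]

/-- If `R` is the graph of the truth value of `P`, then `stepG` defines the graph of the truth value
of `PowStep P`. -/
theorem realizeG_stepG_iff (h01 : (0 : M) ≠ 1) {R : (Fin 4 → M) → Prop} {P : M → M → M → Prop}
    (hR : ∀ a, R a ↔ (a 3 = 1 ∧ P (a 0) (a 1) (a 2)) ∨ (a 3 = 0 ∧ ¬ P (a 0) (a 1) (a 2)))
    (a : Fin 4 → M) : RealizeG R stepG a Fin.elim0 ↔
      (a 3 = 1 ∧ PowStep P (a 0) (a 1) (a 2)) ∨ (a 3 = 0 ∧ ¬ PowStep P (a 0) (a 1) (a 2)) := by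
  classical
  rw [realizeG_stepG]
  let q (b : Fin 7 → M) (y₂ : M) := queryVal (a 0) (a 1) (a 2) b y₂
  -- if the queries with the answers `v` lie in `R`, then `v` consists of the truth values of `P`
  have key (b : Fin 7 → M) (y₂ : M) (v : Fin 10 → M)
      (hv : ∀ u : Fin 4 → M, (∃ i, u 0 = q b y₂ i 0 ∧ u 1 = q b y₂ i 1 ∧ u 2 = q b y₂ i 2 ∧
        u 3 = v i) → R u) :
      (fun i => v i = 1) = fun i => P (q b y₂ i 0) (q b y₂ i 1) (q b y₂ i 2) := by
    funext i
    rcases (hR _).1 (hv ![q b y₂ i 0, q b y₂ i 1, q b y₂ i 2, v i] ⟨i, rfl, rfl, rfl, rfl⟩)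
      with h | h
    · exact propext ⟨fun _ => h.2, fun _ => h.1⟩
    · have h3 : v i = 0 := h.1
      exact propext ⟨fun h' => absurd (h3.symm.trans h') h01, fun h' => absurd h' h.2⟩
  have ex (b : Fin 7 → M) (y₂ : M) : ∃ v : Fin 10 → M,
      ∀ u : Fin 4 → M, (∃ i, u 0 = q b y₂ i 0 ∧ u 1 = q b y₂ i 1 ∧ u 2 = q b y₂ i 2 ∧
        u 3 = v i) → R u := by
    refine ⟨fun i => if P (q b y₂ i 0) (q b y₂ i 1) (q b y₂ i 2) then 1 else 0, ?_⟩
    rintro u ⟨i, h0, h1, h2, h3⟩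
    rw [hR, h0, h1, h2, h3]
    by_cases h : P (q b y₂ i 0) (q b y₂ i 1) (q b y₂ i 2) <;> simp [h]
  constructor
  · rintro ⟨hw, b, hb⟩
    rcases hw with hw | hw
    · refine .inr ⟨hw, fun hS => ?_⟩
      obtain ⟨b', hb'⟩ := (powStep_iff P _ _ _).1 hS
      obtain ⟨y₂', v, v', -, h, hu⟩ := hb (fun _ => 0) b'
      apply h hw
      rw [key b' (y₂' 0) v' fun u hu' => hu u (.inr hu')]
      exact hb' _
    · refine .inl ⟨hw, (powStep_iff P _ _ _).2 ⟨b, fun y₂ => ?_⟩⟩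
      obtain ⟨y₂', v, v', h, -, hu⟩ := hb (fun _ => y₂) (fun _ => 0)
      have := h hw
      rwa [key b y₂ v fun u hu' => hu u (.inl hu')] at this
  · rintro (⟨hw, hS⟩ | ⟨hw, hS⟩)
    · obtain ⟨b, hb⟩ := (powStep_iff P _ _ _).1 hS
      refine ⟨.inr hw, b, fun y₂ b' => ⟨fun _ => 0, ?_⟩⟩
      obtain ⟨v, hv⟩ := ex b (y₂ 0)
      obtain ⟨v', hv'⟩ := ex b' 0
      refine ⟨v, v', fun _ => ?_, fun h => absurd (h.symm.trans hw) h01,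
        fun u hu => hu.elim (hv u) (hv' u)⟩
      rw [key b (y₂ 0) v hv]
      exact hb _
    · refine ⟨.inl hw, fun _ => 0, fun y₂ b' => ?_⟩
      obtain ⟨y₂', hy⟩ : ∃ y₂', ¬ MatRel (a 1) (a 2) b' y₂' fun i =>
          P (q b' y₂' i 0) (q b' y₂' i 1) (q b' y₂' i 2) := by
        by_contra hcon
        push Not at hcon
        exact hS ((powStep_iff P _ _ _).2 ⟨b', hcon⟩)
      obtain ⟨v, hv⟩ := ex (fun _ => 0) (y₂ 0)
      obtain ⟨v', hv'⟩ := ex b' y₂'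
      refine ⟨fun _ => y₂', v, v', fun h => absurd (hw.symm.trans h) h01, fun _ => ?_,
        fun u hu => hu.elim (hv u) (hv' u)⟩
      rw [key b' y₂' v' hv']
      exact hy

omit [Add M] [Mul M] in
theorem InvariantRel.of_graph (h01 : (0 : M) ≠ 1) {R : (Fin 4 → M) → Prop} {P : M → M → M → Prop}
    (hR : ∀ a, R a ↔ (a 3 = 1 ∧ P (a 0) (a 1) (a 2)) ∨ (a 3 = 0 ∧ ¬ P (a 0) (a 1) (a 2)))
    (h₁ : ∀ x y z x', P x y z → ∃ z', P x' y z') (h₂ : ∀ x y z, P x y z → P 1 y 1) :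
    InvariantRel R := by
  have h (x y z : M) : R ![x, y, z, 1] ↔ P x y z := by
    rw [hR]; simp [h01.symm]
  refine ⟨fun x y z w => ?_, ?_, ?_⟩
  · simp only [h, hR]; rfl
  · simpa only [h] using h₁
  · simpa only [h] using h₂

/-- The invariant passes from `Pow_n` to `Pow_{n+1}`. Both cases of the recursion step have to be
considered, but no arithmetic is needed besides `1 * 1 = 1`. -/
theorem InvariantRel.step (h01 : (0 : M) ≠ 1) (h11 : (1 : M) * 1 = 1) {R : (Fin 4 → M) → Prop}
    (h : InvariantRel R) : InvariantRel fun a => RealizeG R stepG a Fin.elim0 := by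
  obtain ⟨hR, hdom, hone⟩ := h
  refine InvariantRel.of_graph h01 (P := PowStep fun x y z => R ![x, y, z, 1])
    (realizeG_stepG_iff h01 fun a => ?_) ?_ ?_
  · rw [← hR]
    exact iff_of_eq (congrArg R (funext fun i => by fin_cases i <;> rfl))
  · rintro x y z x' ⟨hb, hD, hN⟩
    by_cases hy : R ![1, y, 1, 1]
    · obtain ⟨z', hz'⟩ := hdom _ _ _ x' hy
      exact ⟨z', hb, fun _ => hz', fun h => absurd hy h⟩
    · obtain ⟨y₃, y₄, y₅, -, -, -, d₃, d₄, d₅, e, -⟩ := hN hy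
      obtain ⟨z₂, h₂⟩ := hdom _ _ _ x' d₃
      obtain ⟨z₃, h₃⟩ := hdom _ _ _ z₂ d₄
      obtain ⟨z₄, h₄⟩ := hdom _ _ _ x' d₅
      exact ⟨z₃ * z₄, hb, fun h => absurd h hy, fun _ =>
        ⟨y₃, y₄, y₅, z₂, z₃, z₄, d₃, d₄, d₅, e, h₂, h₃, h₄, rfl⟩⟩
  · rintro x y z ⟨hb, hD, hN⟩
    refine ⟨hb, id, fun hy => ?_⟩
    obtain ⟨y₃, y₄, y₅, -, -, -, d₃, d₄, d₅, e, -⟩ := hN hy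
    exact ⟨y₃, y₄, y₅, 1, 1, 1, d₃, d₄, d₅, e, d₃, d₄, d₅, h11.symm⟩

end GraphSemantics

variable {M : Type} [Field M] [LinearOrder M] [IsStrictOrderedRing M]

theorem invariantRel_zero : InvariantRel fun a : Fin 4 → M => (powChar 0).Realize a := by
  have h01 : (0 : M) ≠ 1 := zero_ne_one
  have h02 : (1 + 1 : M) ≠ 0 := by norm_num
  have h12 : (1 + 1 : M) ≠ 1 := by norm_num
  refine InvariantRel.of_graph h01 (isChar_powChar h01 0) ?_ ?_
  · intro x y z x' h
    simp only [powRel_zero h01] at h ⊢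
    by_cases h0 : y = 0
    · exact ⟨1, by simp [h0, h02.symm]⟩
    by_cases h1 : y = 1
    · exact ⟨x', by simp [h1, h12.symm]⟩
    by_cases h2 : y = 1 + 1
    · exact ⟨x' * x', by simp [h2, h02]⟩
    · exact absurd ⟨h0, h1, h2⟩ h.2.2.2
  · intro x y z h
    simp only [powRel_zero h01] at h ⊢
    exact ⟨by simp, by simp, fun _ => (mul_one 1).symm, h.2.2.2⟩

omit [IsStrictOrderedRing M] in
theorem ltM_iff (hle : ∀ a b : M, leM a b ↔ a ≤ b) (a b : M) : ltM a b ↔ a < b := by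
  rw [ltM, hle, lt_iff_le_and_ne]

/-- The least upper bound of `{x | 1 < x ∧ x ^ y ≤ 2}` is a root. -/
theorem trueG_rootG_of_lub (hle : ∀ a b : M, leM a b ↔ a ≤ b) {R : (Fin 4 → M) → Prop}
    (hlub : TrueG R (lubG cutG)) (hinv : InvariantRel R) : TrueG R rootG := by
  rw [trueG_lubG_cutG] at hlub
  rw [trueG_rootG]
  intro y hyp
  specialize hlub y
  obtain ⟨-, hdom, -⟩ := hinv
  simp only [HypRel, ltM_iff hle, hle] at hlub hyp ⊢
  obtain ⟨⟨x, z, hx, hxz, hz⟩, hmono, hdense⟩ := hyp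
  have self (x z : M) (hx : 1 < x) (h : R ![x, y, z, 1]) : x < z := (hmono x x ⟨hx, hx⟩ z z ⟨h, h⟩).1
  obtain ⟨c, hc, hc'⟩ := hlub ⟨⟨x, hx, z, hxz, hz⟩, 1 + 1,
    fun x ⟨hx, z, h, hz⟩ => (self x z hx h).le.trans hz⟩
  have hc1 : 1 < c := hx.trans_le (hc x ⟨hx, z, hxz, hz⟩)
  obtain ⟨w, hw⟩ := hdom x y z c hxz
  have hw1 : 1 < w := hc1.trans (self c w hc1 hw)
  have h12 : (1 : M) < 1 + 1 := by norm_num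
  refine .inr ⟨c, ?_⟩
  -- a power strictly between `w` and `2` would contradict that `c` is the least upper bound
  rcases lt_trichotomy w (1 + 1) with h | h | h
  · obtain ⟨x₀, c₀, h₀, hb, hx₀⟩ := hdense w (1 + 1) ⟨hw1, h12⟩ h.ne
    have hb : w < c₀ ∧ c₀ < 1 + 1 := hb.resolve_right fun h' => (h'.1.trans h'.2).not_gt h
    exact absurd (hc x₀ ⟨hx₀, c₀, h₀, hb.2.le⟩)
      ((hmono c x₀ ⟨hc1, hx₀⟩ w c₀ ⟨hw, h₀⟩).2 hb.1).not_ge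
  · rwa [h] at hw
  · obtain ⟨x₀, c₀, h₀, hb, hx₀⟩ := hdense (1 + 1) w ⟨h12, hw1⟩ h.ne
    have hb : 1 + 1 < c₀ ∧ c₀ < w := hb.resolve_right fun h' => (h'.1.trans h'.2).not_gt h
    have hx₀c : x₀ < c := (hmono x₀ c ⟨hx₀, hc1⟩ c₀ w ⟨h₀, hw⟩).2 hb.2
    exact absurd (hc' x₀ fun s ⟨hs, t, hst, ht⟩ =>
      ((hmono s x₀ ⟨hs, hx₀⟩ t c₀ ⟨hst, h₀⟩).2 (ht.trans_lt hb.1)).le) hx₀c.not_ge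

end Invariant

/-! ### Short proofs from the least upper bound principle -/

section TarskiProofs

attribute [local instance] structureOf

theorem exists_proof_invariant_zero :
    Nonempty (Proof tarski (inst (powChar 0) invariantG : lang.Sentence)) := by
  refine exists_proof_of_orderedField Set.subset_union_left _ fun M _ _ _ _ _ => ?_
  exact (realize_inst _ _ _ _).2 (trueG_invariantG _ |>.2 invariantRel_zero)

theorem exists_proof_invariant_step :
    Nonempty (Proof rcfMinusG (invariantG ⟹ (tr embed stepG invariantG : langG.Sentence))) := by
  refine exists_proof_of_orderedFieldG subset_rfl _ fun M _ _ _ R _ _ => ?_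
  intro h
  refine (realizeG_tr_embed R _ _ stepG invariantG).2 ((trueG_invariantG _).2 ?_)
  exact ((trueG_invariantG R).1 h).step zero_ne_one (mul_one 1)

theorem exists_proof_root :
    Nonempty (Proof tarskiG (invariantG ⟹ rootG)) := by
  refine exists_proof_of_orderedFieldG Set.subset_union_left _ fun M _ _ _ R hle hT => ?_
  intro h
  exact trueG_rootG_of_lub hle (hT _ (.inr rfl)) ((trueG_invariantG R).1 h)

section Sizes

variable {L : FirstOrder.Language.{0, 0}} {α β : Type} {n k : ℕ}

theorem formulaSize_gsub_var (φ : L.BoundedFormula α n) {m : ℕ} (f : α ⊕ Fin n → β ⊕ Fin m) :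
    formulaSize (gsub φ fun v => Term.var (f v)) = formulaSize φ :=
  le_antisymm ((formulaSize_gsub_le φ _ le_rfl fun _ => le_rfl).trans (mul_one _).le)
    (le_formulaSize_gsub _ _)

theorem formulaSize_relabel (φ : L.BoundedFormula α k) (g : α → β ⊕ Fin n) :
    formulaSize (φ.relabel g) = formulaSize φ := by
  rw [relabel_eq_gsub, formulaSize_gsub_var]

theorem formulaSize_formula_relabel (φ : L.Formula α) (g : α → β) :
    formulaSize (Formula.relabel g φ) = formulaSize φ :=
  formulaSize_relabel (n := 0) φ (Sum.inl ∘ g)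

theorem formulaSize_imp (φ ψ : L.BoundedFormula α n) :
    formulaSize (φ ⟹ ψ) = 1 + formulaSize φ + formulaSize ψ := rfl
theorem formulaSize_not (φ : L.BoundedFormula α n) : formulaSize (∼φ) = formulaSize φ + 2 := by
  change 1 + formulaSize φ + 1 = _; omega
theorem formulaSize_inf (φ ψ : L.BoundedFormula α n) :
    formulaSize (φ ⊓ ψ) = formulaSize φ + formulaSize ψ + 5 := by
  change formulaSize (∼(φ ⟹ ∼ψ)) = _
  simp only [formulaSize_not, formulaSize_imp]; omega
theorem formulaSize_sup (φ ψ : L.BoundedFormula α n) :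
    formulaSize (φ ⊔ ψ) = formulaSize φ + formulaSize ψ + 3 := by
  change formulaSize (∼φ ⟹ ψ) = _
  simp only [formulaSize_not, formulaSize_imp]; omega
theorem formulaSize_all (φ : L.BoundedFormula α (n + 1)) :
    formulaSize (∀' φ) = formulaSize φ + 1 := by
  change 1 + formulaSize φ = _; omega
theorem formulaSize_ex (φ : L.BoundedFormula α (n + 1)) :
    formulaSize (∃' φ) = formulaSize φ + 5 := by
  change formulaSize (∼(∀' ∼φ)) = _
  simp only [formulaSize_not, formulaSize_all]

theorem formulaSize_alls (φ : L.BoundedFormula α n) :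
    formulaSize φ.alls = formulaSize φ + n := by
  induction n with
  | zero => rfl
  | succ n ih => rw [BoundedFormula.alls, ih, formulaSize_all]; omega

theorem formulaSize_exs (φ : L.BoundedFormula α n) :
    formulaSize φ.exs = formulaSize φ + 5 * n := by
  induction n with
  | zero => rfl
  | succ n ih => rw [BoundedFormula.exs, ih, formulaSize_ex]; omega

theorem formulaSize_exBlock (φ : lang.Formula (α ⊕ Fin k)) :
    formulaSize (exBlock φ) = formulaSize φ + 5 * k :=
  (formulaSize_exs _).trans (by rw [formulaSize_relabel]; rfl)

theorem formulaSize_allBlock (φ : lang.Formula (α ⊕ Fin k)) :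
    formulaSize (allBlock φ) = formulaSize φ + k :=
  (formulaSize_alls _).trans (by rw [formulaSize_relabel]; rfl)

/-- The previous formula occurs only once in `charStep`, and therefore the size grows by a
constant. -/
theorem exists_formulaSize_charStep :
    ∃ c, 1 ≤ c ∧ ∀ γ : lang.Formula (Fin 4), formulaSize (charStep γ) = formulaSize γ + c := by
  -- the blocks of `7`, `1`, `7`, `1`, `10`, `10` and `4` quantifiers contribute `152` symbols, and
  -- the two conjunctions and the implication around them `11`
  let c : ℕ := formulaSize ((Term.var 3).equal 0 ⊔ (Term.var 3).equal 1 : lang.Formula (Fin 4)) +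
    formulaSize stepCond + formulaSize stepQueries + 163
  refine ⟨c, by omega, fun γ => ?_⟩
  simp only [charStep_eq, formulaSize_inf (φ := _ ⊔ _), formulaSize_inf (φ := stepCond),
    formulaSize_exBlock, formulaSize_allBlock,
    formulaSize_imp (φ := stepQueries), formulaSize_formula_relabel]
  omega

theorem exists_formulaSize_powChar : ∃ A c, 1 ≤ c ∧ ∀ n, formulaSize (powChar n) = A + c * n := by
  obtain ⟨c, hc, h⟩ := exists_formulaSize_charStep
  refine ⟨formulaSize (powChar 0), c, hc, fun n => ?_⟩
  induction n with
  | zero => simp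
  | succ n ih =>
    have : formulaSize (powChar (n + 1)) = formulaSize (powChar n) + c := h _
    rw [this, ih]; ring

theorem le_formulaSize_rootSentence (n : ℕ) : n ≤ formulaSize (rootSentence n) := by
  obtain ⟨A, c, hc, h⟩ := exists_formulaSize_powChar
  have h₁ : formulaSize (powChar n) ≤
      formulaSize (pow n &1 &0 two : lang.BoundedFormula Empty 2) := by
    rw [pow, app_eq_gsub, powFormula, subst_eq_gsub, gsub_gsub]
    exact le_formulaSize_gsub _ _
  have h₂ : n ≤ c * n := Nat.le_mul_of_pos_left n hc
  simp only [rootSentence, formulaSize_all, formulaSize_imp, formulaSize_sup, formulaSize_ex]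
  rw [h] at h₁
  omega

end Sizes

/-- The proof for `powChar n` consists of one proof for `powChar 0` and `n` instances of the proof of
the induction step. -/
theorem exists_proof_invariant {A c : ℕ} (h : ∀ n, formulaSize (powChar n) = A + c * n) :
    ∃ B s : ℕ, ∀ n, ∃ d : Proof tarski (inst (powChar n) invariantG : lang.Sentence),
      d.size ≤ B + 2 * ((A + c * n) * s) * n := by
  obtain ⟨d₀⟩ := exists_proof_invariant_zero
  obtain ⟨d₁⟩ := exists_proof_invariant_step
  refine ⟨d₀.size, d₁.size, fun n => ?_⟩
  induction n with
  | zero => exact ⟨d₀, by simp⟩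
  | succ n ih =>
    obtain ⟨d, hd⟩ := ih
    have key := exists_proof_imp (LHom.id lang) (powChar n) d₁
      (fun φ hφ => .inl (inst_mem_rcfMinus (powChar n) hφ)) d
    have e : tr (LHom.id lang) (powChar n) (tr embed stepG invariantG) =
        inst (powChar (n + 1)) invariantG := by
      rw [tr_tr]; exact congrArg (fun γ => inst γ invariantG) (inst_stepG (powChar n))
    rw [e, h] at key
    obtain ⟨d', hd'⟩ := key
    refine ⟨d', hd'.trans ?_⟩
    have : (A + c * n) * d₁.size ≤ (A + c * (n + 1)) * d₁.size := by gcongr; omega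
    nlinarith

/-- The polynomial upper bounds on the size of `Root_n` and of its proof from the least upper bound
principle. -/
theorem exists_polynomial_proof : ∃ p : Polynomial ℕ, ∀ n : ℕ,
    formulaSize (rootSentence n) ≤ p.eval n ∧
      ∃ d : Proof tarski (rootSentence n), d.size ≤ p.eval n := by
  obtain ⟨A, c, -, h⟩ := exists_formulaSize_powChar
  obtain ⟨B, s, hB⟩ := exists_proof_invariant h
  obtain ⟨d₁⟩ := exists_proof_root
  let p : Polynomial ℕ := 2 * ((.C A + .C c * .X) * .C d₁.size) +
    (.C B + 2 * ((.C A + .C c * .X) * .C s) * .X)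
  have hp (n : ℕ) : p.eval n = 2 * ((A + c * n) * d₁.size) + (B + 2 * ((A + c * n) * s) * n) := by
    simp [p]
  have main (n : ℕ) : ∃ d : Proof tarski (rootSentence n), d.size ≤ p.eval n := by
    obtain ⟨d, hd⟩ := hB n
    have key := exists_proof_imp (LHom.id lang) (powChar n) d₁
      (fun φ hφ => inst_mem_tarski (powChar n) hφ) d
    rw [show tr (LHom.id lang) (powChar n) rootG = rootSentence n from inst_rootG n, h] at key
    obtain ⟨d', hd'⟩ := key
    exact ⟨d', by rw [hp]; omega⟩
  refine ⟨p, fun n => ⟨?_, main n⟩⟩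
  obtain ⟨d, hd⟩ := main n
  have := d.formulaSize_lt
  rw [formulaSize_ofSentence] at this
  omega

end TarskiProofs

/-! ### Proofs from the axioms of real closed fields -/

section RealClosed

attribute [local instance] structureOf

variable {M : Type}

theorem realize_rootSentence [Zero M] [One M] [Add M] [Mul M] (n : ℕ) : M ⊨ rootSentence n ↔
    ∀ y : M, HypRel (PowRel M n) ltM y → ¬ ltM 1 y ∨ ∃ r, PowRel M n r y (1 + 1) := by
  rw [← inst_rootG]
  refine (realize_inst _ _ _ _).trans ((trueG_rootG _).trans ?_)
  simp only [← powRel_iff_char]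

variable [Field M]

theorem realize_powTerm {α : Type} (t : lang.Term α) (v : α → M) (i : ℕ) :
    (powTerm t i).realize v = t.realize v ^ i := by
  induction i using powTerm.induct with
  | case1 => simp [powTerm]
  | case2 => simp [powTerm]
  | case3 i ih => rw [powTerm, realize_mul, ih, ← pow_succ]

theorem realize_monomialTerm {α : Type} (a t : lang.Term α) (v : α → M) (i : ℕ) :
    (monomialTerm a t i).realize v = a.realize v * t.realize v ^ i := by
  cases i with
  | zero => simp [monomialTerm]
  | succ i => simp [monomialTerm, realize_powTerm]

theorem realize_foldl_add {α : Type} (l : List (lang.Term α)) (t : lang.Term α) (v : α → M) :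
    (l.foldl (· + ·) t).realize v = t.realize v + (l.map fun s => s.realize v).sum := by
  induction l generalizing t with
  | nil => simp
  | cons s l ih => simp [ih, add_assoc]

theorem realize_rootAxiom (d : ℕ) :
    M ⊨ rootAxiom d ↔ ∀ a : Fin d → M, ∃ x : M, x ^ d + ∑ i, a i * x ^ (i : ℕ) = 0 := by
  refine BoundedFormula.realize_alls.trans (forall_congr' fun a => ?_)
  refine BoundedFormula.realize_ex.trans (exists_congr fun x => ?_)
  rw [realize_bdEq, monicPoly, realize_foldl_add, realize_powTerm, List.map_map,
    List.map_reverse, List.sum_reverse, ← Fin.sum_univ_def]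
  simp [realize_monomialTerm]

variable [LinearOrder M] [IsStrictOrderedRing M]

/-- In an ordered field, `Pow_n(x, y, z)` says that `y` is a natural number, `y ≤ 2 ^ (2 ^ n)` and
`x ^ y = z`. -/
theorem powRel_iff (hle : ∀ a b : M, leM a b ↔ a ≤ b) (n : ℕ) (x y z : M) :
    PowRel M n x y z ↔ ∃ k : ℕ, k ≤ 2 ^ 2 ^ n ∧ y = k ∧ x ^ k = z := by
  have h01 : (0 : M) ≠ 1 := zero_ne_one
  induction n generalizing x y z with
  | zero =>
    rw [powRel_zero h01]
    have h02 : (1 + 1 : M) ≠ 0 := by norm_num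
    have h12 : (1 + 1 : M) ≠ 1 := by norm_num
    constructor
    · rintro ⟨h0, h1, h2, h⟩
      by_cases e0 : y = 0
      · exact ⟨0, by norm_num, by simpa using e0, by simp [h0 e0]⟩
      by_cases e1 : y = 1
      · exact ⟨1, by norm_num, by simpa using e1, by simp [h1 e1]⟩
      by_cases e2 : y = 1 + 1
      · exact ⟨2, by norm_num, by rw [e2]; norm_num, by rw [h2 e2]; ring⟩
      · exact absurd ⟨e0, e1, e2⟩ h
    · rintro ⟨k, hk, rfl, rfl⟩
      have hk : k ≤ 2 := by simpa using hk
      interval_cases k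
      · simp [h02.symm]
      · simp [h12.symm]
      · have e : ((2 : ℕ) : M) = 1 + 1 := by norm_num
        rw [e]
        simp [h02, pow_two]
  | succ n ih =>
    rw [powRel_succ h01]
    have hN : 2 ^ 2 ^ (n + 1) = 2 ^ 2 ^ n * 2 ^ 2 ^ n := by
      rw [← pow_add, ← two_mul, ← pow_succ']
    have hpos : 0 < 2 ^ 2 ^ n := by positivity
    generalize 2 ^ 2 ^ n = N at ih hN hpos
    have hD (y : M) : PowRel M n 1 y 1 ↔ ∃ k : ℕ, k ≤ N ∧ y = k := by
      simp [ih 1 y 1]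
    simp only [PowStep, hD, hle, hN]
    constructor
    · rintro ⟨⟨_, ⟨k₁, hk₁, rfl⟩, -, hy⟩, hpow, hrec⟩
      by_cases hy' : ∃ k : ℕ, k ≤ N ∧ y = k
      · obtain ⟨k, hk, e⟩ := (ih _ _ _).1 (hpow hy')
        exact ⟨k, hk.trans (Nat.le_mul_self N), e⟩
      · obtain ⟨y₃, y₄, y₅, z₂, z₃, z₄, -, -, -, e, h₂, h₃, h₄, hz⟩ := hrec hy'
        obtain ⟨k₃, -, rfl, rfl⟩ := (ih _ _ _).1 h₂
        obtain ⟨k₄, -, rfl, rfl⟩ := (ih _ _ _).1 h₃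
        obtain ⟨k₅, -, rfl, rfl⟩ := (ih _ _ _).1 h₄
        refine ⟨k₃ * k₄ + k₅, ?_, by rw [e]; push_cast; ring, by rw [hz, pow_add, pow_mul]⟩
        have h : ((k₃ * k₄ + k₅ : ℕ) : M) ≤ ((N * N : ℕ) : M) := by
          push_cast
          rw [← e]
          have : (k₁ : M) ≤ N := by exact_mod_cast hk₁
          exact hy.trans (mul_le_mul this this (Nat.cast_nonneg _) (Nat.cast_nonneg _))
        exact_mod_cast h
    · rintro ⟨k, hk, rfl, rfl⟩
      refine ⟨⟨N, ⟨N, le_rfl, rfl⟩, ?_, by exact_mod_cast hk⟩, ?_, fun hk' => ?_⟩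
      · rintro _ ⟨j, hj, rfl⟩
        exact_mod_cast hj
      · rintro ⟨j, hj, e⟩
        obtain rfl : k = j := by exact_mod_cast e
        exact (ih _ _ _).2 ⟨k, hj, rfl, rfl⟩
      · -- division of `k` by `N` with remainder
        have h₃ : k / N ≤ N := by
          rw [Nat.div_le_iff_le_mul hpos]; omega
        have h₅ : k % N ≤ N := (Nat.mod_lt k hpos).le
        have e : k = k / N * N + k % N := (Nat.div_add_mod' k N).symm
        refine ⟨(k / N : ℕ), (N : ℕ), (k % N : ℕ), x ^ (k / N), (x ^ (k / N)) ^ N, x ^ (k % N),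
          ⟨_, h₃, rfl⟩, ⟨_, le_rfl, rfl⟩, ⟨_, h₅, rfl⟩, by exact_mod_cast e,
          (ih _ _ _).2 ⟨_, h₃, rfl, rfl⟩, (ih _ _ _).2 ⟨_, le_rfl, rfl, rfl⟩,
          (ih _ _ _).2 ⟨_, h₅, rfl, rfl⟩, ?_⟩
        rw [← pow_mul, ← pow_add, ← e]

/-- Roots of even order are reduced to roots of smaller order by taking square roots. -/
theorem exists_root_of_rcf (hsqrt : ∀ a : M, 0 ≤ a → ∃ x, x * x = a)
    (hodd : ∀ d, Odd d → M ⊨ rootAxiom d) (k : ℕ) (hk : 1 ≤ k) (a : M) (ha : 0 ≤ a) :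
    ∃ r : M, 0 ≤ r ∧ r ^ k = a := by
  induction k using Nat.strong_induction_on generalizing a with
  | _ k ih =>
    rcases Nat.even_or_odd k with h | h
    · obtain ⟨j, rfl⟩ := h
      obtain ⟨s, hs⟩ := hsqrt a ha
      obtain ⟨r, hr, hrs⟩ := ih j (by omega) (by omega) |s| (abs_nonneg s)
      exact ⟨r, hr, by rw [pow_add, hrs, abs_mul_abs_self, hs]⟩
    · obtain ⟨x, hx⟩ := (realize_rootAxiom k).1 (hodd k h) fun i => if i.1 = 0 then -a else 0
      have e : x ^ k = a := by
        rw [Finset.sum_eq_single (⟨0, hk⟩ : Fin k)] at hx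
        · simp at hx; linear_combination hx
        · intro i _ hi
          have : i.1 ≠ 0 := fun h => hi (Fin.ext h)
          simp [this]
        · simp
      refine ⟨x, ?_, e⟩
      by_contra hneg
      have := h.pow_neg (not_le.1 hneg)
      rw [e] at this
      exact this.not_ge ha

omit [IsStrictOrderedRing M] in
theorem realize_sqrtAxiom (hle : ∀ a b : M, leM a b ↔ a ≤ b) :
    M ⊨ sqrtAxiom ↔ ∀ a : M, 0 ≤ a → ∃ x, x * x = a := by
  simp only [sqrtAxiom, Sentence.Realize, Formula.Realize, BoundedFormula.realize_all,
    BoundedFormula.realize_ex, BoundedFormula.realize_imp, realize_bdEq, realize_le,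
    snoc_one, snoc_two, realize_mul, realize_zero,
    Function.comp_apply, Term.realize_var, Sum.elim_inr, ← hle, leM]
  rfl

theorem realize_rootSentence_of_rcf (hle : ∀ a b : M, leM a b ↔ a ≤ b) (h : M ⊨ rcf) (n : ℕ) :
    M ⊨ rootSentence n := by
  rw [realize_rootSentence]
  rintro y ⟨⟨x, z, -, hx, -⟩, -⟩
  obtain ⟨k, hk, rfl, -⟩ := (powRel_iff hle n _ _ _).1 hx
  simp only [ltM_iff hle, powRel_iff hle]
  by_cases h1 : 1 ≤ k
  · obtain ⟨r, -, hr⟩ := exists_root_of_rcf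
      ((realize_sqrtAxiom hle).1 (h.realize_of_mem _ (.inl (.inr rfl))))
      (fun d hd => h.realize_of_mem _ (.inr ⟨d, hd, rfl⟩)) k h1 (1 + 1) (by norm_num)
    exact .inr ⟨r, k, hk, rfl, hr⟩
  · obtain rfl : k = 0 := by omega
    exact .inl (by simp)

theorem exists_rcf_proof (n : ℕ) : Nonempty (Proof rcf (rootSentence n)) :=
  exists_proof_of_orderedField (fun _ h => .inl (.inl h)) _ fun _ _ _ _ hle hM =>
    realize_rootSentence_of_rcf hle hM n

end RealClosed

/-! ### A model without the axioms of large degree -/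

section SmallDegreeClosed

open Polynomial in
theorem exists_real_root_of_odd {q : ℝ[X]} (hq : q.Monic) (hd : Odd q.natDegree) :
    ∃ x, q.eval x = 0 := by
  have hpos : 0 < q.natDegree := hd.pos
  have h₁ := q.tendsto_atTop_of_leadingCoeff_nonneg (natDegree_pos_iff_degree_pos.1 hpos)
    (by rw [hq]; exact zero_le_one)
  have hn : (q.comp (-X)).natDegree = q.natDegree := by
    rw [natDegree_comp, natDegree_neg, natDegree_X, mul_one]
  have hl : (q.comp (-X)).leadingCoeff = -1 := by
    rw [leadingCoeff_comp (by rw [natDegree_neg, natDegree_X]; exact one_ne_zero), hq.leadingCoeff,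
      leadingCoeff_neg, leadingCoeff_X, hd.neg_one_pow, one_mul]
  have h₂ := (q.comp (-X)).tendsto_atBot_of_leadingCoeff_nonpos
    (natDegree_pos_iff_degree_pos.1 (hn ▸ hpos)) (by rw [hl]; norm_num)
  obtain ⟨u, hu⟩ := (h₁.eventually (eventually_ge_atTop 0)).exists
  obtain ⟨v, hv⟩ := (h₂.eventually (eventually_le_atBot 0)).exists
  rw [eval_comp, eval_neg, eval_X] at hv
  exact mem_range_of_exists_le_of_exists_ge q.continuous ⟨_, hv⟩ ⟨_, hu⟩

open Polynomial in
/-- For an odd prime `p` there is a field of real numbers that contains no `p`-th root of `2` but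
contains every real root of a monic polynomial of degree less than `p` over it. -/
theorem exists_subfield {p : ℕ} (hp : p.Prime) (hodd : Odd p) : ∃ F : Subfield ℝ,
    (∀ b : F, b ^ p ≠ 2) ∧
    ∀ (q : F[X]) (x : ℝ), q.Monic → q.natDegree < p → aeval x q = 0 → x ∈ F := by
  obtain ⟨r, hr0, hr⟩ : ∃ r : ℝ, 0 < r ∧ r ^ p = 2 :=
    ⟨2 ^ ((p : ℝ)⁻¹), by positivity, Real.rpow_inv_natCast_pow (by norm_num) hp.ne_zero⟩
  have hroot {F : Subfield ℝ} (hF : r ∉ F) (b : F) : b ^ p ≠ 2 := fun hb => by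
    have hb' : (b : ℝ) ^ p = r ^ p := by
      rw [hr]
      exact (map_pow (algebraMap F ℝ) b p).symm.trans
        ((congrArg (algebraMap F ℝ) hb).trans (map_ofNat (algebraMap F ℝ) 2))
    rw [hodd.strictMono_pow.injective.eq_iff] at hb'
    exact hF (hb' ▸ b.2)
  have hbot : r ∉ (⊥ : Subfield ℝ) := by
    intro h
    obtain ⟨s, hs⟩ : ∃ s : ℚ, (s : ℝ) = r := by
      have : r ∈ (algebraMap ℚ ℝ).fieldRange := (bot_le : (⊥ : Subfield ℝ) ≤ _) h
      simpa using this
    have : Irrational r := irrational_nrt_of_notint_nrt p 2 (by rw [hr]; norm_num) (by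
      rintro ⟨y, hy⟩
      have h2 : y ^ p = 2 := by
        have : (y : ℝ) ^ p = 2 := by rw [← hy, hr]
        exact_mod_cast this
      have hy2 : 1 < y := by
        by_contra hle
        have hy0 : (0 : ℝ) < y := hy ▸ hr0
        have hy0 : 0 < y := by exact_mod_cast hy0
        obtain rfl : y = 1 := by omega
        simp at h2
      have : y ^ 2 ≤ y ^ p := pow_le_pow_right₀ hy2.le hp.two_le
      nlinarith) hp.pos
    exact this ⟨s, hs⟩
  obtain ⟨F, -, hF⟩ := zorn_le_nonempty₀ {F : Subfield ℝ | r ∉ F} (fun c hc hchain K hK =>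
    ⟨sSup c, fun h => by
      obtain ⟨s, hs, hrs⟩ := (Subfield.mem_sSup_of_directedOn ⟨K, hK⟩ hchain.directedOn).1 h
      exact hc hs hrs, fun s hs => le_sSup hs⟩) ⊥ hbot
  refine ⟨F, hroot hF.prop, fun q x hq hdeg hx => ?_⟩
  by_contra hxF
  -- by maximality the root of `2`, which has degree `p`, lies in an extension of smaller degree
  have hint : IsIntegral F x := ⟨q, hq, hx⟩
  let K := IntermediateField.adjoin F {x}
  have hle : F ≤ K.toSubfield := fun y hy => K.algebraMap_mem ⟨y, hy⟩
  have hxK : x ∈ K := IntermediateField.mem_adjoin_simple_self F x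
  have hrK : r ∈ K := by
    by_contra hrK
    exact hxF (hF.le_of_ge (y := K.toSubfield) hrK hle hxK)
  have hfin : FiniteDimensional F K := IntermediateField.adjoin.finiteDimensional hint
  have hK : Module.finrank F K < p := by
    rw [IntermediateField.adjoin.finrank hint]
    exact (natDegree_le_natDegree (minpoly.min F x hq hx)).trans_lt hdeg
  have hmin : (minpoly F (⟨r, hrK⟩ : K)).natDegree = p := by
    rw [← minpoly.eq_of_irreducible_of_monic (p := X ^ p - C (2 : F))
      (X_pow_sub_C_irreducible_of_prime hp (hroot hF.prop)) _ (monic_X_pow_sub_C _ hp.ne_zero)]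
    · exact natDegree_X_pow_sub_C
    · apply Subtype.ext
      have h2 : algebraMap F ℝ 2 = 2 := map_ofNat _ 2
      simp [hr, h2]
  have := minpoly.natDegree_le (A := F) (⟨r, hrK⟩ : K)
  omega

end SmallDegreeClosed

section Independence

attribute [local instance] structureOf

open Polynomial in
theorem exists_root_mem {p : ℕ} {F : Subfield ℝ}
    (hF : ∀ (q : F[X]) (x : ℝ), q.Monic → q.natDegree < p → aeval x q = 0 → x ∈ F) {d : ℕ}
    (hd : Odd d) (hdp : d < p) (a : Fin d → F) : ∃ x : F, x ^ d + ∑ i, a i * x ^ (i : ℕ) = 0 := by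
  let s : F[X] := ∑ i : Fin d, C (a i) * X ^ (i : ℕ)
  have hs : s.degree < d := by
    refine (degree_sum_le _ _).trans_lt ((Finset.sup_lt_iff (WithBot.bot_lt_coe d)).2 fun i _ => ?_)
    exact (degree_C_mul_X_pow_le _ _).trans_lt (WithBot.coe_lt_coe.2 i.2)
  have hmonic : (X ^ d + s).Monic := monic_X_pow_add hs
  have hdeg : (X ^ d + s).natDegree = d := by
    exact natDegree_eq_of_degree_eq_some ((degree_add_eq_left_of_degree_lt
      (by rwa [degree_X_pow])).trans (degree_X_pow d))
  obtain ⟨x, hx⟩ := exists_real_root_of_odd (hmonic.map (algebraMap F ℝ))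
    (by rwa [hmonic.natDegree_map, hdeg])
  rw [eval_map_algebraMap] at hx
  refine ⟨⟨x, hF _ x hmonic (hdeg.symm ▸ hdp) hx⟩, Subtype.ext ?_⟩
  simp only [s, map_add, map_sum, map_mul, map_pow, aeval_X, aeval_C] at hx
  push_cast
  exact hx

/-- `rcfMinus` holds in an ordered field whose order is defined by squares. -/
theorem models_rcfMinus {M : Type} [Field M] [LinearOrder M] [IsStrictOrderedRing M]
    (hle : ∀ a b : M, leM a b ↔ a ≤ b) : M ⊨ rcfMinus := by
  have hF : ∀ φ ∈ fieldAxioms, M ⊨ φ := by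
    simp only [fieldAxioms, Set.mem_insert_iff, Set.mem_singleton_iff,
      forall_eq_or_imp, forall_eq, Sentence.Realize, Formula.Realize, BoundedFormula.realize_all,
      BoundedFormula.realize_ex, BoundedFormula.realize_imp, BoundedFormula.realize_not,
      realize_bdEq, snoc_one, snoc_two, snoc_three, realize_add, realize_mul, realize_zero,
      realize_one, Function.comp_apply, Term.realize_var, Sum.elim_inr]
    exact ⟨add_assoc, add_comm, add_zero, fun a => ⟨-a, add_neg_cancel a⟩, mul_assoc, mul_comm,
      mul_one, fun a ha => ⟨a⁻¹, mul_inv_cancel₀ ha⟩, mul_add, zero_ne_one⟩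
  have hO : ∀ φ ∈ orderAxioms, M ⊨ φ := by
    have hle' (a b : M) : (∃ z, a + z * z = b) ↔ a ≤ b := hle a b
    simp only [orderAxioms, Set.mem_insert_iff, Set.mem_singleton_iff,
      forall_eq_or_imp, forall_eq, Sentence.Realize, Formula.Realize, BoundedFormula.realize_all,
      BoundedFormula.realize_imp, BoundedFormula.realize_inf, BoundedFormula.realize_sup,
      realize_bdEq, realize_le, hle', snoc_one, snoc_two, snoc_three, realize_add, realize_mul,
      realize_zero, Function.comp_apply, Term.realize_var, Sum.elim_inr]
    exact ⟨le_refl, fun a b h => le_antisymm h.1 h.2, fun a b c h => h.1.trans h.2, le_total,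
      fun a b c h => add_le_add_left h c, fun a b h => mul_nonneg h.1 h.2⟩
  exact ⟨fun {φ} hφ => hφ.elim (hF φ) (hO φ)⟩

/-- The exponent `p` satisfies `Hyp_n` in every subfield of `ℝ` in which `leM` is the order. -/
theorem hypRel_of_subfield {p : ℕ} (hp : 2 ≤ p) {F : Subfield ℝ} {n : ℕ} (hpn : p ≤ 2 ^ 2 ^ n)
    (hle : ∀ a b : F, leM a b ↔ a ≤ b) : HypRel (PowRel F n) ltM (p : F) := by
  have hpow (x z : F) : PowRel F n x p z ↔ x ^ p = z := by
    rw [powRel_iff hle]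
    refine ⟨?_, fun h => ⟨p, hpn, rfl, h⟩⟩
    rintro ⟨k, -, hk, h⟩
    obtain rfl : p = k := by exact_mod_cast hk
    exact h
  have hp0 : p ≠ 0 := by omega
  -- the `p`-th powers of rational numbers are dense
  have dense (c₁ c₂ : F) (h₁ : 1 ≤ c₁) (h : c₁ < c₂) : ∃ x : F, 1 < x ∧ c₁ < x ^ p ∧ x ^ p < c₂ := by
    have h₁' : (1 : ℝ) ≤ c₁ := h₁
    have h' : (c₁ : ℝ) < c₂ := h
    have hr (c : ℝ) (hc : 0 ≤ c) : (c ^ ((p : ℝ)⁻¹)) ^ p = c := Real.rpow_inv_natCast_pow hc hp0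
    obtain ⟨q, hq₁, hq₂⟩ := exists_rat_btwn (Real.rpow_lt_rpow (by positivity) h'
      (by positivity : (0 : ℝ) < (p : ℝ)⁻¹))
    have hs : (1 : ℝ) ≤ (c₁ : ℝ) ^ ((p : ℝ)⁻¹) := Real.one_le_rpow h₁' (by positivity)
    have e : (((q : F) : F) : ℝ) = q := by simp
    have e' : ((((q : F)) ^ p : F) : ℝ) = (q : ℝ) ^ p := by simp
    refine ⟨q, ?_, ?_, ?_⟩
    · change (1 : ℝ) < ((q : F) : ℝ)
      rw [e]; linarith
    · change (c₁ : ℝ) < (((q : F) ^ p : F) : ℝ)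
      rw [e', ← hr c₁ (by linarith)]
      exact pow_lt_pow_left₀ hq₁ (by linarith) hp0
    · change (((q : F) ^ p : F) : ℝ) < c₂
      rw [e', ← hr c₂ (by linarith)]
      exact pow_lt_pow_left₀ hq₂ (by linarith) hp0
  simp only [HypRel, hpow, ltM_iff hle, hle]
  refine ⟨?_, ?_, ?_⟩
  · obtain ⟨x, hx, -, hx₂⟩ := dense 1 (1 + 1) le_rfl (by norm_num)
    exact ⟨x, x ^ p, hx, rfl, hx₂.le⟩
  · rintro x x₁ ⟨hx, hx₁⟩ _ _ ⟨rfl, rfl⟩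
    exact ⟨lt_self_pow₀ hx (by omega), lt_of_pow_lt_pow_left₀ p (by linarith)⟩
  · rintro c₁ c₂ ⟨h₁, h₂⟩ hne
    rcases lt_or_gt_of_ne hne with h | h
    · obtain ⟨x, hx, hx₁, hx₂⟩ := dense c₁ c₂ h₁.le h
      exact ⟨x, x ^ p, rfl, .inl ⟨hx₁, hx₂⟩, hx⟩
    · obtain ⟨x, hx, hx₁, hx₂⟩ := dense c₂ c₁ h₂.le h
      exact ⟨x, x ^ p, rfl, .inr ⟨hx₁, hx₂⟩, hx⟩

open Polynomial in
/-- For every odd prime `p ≤ 2 ^ (2 ^ n)` there is a structure that refutes `Root_n` and satisfies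
all the axioms of `rcf` except those for the degrees `≥ p`. -/
theorem exists_countermodel {p : ℕ} (hp : p.Prime) (hodd : Odd p) {n : ℕ} (hpn : p ≤ 2 ^ 2 ^ n) :
    ∃ F : Subfield ℝ, ¬ F ⊨ rootSentence n ∧
      ∀ φ ∈ rcf, (∀ m, Odd m → p ≤ m → φ ≠ rootAxiom m) → F ⊨ φ := by
  obtain ⟨F, hF, hF'⟩ := exists_subfield hp hodd
  have h2p : 2 < p := by
    have := hp.two_le
    rcases hodd with ⟨k, rfl⟩
    omega
  have hsqrt (a : F) (ha : 0 ≤ a) : ∃ x : F, x * x = a := by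
    have hx : Real.sqrt a ∈ F := hF' (X ^ 2 - C a) _ (monic_X_pow_sub_C _ two_ne_zero)
      (by rwa [natDegree_X_pow_sub_C]) (by
        simp only [map_sub, map_pow, aeval_X, aeval_C, Real.sq_sqrt (show (0 : ℝ) ≤ a from ha)]
        exact sub_self _)
    exact ⟨⟨_, hx⟩, Subtype.ext (Real.mul_self_sqrt ha)⟩
  have hle (a b : F) : leM a b ↔ a ≤ b := by
    constructor
    · rintro ⟨z, rfl⟩
      exact le_add_of_nonneg_right (mul_self_nonneg z)
    · intro h
      obtain ⟨z, hz⟩ := hsqrt (b - a) (sub_nonneg.2 h)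
      exact ⟨z, by rw [hz]; ring⟩
  refine ⟨F, fun h => ?_, ?_⟩
  · rw [realize_rootSentence] at h
    rcases h p (hypRel_of_subfield hp.two_le hpn hle) with h | ⟨r, hr⟩
    · rw [ltM_iff hle] at h
      exact h (by exact_mod_cast hp.one_lt)
    · obtain ⟨k, -, hk, hr⟩ := (powRel_iff hle _ _ _ _).1 hr
      obtain rfl : p = k := by exact_mod_cast hk
      exact hF r (hr.trans one_add_one_eq_two)
  · rintro φ ((h | rfl) | ⟨d, hd, rfl⟩) hφ
    · exact (models_rcfMinus hle).realize_of_mem φ h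
    · exact (realize_sqrtAxiom hle).2 hsqrt
    · exact (realize_rootAxiom d).2
        (exists_root_mem hF' hd (not_le.1 fun h => hφ d hd h rfl))

/-- Every proof of `Root_n` uses an axiom of degree at least `p`, for a prime `p` between
`2 ^ (2 ^ n - 1)` and `2 ^ (2 ^ n)`. -/
theorem exists_mem_usedAxioms {n : ℕ} (hn : 1 ≤ n) (d : Proof rcf (rootSentence n)) :
    ∃ m : ℕ, Odd m ∧ rootAxiom m ∈ d.usedAxioms ∧ 2 ^ (2 ^ n - 1) < m := by
  obtain ⟨p, hp, hlt, hle⟩ := Nat.exists_prime_lt_and_le_two_mul (2 ^ (2 ^ n - 1)) (by positivity)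
  have hpow : 2 * 2 ^ (2 ^ n - 1) = 2 ^ 2 ^ n := by
    rw [← pow_succ', Nat.sub_add_cancel Nat.one_le_two_pow]
  have h2 : 2 ≤ 2 ^ (2 ^ n - 1) := by
    have : 2 ^ 1 ≤ 2 ^ n := Nat.pow_le_pow_right (by norm_num) hn
    calc 2 = 2 ^ 1 := rfl
      _ ≤ _ := Nat.pow_le_pow_right (by norm_num) (by omega)
  obtain ⟨F, hF, hF'⟩ := exists_countermodel hp (hp.odd_of_ne_two (by omega)) (n := n) (by omega)
  by_contra hcon
  push Not at hcon
  refine hF ((realize_ofSentence _ fun _ => 0).1 (d.sound (fun ψ hψ => ?_) _ (by simp)))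
  refine hF' ψ (d.usedAxioms_subset hψ) fun m hm hpm h => ?_
  have := hcon m hm (h ▸ hψ)
  omega

/-! ### The size of the odd-degree axioms -/

theorem termSize_foldl_add {α : Type} (l : List (lang.Term α)) (t : lang.Term α) :
    termSize t + l.length ≤ termSize (l.foldl (· + ·) t) := by
  induction l generalizing t with
  | nil => simp
  | cons s l ih =>
    have h : termSize (t + s) = 1 + (termSize t + termSize s) := by
      change 1 + ∑ i : Fin 2, termSize (![t, s] i) = _
      rw [Fin.sum_univ_two]; rfl
    have := ih (t + s)
    simp only [List.length_cons, List.foldl_cons]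
    omega

theorem le_formulaSize_rootAxiom (m : ℕ) : m ≤ formulaSize (rootAxiom m) := by
  have h : m ≤ termSize (monicPoly m) := by
    refine le_trans ?_ (termSize_foldl_add _ _)
    simp
  rw [rootAxiom, formulaSize_alls, formulaSize_ex]
  change m ≤ 1 + termSize (monicPoly m) + termSize 0 + 5 + m
  omega

theorem lt_size_of_rcf_proof (n : ℕ) (d : Proof rcf (rootSentence n)) :
    2 ^ (2 ^ n - 1) < d.size := by
  rcases Nat.eq_zero_or_pos n with rfl | hn
  · have h₁ := d.formulaSize_lt
    have h₂ := formulaSize_pos (ofSentence (rootSentence 0))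
    simp only [pow_zero, Nat.sub_self]
    omega
  · obtain ⟨m, -, hm, hlt⟩ := exists_mem_usedAxioms hn d
    exact hlt.trans ((le_formulaSize_rootAxiom m).trans_lt (d.formulaSize_lt_of_mem hm))

end Independence

/-! ### The speedup -/

theorem exists_eval_le_pow (p : Polynomial ℕ) : ∃ D : ℕ, ∀ n : ℕ, 2 ≤ n → p.eval n ≤ n ^ D := by
  induction p using Polynomial.induction_on' with
  | add p q hp hq =>
    obtain ⟨D, hD⟩ := hp
    obtain ⟨E, hE⟩ := hq
    refine ⟨max D E + 1, fun n hn => ?_⟩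
    have h₁ := (hD n hn).trans (Nat.pow_le_pow_right (by omega) (le_max_left D E))
    have h₂ := (hE n hn).trans (Nat.pow_le_pow_right (by omega) (le_max_right D E))
    rw [Polynomial.eval_add, pow_succ]
    nlinarith
  | monomial k c =>
    refine ⟨c + k, fun n hn => ?_⟩
    rw [Polynomial.eval_monomial, pow_add]
    exact Nat.mul_le_mul_right _ (Nat.lt_pow_self (by omega)).le

theorem eval_mono (p : Polynomial ℕ) : Monotone fun n : ℕ => p.eval n := by
  intro m n h
  simp only [Polynomial.eval_eq_sum_range]
  gcongr

/-- If `a` grows at most polynomially and a power of `b` grows at least doubly exponentially, then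
`b` is doubly exponential in a power of `a`. -/
theorem exists_eventually_le {a b : ℕ → ℕ} {D E : ℕ} (ha : ∀ᶠ n in atTop, a n ≤ n ^ E)
    (hb : ∀ n, 2 ^ (2 ^ n - 1) ≤ max (b n) 2 ^ D) :
    ∃ ε : ℝ, 0 < ε ∧ ∀ᶠ n in atTop, (2 : ℝ) ^ ((2 : ℝ) ^ ((a n : ℝ) ^ ε)) ≤ b n := by
  -- With this exponent, `a n ^ ε ≤ √n`.
  refine ⟨(2 * (E + 1 : ℝ))⁻¹, by positivity, ?_⟩
  filter_upwards [ha, eventually_ge_atTop ((D + 2) ^ 2), eventually_ge_atTop 1] with n ha hn hn1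
  have hn1' : (1 : ℝ) ≤ n := by exact_mod_cast hn1
  have hsqrt : (a n : ℝ) ^ (2 * (E + 1 : ℝ))⁻¹ ≤ √n := by
    have h : (a n : ℝ) ≤ (n : ℝ) ^ ((E + 1 : ℕ) : ℝ) := by
      rw [Real.rpow_natCast]
      exact_mod_cast ha.trans (Nat.pow_le_pow_right hn1 (Nat.le_succ E))
    refine (Real.rpow_le_rpow (by positivity) h (by positivity)).trans_eq ?_
    rw [← Real.rpow_mul (by positivity), Real.sqrt_eq_rpow]
    congr 1
    push_cast
    field_simp
  have hs : (D + 2 : ℝ) ≤ √n := Real.le_sqrt_of_sq_le (by exact_mod_cast hn)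
  have hsq : √n * √n = n := Real.mul_self_sqrt (by positivity)
  refine (Real.rpow_le_rpow_of_exponent_le one_le_two
    (Real.rpow_le_rpow_of_exponent_le one_le_two hsqrt)).trans ?_
  by_contra! hlt
  have hmax : ((max (b n) 2 : ℕ) : ℝ) ≤ (2 : ℝ) ^ ((2 : ℝ) ^ √n) := by
    rw [Nat.cast_max]
    refine max_le hlt.le ?_
    calc ((2 : ℕ) : ℝ) = (2 : ℝ) ^ (1 : ℝ) := by norm_num
      _ ≤ _ := Real.rpow_le_rpow_of_exponent_le one_le_two
        (Real.one_le_rpow one_le_two (Real.sqrt_nonneg _))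
  have h₁ : (2 : ℝ) ^ ((2 ^ n - 1 : ℕ) : ℝ) ≤ (2 : ℝ) ^ ((2 : ℝ) ^ √n * D) := by
    rw [Real.rpow_mul zero_le_two, Real.rpow_natCast, Real.rpow_natCast]
    refine le_trans ?_ (pow_le_pow_left₀ (by positivity) hmax D)
    exact_mod_cast hb n
  have h₂ := (Real.rpow_le_rpow_left_iff one_lt_two).1 h₁
  have h₃ : (2 : ℝ) ^ ((n : ℝ) - 1) ≤ ((2 ^ n - 1 : ℕ) : ℝ) := by
    rw [Real.rpow_sub_one two_ne_zero, Real.rpow_natCast, Nat.cast_sub Nat.one_le_two_pow]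
    have : (2 : ℝ) ^ 1 ≤ 2 ^ n := pow_le_pow_right₀ one_le_two hn1
    push_cast
    linarith
  have h₄ : (2 : ℝ) ^ √n * D ≤ (2 : ℝ) ^ (√n + D) := by
    rw [Real.rpow_add two_pos, Real.rpow_natCast]
    have : (D : ℝ) ≤ 2 ^ D := by exact_mod_cast (Nat.lt_two_pow_self (n := D)).le
    gcongr
  have h₅ := (Real.rpow_le_rpow_left_iff one_lt_two).1 ((h₃.trans h₂).trans h₄)
  nlinarith

/-- Provable sentences have finite length in every measure that is polynomially equivalent to
natural deduction. -/
theorem exists_eq_coe_of_proof {ℓ : LengthMeasure lang} (hℓ : PolyEquivalent ℓ proofLength)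
    {T : lang.Theory} {φ : lang.Sentence} (h : Nonempty (Proof T φ)) : ∃ k : ℕ, ℓ T φ = k := by
  obtain ⟨q, hq⟩ := hℓ
  obtain ⟨d⟩ := h
  have := (hq T φ d.size).2 (iInf_le _ d)
  obtain ⟨k, hk⟩ := ENat.ne_top_iff_exists.1 (ne_top_of_le_ne_top (ENat.natCast_ne_top _) this)
  exact ⟨k, hk.symm⟩

/-- The lengths of the proofs of `Root_n` in `tarski` are at most polynomial, and a power of those in
`rcf` is at least doubly exponential. This is not affected by a polynomial change of the measure of
proof length. -/
theorem exists_hasSpeedupVia {ℓ : LengthMeasure lang} (hℓ : PolyEquivalent ℓ proofLength) :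
    ∃ ε : ℝ, 0 < ε ∧ HasSpeedupVia ℓ (fun x : ℝ => (2 : ℝ) ^ ((2 : ℝ) ^ (x ^ ε)))
      tarski rcf rootSentence := by
  obtain ⟨p, hp⟩ := exists_polynomial_proof
  choose a ha using fun n => exists_eq_coe_of_proof (T := tarski) hℓ ⟨(hp n).2.choose⟩
  choose b hb using fun n => exists_eq_coe_of_proof hℓ (exists_rcf_proof n)
  obtain ⟨q, hq⟩ := hℓ
  obtain ⟨E, hE⟩ := exists_eval_le_pow (q.comp p)
  obtain ⟨D, hD⟩ := exists_eval_le_pow q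
  have hlower : ∀ n, n ≤ q.eval (a n) := fun n => by
    have h := (hq tarski (rootSentence n) (a n)).1 (ha n).le
    refine Nat.cast_le.1 (le_trans (le_iInf fun d => Nat.cast_le.2 ?_) h)
    have h₁ := d.formulaSize_lt
    rw [formulaSize_ofSentence] at h₁
    exact (le_formulaSize_rootSentence n).trans h₁.le
  have hupper : ∀ᶠ n in atTop, a n ≤ n ^ E := by
    filter_upwards [eventually_ge_atTop 2] with n hn
    obtain ⟨d, hd⟩ := (hp n).2
    have h := (hq tarski (rootSentence n) (p.eval n)).2 ((iInf_le _ d).trans (Nat.cast_le.2 hd))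
    rw [ha, Nat.cast_le] at h
    refine h.trans (le_of_eq_of_le ?_ (hE n hn))
    rw [Polynomial.eval_comp]
  have hlarge : ∀ n, 2 ^ (2 ^ n - 1) ≤ max (b n) 2 ^ D := fun n => by
    have h := (hq rcf (rootSentence n) (b n)).1 (hb n).le
    refine le_trans (Nat.cast_le.1 (le_trans (le_iInf fun d => Nat.cast_le.2 ?_) h))
      ((eval_mono q (le_max_left (b n) 2)).trans (hD _ (le_max_right _ _)))
    exact (lt_size_of_rcf_proof n d).le
  obtain ⟨ε, hε, h⟩ := exists_eventually_le hupper hlarge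
  refine ⟨ε, hε, a, b, fun n => ⟨ha n, hb n⟩, tendsto_atTop.2 fun k => ?_, h⟩
  filter_upwards [eventually_gt_atTop (q.eval k)] with n hn
  by_contra! hlt
  exact absurd ((hlower n).trans (eval_mono q hlt.le)) (not_le.2 hn)

end SpeedupRCF

theorem mainTheorem2 :
    (∃ p : Polynomial ℕ, ∀ n : ℕ,
      SpeedupRCF.formulaSize (SpeedupRCF.rootSentence n) ≤ p.eval n ∧
      ∃ d : SpeedupRCF.Proof SpeedupRCF.tarski (SpeedupRCF.rootSentence n), d.size ≤ p.eval n) ∧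
    (∀ n : ℕ, Nonempty (SpeedupRCF.Proof SpeedupRCF.rcf (SpeedupRCF.rootSentence n))) ∧
    (∀ n : ℕ, 1 ≤ n →
      ∀ d : SpeedupRCF.Proof SpeedupRCF.rcf (SpeedupRCF.rootSentence n),
        ∃ m : ℕ, Odd m ∧ SpeedupRCF.rootAxiom m ∈ d.usedAxioms ∧ 2 ^ (2 ^ n - 1) < m ∧
          2 ^ (2 ^ n - 1) ≤ SpeedupRCF.formulaSize (SpeedupRCF.rootAxiom m)) ∧
    (∀ n : ℕ, ∀ d : SpeedupRCF.Proof SpeedupRCF.rcf (SpeedupRCF.rootSentence n),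
      2 ^ (2 ^ n - 1) < d.size) ∧
    (∀ ℓ : SpeedupRCF.LengthMeasure SpeedupRCF.lang,
      SpeedupRCF.PolyEquivalent ℓ SpeedupRCF.proofLength →
      ∃ ε : ℝ, 0 < ε ∧
        SpeedupRCF.HasSpeedupVia ℓ (fun x : ℝ => (2 : ℝ) ^ ((2 : ℝ) ^ (x ^ ε)))
          SpeedupRCF.tarski SpeedupRCF.rcf SpeedupRCF.rootSentence) := by
  refine ⟨SpeedupRCF.exists_polynomial_proof, SpeedupRCF.exists_rcf_proof, fun n hn d => ?_,
    SpeedupRCF.lt_size_of_rcf_proof, fun ℓ hℓ => SpeedupRCF.exists_hasSpeedupVia hℓ⟩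
  obtain ⟨m, hodd, hmem, hlt⟩ := SpeedupRCF.exists_mem_usedAxioms hn d
  exact ⟨m, hodd, hmem, hlt, hlt.le.trans (SpeedupRCF.le_formulaSize_rootAxiom m)⟩
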